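/- Setting. Let $G$ be a connected semisimple real Lie group without compact factors, $\Gamma$ an irreducible lattice in $G$, $X=G/\Gamma$, and $\mu$ the $G$-invariant probability measure on $X$. Write $\varphi\circ g$ for $x\mapsto\varphi(gx)$ and $\nu(\varphi)=\int_X\varphi\,d\nu$. Let $\mathcal A=\mathbb C+C_c^\infty(X)$. Let $U$ be a closed connected subgroup of $G$ with Lie algebra $\mathfrak u$, and let $T$ be a closed connected abelian subgroup of $G$ that normalizes $U$ and whose adjoint action on $\mathfrak u$ is proper and diagonalizable, say $\mathrm{Ad}(t)b_i=\alpha_i(t)b_i$ for a basis $(b_i)$ of $\mathfrak u$ and $\alpha_i\in\mathrm{Hom}(T,\mathbb R^*)$. Let $\|w\|$ be the $\ell^\infty$-norm on $\mathfrak u$ in this basis and $\|t\|_*=\max_i\max(|\alpha_i(t)|,|\alpha_i(t)|^{-1})$ for $t\in T$. Assume that the matrix entries of $\mathrm{Ad}(\exp w)$ on $\mathrm{Lie}(G)$ are $O(\max(1,\|w\|)^{p})$ for $w\in\mathfrak u$, for some $p$. Let $\nu$ be a $U$-invariant, $U$-ergodic Borel probability measure on $X$ with discrete spectrum: $L^2(\nu)$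 has an orthonormal basis $\{\psi_\xi\}_{\xi\in\Xi}$ with $\psi_\xi\circ\exp(w)=\xi(w)\psi_\xi$ $\nu$-a.e. for all $w\in\mathfrak u$, where each $\xi$ is a unitary character on $\mathfrak u$. For a bounded measurable $\varphi$ put $\|\varphi\|_{W(\nu)}=\sum_{\xi\in\Xi}|\nu(\varphi\,\overline{\psi_\xi})|$, and let $W(\nu)$ be the set of bounded measurable $\varphi$ with $\|\varphi\|_{W(\nu)}<\infty$. Norms. Let $(S_d)_{d\ge1}$ be one of the following families of norms on $\mathcal A$: (i) $S_d=\|\cdot\|_{C^k}$ for all $d$, with a fixed $k\ge1$; (ii) $S_d(\varphi)=\max\big(\|\varphi\|_{C^0},\|\varphi\|_{Lip},\|\varphi\|_{L^{2^d}_k}\big)$ with a fixed $k$, where $\|\cdot\|_{Lip}$ is the Lipschitz norm for the Riemannian metric on $X$ induced by a right-invariant metric on $G$, and $\|\cdot\|_{L^p_k}$ is the $L^p(\mu)$-Sobolev norm of order $k$; derivatives are taken along a fixed basis of $\mathrm{Lie}(G)$. Assume that there are a subset $T_+\subset T$, a function $\rho:T_+\to[1,\infty)$, and constants $D_o\ge1$,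 $\delta_o\in(0,1)$, $C\ge1$, $0<c<1/2$ such that $$|\nu(\varphi\circ t)-\mu(\varphi)|\le D_o\,\rho(t)^{-\delta_o}S_1(\varphi)\qquad(\varphi\in\mathcal A,\ t\in T_+),$$ $$|\mu(\varphi_1\circ\exp(w)\cdot\varphi_2)-\mu(\varphi_1)\mu(\varphi_2)|\le C\max(1,\|w\|)^{-c}S_1(\varphi_1)S_1(\varphi_2)\qquad(\varphi_1,\varphi_2\in\mathcal A,\ w\in\mathfrak u).$$ For $\underline t=(t_1,\dots,t_r)\in T_+^r$ let $\Delta_1(\underline t)=\rho(t_1)$ and, for $r\ge2$, $\Delta_r(\underline t)=\min\big(\min_i\rho(t_i),\ \min_{i\ne j}\|t_it_j^{-1}\|_*\big)$. Corollary. There exist $H_1,H_2>0$ and $\lambda>1$ such that for all $r\ge1$, $\varphi_o\in W(\nu)$, $\varphi_1,\dots,\varphi_r\in\mathcal A$ and $\underline t\in T_+^r$ satisfying $\Delta_r(\underline t)>H_2^{(r-1)!\,r!\,\lambda^r}$, $$\Big|\nu\Big(\varphi_o\prod_{i=1}^r\varphi_i\circ t_i\Big)-\nu(\varphi_o)\prod_{i=1}^r\mu(\varphi_i)\Big|\le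 rH_1\,\Delta_r(\underline t)^{-\frac{1}{(r!)^2\lambda^r}}\,\|\varphi_o\|_{W(\nu)}\prod_{i=1}^rS_{r+1}(\varphi_i).$$ -/

import Mathlib

open MeasureTheory Set
open scoped Manifold ContDiff ENNReal ComplexConjugate

noncomputable section

namespace MultiEquidist

section LieGroups

variable {E : Type*} [NormedAddCommGroup E] [NormedSpace ℝ E]
  {G : Type*} [TopologicalSpace G] [ChartedSpace E G] [Group G]

variable (E G) in
/-- The Lie algebra of `G`: the tangent space at the identity. -/
abbrev Lie𝔤 : Type _ := GroupLieAlgebra 𝓘(ℝ, E) G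

open Classical in
/-- The exponential map: `exp v = γ 1`, where `γ` is the integral curve through `1` of the
left-invariant vector field defined by `v` (this curve exists on all of `ℝ` and is unique). -/
def lieExp (v : Lie𝔤 E G) : G :=
  if h : ∃ γ : ℝ → G, γ 0 = 1 ∧
      IsMIntegralCurve (I := 𝓘(ℝ, E)) γ (mulInvariantVectorField (I := 𝓘(ℝ, E)) v)
  then h.choose 1 else 1

/-- The adjoint action `Ad g`: the derivative at `1` of `x ↦ g x g⁻¹`. -/
def Ad (g : G) : Lie𝔤 E G →ₗ[ℝ] Lie𝔤 E G :=
  (mfderiv 𝓘(ℝ, E) 𝓘(ℝ, E) (fun x : G => g * x * g⁻¹) (1 : G) : E →L[ℝ] E).toLinearMap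

variable (E) in
/-- The Lie algebra `{w | exp (s w) ∈ U for all s}` of a closed subgroup `U`. For closed `U` this
set is a linear subspace, so that taking the span does not enlarge it. -/
def lieAlgOf (U : Subgroup G) : Submodule ℝ (Lie𝔤 E G) :=
  Submodule.span ℝ {w : Lie𝔤 E G | ∀ s : ℝ, lieExp (s • w) ∈ U}

variable (E G) in
/-- The Lie algebra of the (smooth) Lie group `G` is semisimple. -/
def IsSemisimpleLieGroup [FiniteDimensional ℝ E] [LieGroup 𝓘(ℝ, E) ∞ G] : Prop :=
  haveI : CompleteSpace E := FiniteDimensional.complete ℝ E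
  haveI : LieGroup 𝓘(ℝ, E) (minSmoothness ℝ 3) G :=
    LieGroup.of_le (n := ∞) (by
      rw [minSmoothness_of_isRCLikeNormedField]; exact ENat.LEInfty.out)
  LieAlgebra.IsSemisimple ℝ (GroupLieAlgebra 𝓘(ℝ, E) G)

variable (G) in
/-- `G` has no compact factors: no nontrivial compact connected normal subgroup. -/
def NoCompactFactors : Prop :=
  ∀ N : Subgroup G, N.Normal → IsCompact (N : Set G) → IsConnected (N : Set G) → N = ⊥

/-- `Γ` is irreducible: `Γ N` is dense in `G` for each nontrivial closed connected normal
subgroup `N` of `G`. -/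
def IsIrreducibleSubgroup (Γ : Subgroup G) : Prop :=
  ∀ N : Subgroup G, N.Normal → IsClosed (N : Set G) → IsConnected (N : Set G) → N ≠ ⊥ →
    Dense {g : G | ∃ γ ∈ Γ, ∃ n ∈ N, g = γ * n}

end LieGroups

section Norms

variable {E : Type*} [NormedAddCommGroup E] [NormedSpace ℝ E]
  {G : Type*} [TopologicalSpace G] [ChartedSpace E G] [Group G] {Γ : Subgroup G}
  {κ : Type*} [Fintype κ]

variable (E) in
/-- The algebra `ℂ + C_c^∞(G/Γ)`; a function on `G/Γ` is smooth if and only if its pull-back to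
`G` is smooth, because `G → G/Γ` is a smooth covering (`Γ` being discrete). -/
def smoothAlg (Γ : Subgroup G) : Set (G ⧸ Γ → ℂ) :=
  {φ | ∃ (c : ℂ) (f : G ⧸ Γ → ℂ), HasCompactSupport f ∧
    ContMDiff 𝓘(ℝ, E) 𝓘(ℝ, ℂ) ∞ (fun g : G => f (g : G ⧸ Γ)) ∧ φ = fun x => c + f x}

/-- The derivative of `φ` in the direction `Y` of the Lie algebra:
`(D_Y φ)(x) = d/ds φ(exp(s Y) x)` at `s = 0`. -/
def lieDeriv (Y : Lie𝔤 E G) (φ : G ⧸ Γ → ℂ) (x : G ⧸ Γ) : ℂ :=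
  deriv (fun s : ℝ => φ (lieExp (s • Y) • x)) 0

/-- Iterated derivatives `D_{e i₁} ⋯ D_{e iⱼ} φ` along a word in the basis `e`. -/
def wordDeriv (e : Module.Basis κ ℝ (Lie𝔤 E G)) : List κ → (G ⧸ Γ → ℂ) → (G ⧸ Γ → ℂ)
  | [], φ => φ
  | i :: l, φ => lieDeriv (e i) (wordDeriv e l φ)

/-- Words of length at most `k`. -/
abbrev Words (κ : Type*) (k : ℕ) : Type _ := Σ j : Fin (k + 1), (Fin (j : ℕ) → κ)

/-- The supremum norm. -/
def supNorm {X : Type*} (φ : X → ℂ) : ℝ := ⨆ x, ‖φ x‖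

/-- The `C^k` norm: the largest supremum norm of a derivative of order at most `k`. -/
def ckNorm (e : Module.Basis κ ℝ (Lie𝔤 E G)) (k : ℕ) (φ : G ⧸ Γ → ℂ) : ℝ :=
  ⨆ w : Words κ k, supNorm (wordDeriv e (List.ofFn w.2) φ)

/-- The `L^p` Sobolev norm of order `k`. -/
def sobolevNorm [MeasurableSpace (G ⧸ Γ)] (e : Module.Basis κ ℝ (Lie𝔤 E G))
    (μ : Measure (G ⧸ Γ)) (p : ℝ≥0∞) (k : ℕ) (φ : G ⧸ Γ → ℂ) : ℝ :=
  ∑ w : Words κ k, (eLpNorm (wordDeriv e (List.ofFn w.2) φ) p μ).toReal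

/-- The length of a tangent vector of `G` at `g` for the right-invariant Riemannian metric on `G`
for which the basis `e` of the Lie algebra is orthonormal. -/
def rightInvLength (e : Module.Basis κ ℝ (Lie𝔤 E G)) (g : G) (v : TangentSpace 𝓘(ℝ, E) g) :
    ℝ≥0∞ :=
  ENNReal.ofReal (Real.sqrt (∑ i, (e.repr
    ((mfderiv 𝓘(ℝ, E) 𝓘(ℝ, E) (fun x : G => x * g⁻¹) g : E →L[ℝ] E) v : E) i) ^ 2))

/-- The Riemannian distance on `G` of this metric. -/
def rightInvEDist (e : Module.Basis κ ℝ (Lie𝔤 E G)) (g h : G) : ℝ≥0∞ :=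
  letI : ∀ x : G, ENorm (TangentSpace 𝓘(ℝ, E) x) := fun x => ⟨rightInvLength e x⟩
  Manifold.riemannianEDist 𝓘(ℝ, E) g h

/-- The Riemannian distance on `G/Γ` of the induced metric. -/
def quotEDist (e : Module.Basis κ ℝ (Lie𝔤 E G)) (x y : G ⧸ Γ) : ℝ≥0∞ :=
  ⨅ (g : G) (h : G) (_ : (g : G ⧸ Γ) = x) (_ : (h : G ⧸ Γ) = y), rightInvEDist e g h

/-- The Lipschitz (semi)norm: the least Lipschitz constant of `φ` on `G/Γ`. -/
def lipNorm (e : Module.Basis κ ℝ (Lie𝔤 E G)) (φ : G ⧸ Γ → ℂ) : ℝ :=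
  sInf {L : ℝ | 0 ≤ L ∧ ∀ x y, ‖φ x - φ y‖ₑ ≤ ENNReal.ofReal L * quotEDist e x y}

/-- The norm `S_d(φ) = max (‖φ‖_{C^0}, ‖φ‖_{Lip}, ‖φ‖_{L^{2^d}_k})`. -/
def lipSobolevNorm [MeasurableSpace (G ⧸ Γ)] (e : Module.Basis κ ℝ (Lie𝔤 E G))
    (μ : Measure (G ⧸ Γ)) (k d : ℕ) (φ : G ⧸ Γ → ℂ) : ℝ :=
  max (supNorm φ) (max (lipNorm e φ) (sobolevNorm e μ (2 ^ d) k φ))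

end Norms

section Dynamics

variable {E : Type*} [NormedAddCommGroup E] [NormedSpace ℝ E]
  {G : Type*} [TopologicalSpace G] [ChartedSpace E G] [Group G] {Γ : Subgroup G}

/-- `ψ` is an orthonormal basis of `L²(ν)` consisting of eigenfunctions of `U`, with respect to
continuous unitary characters of the Lie algebra of `U`. -/
def IsEigenbasis [MeasurableSpace (G ⧸ Γ)] (ν : Measure (G ⧸ Γ)) (U : Subgroup G)
    {Ξ : Type*} (ψ : HilbertBasis Ξ ℂ (Lp ℂ 2 ν)) : Prop :=
  ∀ ξ : Ξ, ∃ χ : AddChar (lieAlgOf E U) Circle, Continuous χ ∧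
    ∀ w : lieAlgOf E U,
      (fun x => (ψ ξ : G ⧸ Γ → ℂ) (lieExp (w : Lie𝔤 E G) • x)) =ᵐ[ν]
        fun x => (χ w : ℂ) * (ψ ξ : G ⧸ Γ → ℂ) x

/-- The Fourier coefficient `ν(φ ψ̄_ξ)`. -/
def fourierCoeff {X : Type*} [MeasurableSpace X] {ν : Measure X} {Ξ : Type*}
    (ψ : HilbertBasis Ξ ℂ (Lp ℂ 2 ν)) (φ : X → ℂ) (ξ : Ξ) : ℂ :=
  ∫ x, φ x * conj ((ψ ξ : X → ℂ) x) ∂ν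

/-- The Wiener norm `∑_ξ |ν(φ ψ̄_ξ)|`. -/
def wienerNorm {X : Type*} [MeasurableSpace X] {ν : Measure X} {Ξ : Type*}
    (ψ : HilbertBasis Ξ ℂ (Lp ℂ 2 ν)) (φ : X → ℂ) : ℝ :=
  ∑' ξ, ‖fourierCoeff ψ φ ξ‖

/-- The Wiener algebra: bounded measurable functions with finite Wiener norm. -/
def wienerAlg {X : Type*} [MeasurableSpace X] {ν : Measure X} {Ξ : Type*}
    (ψ : HilbertBasis Ξ ℂ (Lp ℂ 2 ν)) : Set (X → ℂ) :=
  {φ | Measurable φ ∧ (∃ C : ℝ, ∀ x, ‖φ x‖ ≤ C) ∧ Summable fun ξ => ‖fourierCoeff ψ φ ξ‖}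

/-- The norm `‖t‖_* = max_α max(|α(t)|, |α(t)|⁻¹)` on `T`, for a family `α` of characters. -/
def starNorm {T : Type*} [Group T] {ι : Type*} (α : ι → (T →* ℝˣ)) (t : T) : ℝ :=
  ⨆ i, max |((α i t : ℝˣ) : ℝ)| |((α i t : ℝˣ) : ℝ)|⁻¹

/-- `Δ_r(t₁, …, t_r)`: it is `ρ(t₁)` for `r = 1`, and the minimum of all the `ρ(t_i)` and all the
`‖t_i t_j⁻¹‖_*` with `i ≠ j` for `r ≥ 2`. -/
def Delta {T : Type*} [Group T] {ι : Type*} (α : ι → (T →* ℝˣ)) (ρ : T → ℝ) {r : ℕ}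
    (t : Fin r → T) : ℝ :=
  if r ≤ 1 then ⨅ i, ρ (t i)
  else min (⨅ i, ρ (t i))
    (⨅ p : {p : Fin r × Fin r // p.1 ≠ p.2}, starNorm α (t p.1.1 * (t p.1.2)⁻¹))

end Dynamics

end MultiEquidist

end

/-! Expanding `φ₀` in the eigenbasis, with coefficients whose absolute values sum to the Wiener
norm, reduces the claim to a bound that is uniform over eigenfunctions `ψ` of `U` in place of `φ₀`
(`norm_integral_mul_sub_le`). That bound is proved by induction on the number `r` of functions
(`multipleBound`), with van der Corput's trick along a one-parameter subgroup of `U`.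

For `r ≥ 2` some weight `α` separates two of the `t i` by a factor of at least `Δ`. Let `t k` have
the largest `|α|`, and split `φ k` into its mean, which leaves `r - 1` functions, and a function of
mean zero. For the latter, let `u(y) = exp (y b)` with `b` the vector of weight `α`. The measure `ν`
is invariant under `u(y)`, and `t u(y) = u(α(t) y) t`; so a shift of `x` by `u(y)` shifts the
argument of `φ i` by `u(α(t i) y)` and multiplies `ψ` by a scalar of modulus one. Now average over
`K` values of `y`. The functions with `|α(t i)| ≤ |α(t k)| / Δ` hardly move and come out of the
average. For the set `I` of the other indices, Cauchy-Schwarz removes `ψ` and leaves correlations,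
which are again products over `I` of translated functions of the algebra. Since `I` is a proper
subset, the induction hypothesis with `ψ = 1` replaces them by products of `μ`-integrals, and off
the diagonal the factor of index `k` is `O(K ^ (-c))` by mixing. For `r = 1` the equidistribution
hypothesis takes the place of the induction hypothesis. This estimate is
`norm_integral_mul_prod_le_of_integral_eq_zero`.

The shifts enlarge the norms by a power of `K`, so `K` has to be a small power of `Δ`
(`exists_average_length`); this and the square root from Cauchy-Schwarz shrink the rate at each
step. Correlations are quadratic in `φ`, and the `L^q` norm of a product needs `L^(2q)` norms of the
factors: hence `S (d + 1)` bounds what happens in `S d`.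

All this rests on the few properties in `EquidistData`. They hold because conjugation acts on
one-parameter subgroups through `Ad` (`conj_oneParam`), the Lie algebra of the closed subgroup `U`
exponentiates into `U` (`oneParam_mem_of_mem_lieAlgOf`), derivatives of a translate involve `Ad`
polynomially (`IsInvariantSeminorm.wordDeriv_comp_smul_le`), and the Lipschitz norm is comparable
with the first derivatives. If the Lie algebra of `U` is zero there is no direction to average in;
then `U` is trivial and ergodicity makes every eigenfunction constant. -/

noncomputable section

set_option linter.unusedSectionVars false

namespace MultiEquidist

/-! ### The axioms of the equidistribution argument -/

section Abstract

variable {G X T ι J : Type*} [Group G] [MulAction G X] [MeasurableSpace X]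
  [Group T]

/-- The properties of the measures `μ` and `ν`, of the one-parameter groups `u i`, of the
translations `τ t` and of the norms `S d` on the algebra `𝒜` on which multiple equidistribution
rests. -/
structure EquidistData (μ ν : Measure X) (𝒜 : Set (X → ℂ)) (S : ℕ → (X → ℂ) → ℝ)
    (u : ι → ℝ → G) (τ : T → G) (α : ι → T →* ℝˣ) (Tplus : Set T) (ρ : T → ℝ)
    (M : ℝ) (A : ℕ) (C c D δ : ℝ) : Prop where
  one_le_M : 1 ≤ M
  one_le_C : 1 ≤ C
  c_pos : 0 < c
  c_lt : c < 1 / 2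
  one_le_D : 1 ≤ D
  δ_pos : 0 < δ
  meas : ∀ φ ∈ 𝒜, Measurable φ
  norm_le : ∀ φ ∈ 𝒜, ∀ d x, ‖φ x‖ ≤ S d φ
  mono : ∀ φ ∈ 𝒜, ∀ d, S d φ ≤ S (d + 1) φ
  sub_const : ∀ φ ∈ 𝒜, ∀ z : ℂ, (fun x => φ x - z) ∈ 𝒜 ∧
    ∀ d, S d (fun x => φ x - z) ≤ S d φ + ‖z‖
  corr : ∀ φ ∈ 𝒜, ∀ i s s' N, 1 ≤ N → |s| ≤ N → |s'| ≤ N →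
    (fun x => φ (u i s • x) * conj (φ (u i s' • x))) ∈ 𝒜 ∧
    ∀ d, S d (fun x => φ (u i s • x) * conj (φ (u i s' • x))) ≤ M * N ^ A * S (d + 1) φ ^ 2
  lip : ∀ φ ∈ 𝒜, ∀ i s x d, ‖φ (u i s • x) - φ x‖ ≤ M * |s| * S d φ
  conj_u : ∀ t i s, τ t * u i s = u i (((α i t : ℝˣ) : ℝ) * s) * τ t
  pres : ∀ i s, MeasurePreserving (fun x : X => u i s • x) ν ν
  mix : ∀ φ ∈ 𝒜, ∫ x, φ x ∂μ = 0 → ∀ i s s',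
    ‖∫ x, φ (u i s • x) * conj (φ (u i s' • x)) ∂μ‖ ≤ C * max 1 |s - s'| ^ (-c) * S 1 φ ^ 2
  equi : ∀ φ ∈ 𝒜, ∀ t ∈ Tplus,
    ‖∫ x, φ (τ t • x) ∂ν - ∫ x, φ x ∂μ‖ ≤ D * ρ t ^ (-δ) * S 1 φ

/-- `ψ` is a square integrable function of norm at most `1` which is an eigenfunction of the
one-parameter groups `u i`. -/
structure IsEigenfunction (ν : Measure X) (u : ι → ℝ → G) (ψ : X → ℂ) : Prop where
  memLp : MemLp ψ 2 ν
  sq_le : ∫ x, ‖ψ x‖ ^ 2 ∂ν ≤ 1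
  eigen : ∀ i s, ∃ z : ℂ, ‖z‖ = 1 ∧ (fun x => ψ (u i s • x)) =ᵐ[ν] fun x => z * ψ x

/-- The factors are exchanged one at a time. The error is measured relative to the bounds `p i`, so
that the result is a multiple of the full product of norms, even if some `p i` vanish. -/
theorem norm_prod_sub_prod_le (s : Finset J) (a b : J → ℂ) (p : J → ℝ) (ε : ℝ)
    (ha : ∀ i ∈ s, ‖a i‖ ≤ p i) (hb : ∀ i ∈ s, ‖b i‖ ≤ p i)
    (hab : ∀ i ∈ s, ‖a i - b i‖ ≤ ε * p i) :
    ‖∏ i ∈ s, a i - ∏ i ∈ s, b i‖ ≤ s.card * ε * ∏ i ∈ s, p i := by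
  classical
  induction s using Finset.induction_on with
  | empty => simp
  | insert j s hj ih =>
    have ih' := ih (fun i hi => ha i (Finset.mem_insert_of_mem hi))
      (fun i hi => hb i (Finset.mem_insert_of_mem hi))
      (fun i hi => hab i (Finset.mem_insert_of_mem hi))
    have hpa : ‖∏ i ∈ s, a i‖ ≤ ∏ i ∈ s, p i := by
      rw [norm_prod]
      exact Finset.prod_le_prod (fun _ _ => norm_nonneg _)
        fun i hi => ha i (Finset.mem_insert_of_mem hi)
    have h1 := hab j (Finset.mem_insert_self _ _)
    have h2 := hb j (Finset.mem_insert_self _ _)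
    rw [Finset.prod_insert hj, Finset.prod_insert hj, Finset.prod_insert hj,
      Finset.card_insert_of_notMem hj]
    calc ‖a j * ∏ i ∈ s, a i - b j * ∏ i ∈ s, b i‖
        = ‖(a j - b j) * ∏ i ∈ s, a i + b j * (∏ i ∈ s, a i - ∏ i ∈ s, b i)‖ := by
          congr 1; ring
      _ ≤ ‖a j - b j‖ * ‖∏ i ∈ s, a i‖ + ‖b j‖ * ‖∏ i ∈ s, a i - ∏ i ∈ s, b i‖ :=
          (norm_add_le _ _).trans (by rw [norm_mul, norm_mul])
      _ ≤ ε * p j * ∏ i ∈ s, p i + p j * (s.card * ε * ∏ i ∈ s, p i) := by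
          refine add_le_add (mul_le_mul h1 hpa (norm_nonneg _) ((norm_nonneg _).trans h1))
            (mul_le_mul h2 ih' (norm_nonneg _) ((norm_nonneg _).trans h2))
      _ = _ := by push_cast; ring

theorem integral_norm_mul_norm_le {ν : Measure X} {ψ g : X → ℂ} (hψ : MemLp ψ 2 ν)
    (hg : MemLp g 2 ν) (hψ1 : ∫ x, ‖ψ x‖ ^ 2 ∂ν ≤ 1) {V : ℝ} (hV : ∫ x, ‖g x‖ ^ 2 ∂ν ≤ V) :
    ∫ x, ‖ψ x‖ * ‖g x‖ ∂ν ≤ √V := by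
  have hV0 : 0 ≤ V := (integral_nonneg fun x => by positivity).trans hV
  have h := integral_mul_norm_le_Lp_mul_Lq (μ := ν) (p := 2) (q := 2) (f := ψ) (g := g)
    Real.HolderConjugate.two_two (by simpa using hψ) (by simpa using hg)
  simp only [Real.rpow_two] at h
  refine h.trans ?_
  rw [← Real.sqrt_eq_rpow, ← Real.sqrt_eq_rpow]
  calc _ ≤ √1 * √V := by gcongr
    _ = _ := by simp

theorem IsEigenfunction.integral_norm_le {ν : Measure X} [IsProbabilityMeasure ν]
    {u : ι → ℝ → G} {ψ : X → ℂ} (hψ : IsEigenfunction ν u ψ) : ∫ x, ‖ψ x‖ ∂ν ≤ 1 := by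
  have := integral_norm_mul_norm_le (g := fun _ => 1) hψ.memLp (memLp_const _) hψ.sq_le
    (V := 1) (by simp)
  simpa using this

/-- The correlations in the van der Corput estimate carry no eigenfunction; the induction hypothesis
is applied to them with this one. -/
theorem isEigenfunction_one {ν : Measure X} [IsProbabilityMeasure ν] (u : ι → ℝ → G) :
    IsEigenfunction ν u (fun _ => 1) where
  memLp := memLp_const _
  sq_le := by simp
  eigen _ _ := ⟨1, by simp, by simp⟩

variable {μ ν : Measure X} {𝒜 : Set (X → ℂ)} {S : ℕ → (X → ℂ) → ℝ}
    {u : ι → ℝ → G} {τ : T → G} {α : ι → T →* ℝˣ} {Tplus : Set T} {ρ : T → ℝ}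
    {M : ℝ} {A : ℕ} {C c D δ : ℝ}

namespace EquidistData

theorem mono_le (h : EquidistData μ ν 𝒜 S u τ α Tplus ρ M A C c D δ) {φ : X → ℂ} (hφ : φ ∈ 𝒜)
    {d d' : ℕ} (hd : d ≤ d') : S d φ ≤ S d' φ := by
  induction hd with
  | refl => exact le_rfl
  | step _ ih => exact ih.trans (h.mono φ hφ _)

theorem measurable_translate [MeasurableConstSMul G X]
    (h : EquidistData μ ν 𝒜 S u τ α Tplus ρ M A C c D δ) {φ : X → ℂ}
    (hφ : φ ∈ 𝒜) (g : G) : Measurable fun x => φ (g • x) :=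
  (h.meas φ hφ).comp (measurable_const_smul g)

theorem nonneg [IsProbabilityMeasure ν] (h : EquidistData μ ν 𝒜 S u τ α Tplus ρ M A C c D δ)
    {φ : X → ℂ} (hφ : φ ∈ 𝒜) (d : ℕ) : 0 ≤ S d φ := by
  have : Nonempty X := by
    by_contra hX
    rw [not_nonempty_iff] at hX
    have := measure_univ (μ := ν)
    simp [Set.univ_eq_empty_iff.2 hX] at this
  exact (norm_nonneg _).trans (h.norm_le φ hφ d (Classical.arbitrary X))

theorem norm_integral_le {m : Measure X} [IsProbabilityMeasure m]
    (h : EquidistData μ ν 𝒜 S u τ α Tplus ρ M A C c D δ)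
    {φ : X → ℂ} (hφ : φ ∈ 𝒜) (d : ℕ) : ‖∫ x, φ x ∂m‖ ≤ S d φ := by
  simpa using norm_integral_le_of_norm_le_const (μ := m) (.of_forall (h.norm_le φ hφ d))

end EquidistData

end Abstract

/-! ### The van der Corput estimate -/

section VanDerCorput

theorem norm_sq_sum_eq {X : Type*} (K : ℕ) (f : ℕ → X → ℂ) (x : X) :
    ((‖∑ n ∈ Finset.range K, f n x‖ ^ 2 : ℝ) : ℂ)
      = ∑ n ∈ Finset.range K, ∑ m ∈ Finset.range K, f n x * conj (f m x) := by
  rw [← Complex.normSq_eq_norm_sq, Complex.normSq_eq_conj_mul_self, mul_comm, map_sum,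
    Finset.sum_mul_sum]

/-- Second moment of an average whose correlations are small off the diagonal. -/
theorem integral_norm_sq_average_le {X : Type*} [MeasurableSpace X] {ν : Measure X} {K : ℕ}
    (hK : 1 ≤ K)
    (f : ℕ → X → ℂ) (hf : ∀ n m, Integrable (fun x => f n x * conj (f m x)) ν) {a b : ℝ}
    (hdiag : ∀ n, ‖∫ x, f n x * conj (f n x) ∂ν‖ ≤ a + b)
    (hoff : ∀ n m, n ≠ m → ‖∫ x, f n x * conj (f m x) ∂ν‖ ≤ b) :
    ∫ x, ‖(K : ℂ)⁻¹ * ∑ n ∈ Finset.range K, f n x‖ ^ 2 ∂ν ≤ a / K + b := by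
  have hK0 : (0 : ℝ) < K := by exact_mod_cast hK
  have e1 : ∫ x, ‖∑ n ∈ Finset.range K, f n x‖ ^ 2 ∂ν ≤ K * a + K ^ 2 * b := by
    have : ((∫ x, ‖∑ n ∈ Finset.range K, f n x‖ ^ 2 ∂ν : ℝ) : ℂ)
        = ∑ n ∈ Finset.range K, ∑ m ∈ Finset.range K, ∫ x, f n x * conj (f m x) ∂ν := by
      rw [← integral_complex_ofReal]
      simp_rw [norm_sq_sum_eq]
      rw [integral_finsetSum _ fun n _ => integrable_finsetSum _ fun m _ => hf n m]
      refine Finset.sum_congr rfl fun n _ => ?_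
      rw [integral_finsetSum _ fun m _ => hf n m]
    calc ∫ x, ‖∑ n ∈ Finset.range K, f n x‖ ^ 2 ∂ν
        ≤ ‖((∫ x, ‖∑ n ∈ Finset.range K, f n x‖ ^ 2 ∂ν : ℝ) : ℂ)‖ := by
          rw [Complex.norm_real]; exact le_abs_self _
      -- Each of the `K ^ 2` correlations costs `b`, and the `K` diagonal ones cost `a` in addition.
      _ ≤ ∑ n ∈ Finset.range K, ∑ m ∈ Finset.range K, ((if n = m then a else 0) + b) := by
          rw [this]
          refine (norm_sum_le _ _).trans (Finset.sum_le_sum fun n _ =>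
            (norm_sum_le _ _).trans (Finset.sum_le_sum fun m _ => ?_))
          split_ifs with hnm
          · subst hnm; exact hdiag n
          · simpa using hoff n m hnm
      _ = K * a + K ^ 2 * b := by
          have : ∀ n ∈ Finset.range K,
              ∑ m ∈ Finset.range K, ((if n = m then a else 0) + b) = a + K * b := by
            intro n hn
            rw [Finset.sum_add_distrib, Finset.sum_ite_eq, if_pos hn]
            simp
          rw [Finset.sum_congr rfl this]
          simp
          ring
  calc ∫ x, ‖(K : ℂ)⁻¹ * ∑ n ∈ Finset.range K, f n x‖ ^ 2 ∂ν
      = ((K : ℝ)⁻¹) ^ 2 * ∫ x, ‖∑ n ∈ Finset.range K, f n x‖ ^ 2 ∂ν := by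
        rw [← integral_const_mul]
        refine integral_congr_ae (.of_forall fun x => ?_)
        simp only [norm_mul, mul_pow]
        simp
    _ ≤ ((K : ℝ)⁻¹) ^ 2 * (K * a + K ^ 2 * b) := by gcongr
    _ = a / K + b := by field_simp

variable {G X T ι J : Type*} [Group G] [MulAction G X] [MeasurableSpace X] [Group T]
  {μ ν : Measure X} {𝒜 : Set (X → ℂ)} {S : ℕ → (X → ℂ) → ℝ}
    {u : ι → ℝ → G} {τ : T → G} {α : ι → T →* ℝˣ} {Tplus : Set T} {ρ : T → ℝ}
    {M : ℝ} {A : ℕ} {C c D δ : ℝ}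

namespace EquidistData

/-- The van der Corput estimate: if `φ k` has mean zero, and the translates `t i`, `i ∈ I`, expand
the direction `i₀` at most as `t k`, while the other ones expand it much less, then
`ν (ψ ∏ φ i ∘ t i)` is bounded in terms of the error term of multiple equidistribution for `I`. -/
theorem norm_integral_mul_prod_le_of_integral_eq_zero [MeasurableConstSMul G X]
    [IsProbabilityMeasure μ] [IsProbabilityMeasure ν]
    (h : EquidistData μ ν 𝒜 S u τ α Tplus ρ M A C c D δ)
    {s I : Finset J} (hI : I ⊆ s) {φ : J → X → ℂ} (hφ : ∀ i, φ i ∈ 𝒜) (t : J → T) (i₀ : ι)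
    {σ θ : ℝ} (hσ : 0 < σ) (hθ : 0 ≤ θ) {K : ℕ} (hK : 1 ≤ K)
    (hσI : ∀ i ∈ I, |((α i₀ (t i) : ℝˣ) : ℝ)| * σ ≤ 1)
    (hσJ : ∀ i ∈ s, i ∉ I → |((α i₀ (t i) : ℝˣ) : ℝ)| * σ ≤ θ)
    {k : J} (hk : k ∈ I) (hσk : |((α i₀ (t k) : ℝˣ) : ℝ)| * σ = 1) (hφk : ∫ x, φ k x ∂μ = 0)
    {d : ℕ} (hd : 1 ≤ d) {B : ℝ} (hB0 : 0 ≤ B)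
    (hB : ∀ Φ : J → X → ℂ, (∀ i, Φ i ∈ 𝒜) →
      ‖∫ x, ∏ i ∈ I, Φ i (τ (t i) • x) ∂ν - ∏ i ∈ I, ∫ x, Φ i x ∂μ‖ ≤ B * ∏ i ∈ I, S d (Φ i))
    {ψ : X → ℂ} (hψ : IsEigenfunction ν u ψ) :
    ‖∫ x, ψ x * ∏ i ∈ s, φ i (τ (t i) • x) ∂ν‖ ≤
      (s.card * (M * K ^ 2 * θ)
        + √(2 * C * (K : ℝ) ^ (-c) + B * (M * K ^ (2 * A)) ^ I.card)) *
        ∏ i ∈ s, S (d + 1) (φ i) := by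
  classical
  have hK1 : (1 : ℝ) ≤ K := by exact_mod_cast hK
  have hK0 : (0 : ℝ) < K := by linarith
  have hM0 : 0 ≤ M := zero_le_one.trans h.one_le_M
  have hC0 : 0 ≤ C := zero_le_one.trans h.one_le_C
  set p : J → ℝ := fun i => S (d + 1) (φ i) with hp
  have hp0 : ∀ i, 0 ≤ p i := fun i => h.nonneg (hφ i) _
  have hφp : ∀ i x, ‖φ i x‖ ≤ p i := fun i x => h.norm_le _ (hφ i) _ x
  set PI := ∏ i ∈ I, p i with hPI
  set PJ := ∏ i ∈ s \ I, p i with hPJ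
  have hPI0 : 0 ≤ PI := Finset.prod_nonneg fun i _ => hp0 i
  have hPJ0 : 0 ≤ PJ := Finset.prod_nonneg fun i _ => hp0 i
  have hP : ∏ i ∈ s, p i = PJ * PI := (Finset.prod_sdiff hI).symm
  -- the sample points and the shifted functions
  set y : ℕ → ℝ := fun n => K * n * σ with hy
  -- Moving `x` by `u i₀ (y n)` moves `τ (t i) • x` by `u i₀ (a n i)`. The spacing `K * σ` keeps the
  -- values `a n k` at mutual distance at least `K`, while all `a n i` with `i ∈ I` and `n < K` stay
  -- bounded by `K ^ 2`.
  set a : ℕ → J → ℝ := fun n i => ((α i₀ (t i) : ℝˣ) : ℝ) * y n with ha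
  set f : ℕ → J → X → ℂ := fun n i x => φ i (u i₀ (a n i) • τ (t i) • x) with hf
  have hfm : ∀ n i, Measurable (f n i) := fun n i =>
    ((h.meas _ (hφ i)).comp (measurable_const_smul _)).comp (measurable_const_smul _)
  have hfp : ∀ n i x, ‖f n i x‖ ≤ p i := fun n i x => hφp i _
  set F : ℕ → X → ℂ := fun n x => ∏ i ∈ I, f n i x with hF
  have hFm : ∀ n, Measurable (F n) := fun n => Finset.measurable_prod _ fun i _ => hfm n i
  have hFp : ∀ n x, ‖F n x‖ ≤ PI := fun n x => by
    rw [hF]; simp only [norm_prod]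
    exact Finset.prod_le_prod (fun _ _ => norm_nonneg _) fun i _ => hfp n i x
  set H : ℕ → X → ℂ := fun n x => ∏ i ∈ s \ I, f n i x with hH
  have hHm : ∀ n, Measurable (H n) := fun n => Finset.measurable_prod _ fun i _ => hfm n i
  have hHp : ∀ n x, ‖H n x‖ ≤ PJ := fun n x => by
    rw [hH]; simp only [norm_prod]
    exact Finset.prod_le_prod (fun _ _ => norm_nonneg _) fun i _ => hfp n i x
  set H0 : X → ℂ := fun x => ∏ i ∈ s \ I, φ i (τ (t i) • x) with hH0
  have hH0m : Measurable H0 := Finset.measurable_prod _ fun i _ => h.measurable_translate (hφ i) _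
  have hH0p : ∀ x, ‖H0 x‖ ≤ PJ := fun x => by
    rw [hH0]; simp only [norm_prod]
    exact Finset.prod_le_prod (fun _ _ => norm_nonneg _) fun i _ => hφp i _
  have hyK : ∀ n < K, |y n| ≤ K ^ 2 * σ := by
    intro n hn
    have : (n : ℝ) ≤ K := by exact_mod_cast hn.le
    simp only [hy]
    rw [abs_of_nonneg (by positivity), sq]
    gcongr
  have haI : ∀ n < K, ∀ i ∈ I, |a n i| ≤ K ^ 2 := by
    intro n hn i hi
    calc |a n i| = |((α i₀ (t i) : ℝˣ) : ℝ)| * |y n| := abs_mul _ _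
      _ ≤ |((α i₀ (t i) : ℝˣ) : ℝ)| * (K ^ 2 * σ) := by gcongr; exact hyK n hn
      _ = K ^ 2 * (|((α i₀ (t i) : ℝˣ) : ℝ)| * σ) := by ring
      _ ≤ K ^ 2 * 1 := by gcongr; exact hσI i hi
      _ = K ^ 2 := mul_one _
  have haJ : ∀ n < K, ∀ i ∈ s \ I, |a n i| ≤ K ^ 2 * θ := by
    intro n hn i hi
    rw [Finset.mem_sdiff] at hi
    calc |a n i| = |((α i₀ (t i) : ℝˣ) : ℝ)| * |y n| := abs_mul _ _
      _ ≤ |((α i₀ (t i) : ℝˣ) : ℝ)| * (K ^ 2 * σ) := by gcongr; exact hyK n hn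
      _ = K ^ 2 * (|((α i₀ (t i) : ℝˣ) : ℝ)| * σ) := by ring
      _ ≤ K ^ 2 * θ := by gcongr; exact hσJ i hi.1 hi.2
  have hψi : Integrable ψ ν := hψ.memLp.integrable one_le_two
  -- invariance
  choose z hz1 hz using fun n => hψ.eigen i₀ (y n)
  -- The scalar `z n` is attached to `F n`, so that replacing `H n` by `H0` leaves an average of the
  -- functions `z n * F n` alone.
  have step1 : ∀ n, ∫ x, ψ x * ∏ i ∈ s, φ i (τ (t i) • x) ∂ν
      = ∫ x, ψ x * (H n x * (z n * F n x)) ∂ν := by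
    intro n
    have hmeas : AEStronglyMeasurable (fun x => ψ x * ∏ i ∈ s, φ i (τ (t i) • x)) ν :=
      hψi.aestronglyMeasurable.mul (Finset.measurable_prod _ fun i _ =>
        h.measurable_translate (hφ i) _).aestronglyMeasurable
    have := h.pres i₀ (y n)
    rw [← this.map_eq, integral_map this.aemeasurable (by rw [this.map_eq]; exact hmeas)]
    rw [this.map_eq]
    refine integral_congr_ae ?_
    filter_upwards [hz n] with x hx
    have e : ∏ i ∈ s, φ i (τ (t i) • u i₀ (y n) • x) = H n x * F n x := by
      rw [hH, hF]
      simp only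
      rw [Finset.prod_sdiff hI]
      refine Finset.prod_congr rfl fun i _ => ?_
      rw [hf]; simp only
      rw [smul_smul, h.conj_u, mul_smul]
    rw [hx, e]
    ring
  set g : X → ℂ := fun x => (K : ℂ)⁻¹ * ∑ n ∈ Finset.range K, z n * F n x with hg
  have hgm : Measurable g := (Finset.measurable_sum _ fun n _ => (hFm n).const_mul _).const_mul _
  have hgp : ∀ x, ‖g x‖ ≤ PI := fun x => by
    rw [hg]; simp only [norm_mul, norm_inv, Complex.norm_natCast]
    rw [inv_mul_le_iff₀ hK0]
    refine (norm_sum_le _ _).trans ((Finset.sum_le_sum fun n _ =>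
      (?_ : ‖z n * F n x‖ ≤ PI)).trans (by simp))
    rw [norm_mul, hz1, one_mul]; exact hFp n x
  have int1 : ∀ n, Integrable (fun x => ψ x * (H n x * (z n * F n x))) ν := fun n =>
    hψi.mul_bdd (c := PJ * PI) ((hHm n).mul ((hFm n).const_mul _)).aestronglyMeasurable
      (.of_forall fun x => by
        rw [norm_mul, norm_mul, hz1, one_mul]
        exact mul_le_mul (hHp n x) (hFp n x) (norm_nonneg _) hPJ0)
  have int2 : ∀ n, Integrable (fun x => ψ x * (H0 x * (z n * F n x))) ν := fun n =>
    hψi.mul_bdd (c := PJ * PI) (hH0m.mul ((hFm n).const_mul _)).aestronglyMeasurable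
      (.of_forall fun x => by
        rw [norm_mul, norm_mul, hz1, one_mul]
        exact mul_le_mul (hH0p x) (hFp n x) (norm_nonneg _) hPJ0)
  -- the functions that move little
  have step2 : ∀ n < K, ‖∫ x, ψ x * (H n x * (z n * F n x)) ∂ν
      - ∫ x, ψ x * (H0 x * (z n * F n x)) ∂ν‖ ≤ s.card * (M * K ^ 2 * θ) * (PJ * PI) := by
    intro n hn
    rw [← integral_sub (int1 n) (int2 n)]
    -- Only indices outside `I` occur here; their arguments move by at most `K ^ 2 * θ`, which the
    -- Lipschitz property turns into a relative error per factor.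
    have hb : ∀ x, ‖H n x - H0 x‖ ≤ s.card * (M * K ^ 2 * θ) * PJ := by
      intro x
      refine (norm_prod_sub_prod_le (s \ I) _ _ p (M * K ^ 2 * θ) (fun i _ => hfp n i x)
        (fun i _ => hφp i _) fun i hi => ?_).trans ?_
      · refine (h.lip _ (hφ i) _ _ _ (d + 1)).trans ?_
        rw [mul_assoc M (_ ^ 2)]
        exact mul_le_mul_of_nonneg_right (mul_le_mul_of_nonneg_left (haJ n hn i hi) hM0) (hp0 i)
      · have : ((s \ I).card : ℝ) ≤ s.card := by
          exact_mod_cast Finset.card_le_card Finset.sdiff_subset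
        gcongr
    set R := s.card * (M * K ^ 2 * θ) * (PJ * PI) with hR
    have hR0 : 0 ≤ R := by positivity
    calc _ ≤ ∫ x, ‖ψ x‖ * R ∂ν := by
          refine norm_integral_le_of_norm_le (hψi.norm.mul_const _) (.of_forall fun x => ?_)
          rw [← mul_sub, ← sub_mul, norm_mul, norm_mul, norm_mul, hz1, one_mul]
          refine mul_le_mul_of_nonneg_left ?_ (norm_nonneg _)
          rw [hR, ← mul_assoc]
          exact mul_le_mul (hb x) (hFp n x) (norm_nonneg _) (by positivity)
      _ = (∫ x, ‖ψ x‖ ∂ν) * R := integral_mul_const _ _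
      _ ≤ 1 * R := by gcongr; exact hψ.integral_norm_le
      _ = R := one_mul _
  have step3 : ‖∫ x, ψ x * ∏ i ∈ s, φ i (τ (t i) • x) ∂ν - ∫ x, ψ x * (H0 x * g x) ∂ν‖
      ≤ s.card * (M * K ^ 2 * θ) * (PJ * PI) := by
    have e1 : ∫ x, ψ x * (H0 x * g x) ∂ν
        = (K : ℂ)⁻¹ * ∑ n ∈ Finset.range K, ∫ x, ψ x * (H0 x * (z n * F n x)) ∂ν := by
      rw [← integral_finsetSum _ fun n _ => int2 n, ← integral_const_mul]
      refine integral_congr_ae (.of_forall fun x => ?_)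
      simp only [hg, Finset.mul_sum]
      refine Finset.sum_congr rfl fun n _ => by ring
    have e2 : ∫ x, ψ x * ∏ i ∈ s, φ i (τ (t i) • x) ∂ν
        = (K : ℂ)⁻¹ * ∑ n ∈ Finset.range K, ∫ x, ψ x * (H n x * (z n * F n x)) ∂ν := by
      simp_rw [← step1]
      have : (K : ℂ) ≠ 0 := by exact_mod_cast hK0.ne'
      simp only [Finset.sum_const, Finset.card_range, nsmul_eq_mul]
      field_simp
    rw [e1, e2, ← mul_sub, ← Finset.sum_sub_distrib, norm_mul, norm_inv, Complex.norm_natCast,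
      inv_mul_le_iff₀ hK0]
    refine (norm_sum_le _ _).trans ((Finset.sum_le_sum fun n hn =>
      step2 n (Finset.mem_range.1 hn)).trans (by simp))
  -- correlations
  set E := B * (M * K ^ (2 * A)) ^ I.card with hE
  have hE0 : 0 ≤ E := by positivity
  have hcorr0 : ∀ n m, ‖∫ x, F n x * conj (F m x) ∂ν‖ ≤ PI ^ 2 := by
    intro n m
    have : ∀ x, ‖F n x * conj (F m x)‖ ≤ PI ^ 2 := fun x => by
      rw [norm_mul, RCLike.norm_conj, sq]
      exact mul_le_mul (hFp n x) (hFp m x) (norm_nonneg _) hPI0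
    simpa using norm_integral_le_of_norm_le_const (μ := ν) (.of_forall this)
  have hcorr : ∀ n < K, ∀ m < K, n ≠ m →
      ‖∫ x, F n x * conj (F m x) ∂ν‖ ≤ (C * (K : ℝ) ^ (-c) + E) * PI ^ 2 := by
    intro n hn m hm hnm
    -- `F n * conj (F m)` is again a product over `I` of translates by the `t i`, now of the
    -- correlations `Φ i`, so `hB` applies to it. Outside `I` the value of `Φ` is irrelevant, but
    -- has to lie in `𝒜`.
    set Φ : J → X → ℂ := fun i => if i ∈ I then
      (fun x => φ i (u i₀ (a n i) • x) * conj (φ i (u i₀ (a m i) • x))) else φ i with hΦ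
    have hΦA : ∀ i, Φ i ∈ 𝒜 := fun i => by
      by_cases hi : i ∈ I
      · simp only [hΦ, if_pos hi]
        exact (h.corr _ (hφ i) _ _ _ (K ^ 2) (one_le_pow₀ hK1) (haI n hn i hi)
          (haI m hm i hi)).1
      · simp only [hΦ, if_neg hi]; exact hφ i
    have hΦS : ∀ i ∈ I, S d (Φ i) ≤ M * K ^ (2 * A) * p i ^ 2 := fun i hi => by
      simp only [hΦ, if_pos hi]
      refine ((h.corr _ (hφ i) _ _ _ (K ^ 2) (one_le_pow₀ hK1) (haI n hn i hi)
          (haI m hm i hi)).2 d).trans (le_of_eq ?_)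
      rw [pow_mul]
    have hΦint : ∀ i ∈ I, ‖∫ x, Φ i x ∂μ‖ ≤ p i ^ 2 := fun i hi => by
      simp only [hΦ, if_pos hi]
      have : ∀ x, ‖φ i (u i₀ (a n i) • x) * conj (φ i (u i₀ (a m i) • x))‖ ≤ p i ^ 2 :=
        fun x => by
          rw [norm_mul, RCLike.norm_conj, sq]
          exact mul_le_mul (hφp i _) (hφp i _) (norm_nonneg _) (hp0 i)
      simpa using norm_integral_le_of_norm_le_const (μ := μ) (.of_forall this)
    have hΦk : ‖∫ x, Φ k x ∂μ‖ ≤ C * (K : ℝ) ^ (-c) * p k ^ 2 := by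
      simp only [hΦ, if_pos hk]
      refine (h.mix _ (hφ k) hφk _ _ _).trans ?_
      -- By the normalisation `hσk` the two arguments of `φ k` differ by `K * |n - m|`, so mixing
      -- gains `K ^ (-c)`.
      have h1 : (K : ℝ) ≤ |a n k - a m k| := by
        have : a n k - a m k = ((α i₀ (t k) : ℝˣ) : ℝ) * σ * K * ((n : ℝ) - m) := by
          simp only [ha, hy]; ring
        rw [this, abs_mul, abs_mul, abs_mul, abs_of_pos hσ, hσk, one_mul, abs_of_pos hK0]
        have : (1 : ℝ) ≤ |(n : ℝ) - m| := by
          have : (1 : ℤ) ≤ |(n : ℤ) - m| := Int.one_le_abs (sub_ne_zero.2 (by exact_mod_cast hnm))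
          exact_mod_cast this
        nlinarith
      have h2 : S 1 (φ k) ≤ p k := h.mono_le (hφ k) (by omega)
      have h3 := h.nonneg (hφ k) 1
      have h4 : max 1 |a n k - a m k| ^ (-c) ≤ (K : ℝ) ^ (-c) :=
        Real.rpow_le_rpow_of_nonpos hK0 (h1.trans (le_max_right _ _)) (by linarith [h.c_pos])
      gcongr
    have e1 : ∫ x, F n x * conj (F m x) ∂ν = ∫ x, ∏ i ∈ I, Φ i (τ (t i) • x) ∂ν := by
      refine integral_congr_ae (.of_forall fun x => ?_)
      simp only [hF, map_prod, ← Finset.prod_mul_distrib]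
      refine Finset.prod_congr rfl fun i hi => ?_
      simp only [hΦ, if_pos hi, hf]
    have e2 : ‖∏ i ∈ I, ∫ x, Φ i x ∂μ‖ ≤ C * (K : ℝ) ^ (-c) * PI ^ 2 := by
      rw [norm_prod, hPI, ← Finset.prod_pow, ← Finset.mul_prod_erase I _ hk,
        ← Finset.mul_prod_erase I (fun i => p i ^ 2) hk, ← mul_assoc]
      refine mul_le_mul hΦk (Finset.prod_le_prod (fun _ _ => norm_nonneg _) fun i hi =>
        hΦint i (Finset.mem_of_mem_erase hi)) (Finset.prod_nonneg fun _ _ => norm_nonneg _)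
        (by positivity)
    have e3 : B * ∏ i ∈ I, S d (Φ i) ≤ E * PI ^ 2 := by
      rw [hE, mul_assoc]
      refine mul_le_mul_of_nonneg_left ?_ hB0
      rw [hPI, ← Finset.prod_pow, ← Finset.prod_const, ← Finset.prod_mul_distrib]
      exact Finset.prod_le_prod (fun i _ => h.nonneg (hΦA i) _) hΦS
    calc _ = ‖(∫ x, ∏ i ∈ I, Φ i (τ (t i) • x) ∂ν - ∏ i ∈ I, ∫ x, Φ i x ∂μ)
          + ∏ i ∈ I, ∫ x, Φ i x ∂μ‖ := by rw [e1, sub_add_cancel]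
      _ ≤ E * PI ^ 2 + C * (K : ℝ) ^ (-c) * PI ^ 2 :=
          (norm_add_le _ _).trans (add_le_add ((hB Φ hΦA).trans e3) e2)
      _ = _ := by ring
  have step4 : ∫ x, ‖g x‖ ^ 2 ∂ν ≤ (2 * C * (K : ℝ) ^ (-c) + E) * PI ^ 2 := by
    -- The diagonal contributes `1 / K`, which is dominated by the mixing term because `c < 1` and
    -- `1 ≤ C`; this is the source of the factor `2 * C`.
    have e0 : (1 : ℝ) / K ≤ C * (K : ℝ) ^ (-c) := by
      rw [one_div, ← Real.rpow_neg_one]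
      calc (K : ℝ) ^ (-1 : ℝ) ≤ (K : ℝ) ^ (-c) :=
            Real.rpow_le_rpow_of_exponent_le hK1 (by linarith [h.c_lt])
        _ ≤ _ := le_mul_of_one_le_left (by positivity) h.one_le_C
    -- The second moment bound asks for all pairs of indices, whereas the correlations are
    -- controlled for `n, m < K` only; cutting off there does not change the average.
    set f' : ℕ → X → ℂ := fun n x => if n < K then z n * F n x else 0 with hf'
    have hb : 0 ≤ (C * (K : ℝ) ^ (-c) + E) * PI ^ 2 := by positivity
    have key : ∀ n m, ‖∫ x, f' n x * conj (f' m x) ∂ν‖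
        ≤ if n < K ∧ m < K then ‖∫ x, F n x * conj (F m x) ∂ν‖ else 0 := by
      intro n m
      by_cases hn : n < K
      · by_cases hm : m < K
        · simp only [hf', hn, hm, if_true, and_self]
          have : ∀ x, z n * F n x * conj (z m * F m x)
              = (z n * conj (z m)) * (F n x * conj (F m x)) := fun x => by
            rw [map_mul]; ring
          simp_rw [this]
          rw [integral_const_mul, norm_mul, norm_mul, RCLike.norm_conj, hz1, hz1]
          simp
        · simp [hf', hm]
      · simp [hf', hn]
    have := integral_norm_sq_average_le (ν := ν) hK f' (a := PI ^ 2)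
      (b := (C * (K : ℝ) ^ (-c) + E) * PI ^ 2) (fun n m => ?_) (fun n => ?_) (fun n m hnm => ?_)
    · have e : ∀ x, (K : ℂ)⁻¹ * ∑ n ∈ Finset.range K, f' n x = g x := fun x => by
        rw [hg]
        congr 1
        refine Finset.sum_congr rfl fun n hn => ?_
        simp [hf', Finset.mem_range.1 hn]
      simp_rw [e] at this
      refine this.trans ?_
      have : PI ^ 2 / K ≤ C * (K : ℝ) ^ (-c) * PI ^ 2 := by
        calc PI ^ 2 / K = 1 / K * PI ^ 2 := by ring
          _ ≤ _ := by gcongr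
      linarith
    · have hm : ∀ n, Measurable (f' n) := fun n => by
        by_cases hn : n < K
        · simp only [hf', hn, if_true]; exact (hFm n).const_mul _
        · simp only [hf', hn, if_false]; exact measurable_const
      have hb' : ∀ n x, ‖f' n x‖ ≤ PI := fun n x => by
        by_cases hn : n < K
        · simp only [hf', hn, if_true, norm_mul, hz1, one_mul]; exact hFp n x
        · simp only [hf', hn, if_false, norm_zero]; exact hPI0
      refine Integrable.of_bound (C := PI * PI)
        ((hm n).mul (Complex.continuous_conj.measurable.comp (hm m))).aestronglyMeasurable
        (.of_forall fun x => ?_)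
      rw [norm_mul, RCLike.norm_conj]
      exact mul_le_mul (hb' n x) (hb' m x) (norm_nonneg _) hPI0
    · refine (key n n).trans ?_
      split_ifs
      · exact (hcorr0 n n).trans (by linarith)
      · positivity
    · refine (key n m).trans ?_
      split_ifs with hnm'
      · exact hcorr n hnm'.1 m hnm'.2 hnm
      · exact hb
  have step5 : ‖∫ x, ψ x * (H0 x * g x) ∂ν‖
      ≤ √(2 * C * (K : ℝ) ^ (-c) + E) * (PJ * PI) := by
    have hgL : MemLp g 2 ν := MemLp.of_bound hgm.aestronglyMeasurable PI (.of_forall hgp)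
    have h1 := integral_norm_mul_norm_le hψ.memLp hgL hψ.sq_le step4
    have hint : Integrable (fun x => ‖ψ x‖ * ‖g x‖) ν :=
      hψi.norm.mul_bdd (c := PI) hgm.norm.aestronglyMeasurable
        (.of_forall fun x => by rw [norm_norm]; exact hgp x)
    calc _ ≤ ∫ x, PJ * (‖ψ x‖ * ‖g x‖) ∂ν := by
          refine norm_integral_le_of_norm_le (hint.const_mul _) (.of_forall fun x => ?_)
          rw [norm_mul, norm_mul]
          have := hH0p x
          calc ‖ψ x‖ * (‖H0 x‖ * ‖g x‖) ≤ ‖ψ x‖ * (PJ * ‖g x‖) := by gcongr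
            _ = _ := by ring
      _ = PJ * ∫ x, ‖ψ x‖ * ‖g x‖ ∂ν := integral_const_mul _ _
      _ ≤ PJ * √((2 * C * (K : ℝ) ^ (-c) + E) * PI ^ 2) := by gcongr
      _ = _ := by rw [Real.sqrt_mul (by positivity), Real.sqrt_sq hPI0]; ring
  rw [hP]
  calc _ = ‖(∫ x, ψ x * ∏ i ∈ s, φ i (τ (t i) • x) ∂ν - ∫ x, ψ x * (H0 x * g x) ∂ν)
        + ∫ x, ψ x * (H0 x * g x) ∂ν‖ := by rw [sub_add_cancel]
    _ ≤ _ := (norm_add_le _ _).trans (add_le_add step3 step5)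
    _ = _ := by ring

end EquidistData

end VanDerCorput

/-! ### Choice of parameters and induction on the number of functions -/

section Induction

/-- The choice of the length of the averages in the van der Corput estimate. -/
theorem exists_average_length {M C c η Δ H₁ H₂ b ζ : ℝ} {A r q : ℕ} (hr : 1 ≤ r) (hq : q ≤ r)
    (hM : 1 ≤ M) (hC : 1 ≤ C) (hc : 0 < c) (hη : 0 < η) (hΔ1 : 1 ≤ Δ) (hH₁ : 1 ≤ H₁)
    (hH₂ : 2 * (M * 4 ^ A) ≤ H₂) (hΔ : H₂ ^ r ≤ Δ ^ (η * r ^ 2))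
    (hη1 : η * (1 + r ^ 2) ≤ 1 / 2) (hη2 : 4 * η / c ≤ 1 / 2)
    (hb : b ≤ r * H₁) (hζ : η * (1 + r ^ 2 + 2 * A * r / c) ≤ ζ / 2) :
    ∃ K : ℕ, 1 ≤ K ∧ r * (M * K ^ 2 * (1 / Δ))
      + √(2 * C * (K : ℝ) ^ (-c) + b * Δ ^ (-ζ) * (M * K ^ (2 * A)) ^ q)
      ≤ (4 * M + √(2 * C) + √H₁) * Δ ^ (-η) := by
  have hΔ0 : 0 < Δ := by linarith
  -- With `K` of order `Δ ^ β` the mixing term `K ^ (-c)` is at most `Δ ^ (-2 * η)`, whose square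
  -- root has the desired rate.
  set β := 2 * η / c with hβ
  have hβ0 : 0 < β := by positivity
  set y := Δ ^ β with hy
  have hy1 : 1 ≤ y := Real.one_le_rpow hΔ1 hβ0.le
  have hy0 : 0 < y := by linarith
  have hM4 : 1 ≤ M * 4 ^ A := one_le_mul_of_one_le_of_one_le hM (one_le_pow₀ (by norm_num))
  have hH₂0 : 0 < H₂ := by linarith
  -- gain
  have hgain : Δ ^ (-(η * r ^ 2)) ≤ (H₂ ^ r)⁻¹ := by
    rw [Real.rpow_neg hΔ0.le]
    exact inv_anti₀ (by positivity) hΔ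
  -- The threshold on `Δ` serves to absorb the factors that grow with `r`: `r ≤ 2 ^ r` and `(M * 4 ^
  -- A) ^ r` multiply to at most `H₂ ^ r`. The `4 ^ A` comes from `K ≤ 2 * y`.
  have h2r : (r : ℝ) ≤ 2 ^ r := by exact_mod_cast (Nat.lt_two_pow_self).le
  have hgain2 : (r : ℝ) * (M * 4 ^ A) ^ r * (H₂ ^ r)⁻¹ ≤ 1 := by
    rw [mul_inv_le_iff₀ (by positivity), one_mul]
    calc (r : ℝ) * (M * 4 ^ A) ^ r ≤ 2 ^ r * (M * 4 ^ A) ^ r := by gcongr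
      _ = (2 * (M * 4 ^ A)) ^ r := (mul_pow _ _ _).symm
      _ ≤ H₂ ^ r := by gcongr
  have hM4r : 1 ≤ (M * 4 ^ A) ^ r := one_le_pow₀ hM4
  refine ⟨⌈y⌉₊, Nat.one_le_iff_ne_zero.2 (by positivity), ?_⟩
  set K : ℝ := (⌈y⌉₊ : ℝ) with hK
  have hKy : y ≤ K := Nat.le_ceil y
  have hK2 : K ≤ 2 * y := by
    have := Nat.ceil_lt_add_one hy0.le
    linarith
  have hK0 : 0 < K := by linarith
  have t1 : r * (M * K ^ 2 * (1 / Δ)) ≤ 4 * M * Δ ^ (-η) := by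
    have e1 : K ^ 2 * (1 / Δ) ≤ 4 * (Δ ^ (-η) * Δ ^ (-(η * r ^ 2))) := by
      calc K ^ 2 * (1 / Δ) ≤ (2 * y) ^ 2 * (1 / Δ) := by gcongr
        _ = 4 * (Δ ^ (β * 2) * Δ ^ (-1 : ℝ)) := by
            rw [Real.rpow_mul hΔ0.le, Real.rpow_neg_one, ← hy, Real.rpow_two, one_div]; ring
        _ = 4 * Δ ^ (β * 2 + -1) := by rw [Real.rpow_add hΔ0]
        _ ≤ 4 * Δ ^ (-η + -(η * r ^ 2)) := by
            -- The hypotheses `hη1` and `hη2` add up to `4 * η / c + η * (1 + r ^ 2) ≤ 1`.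
            refine mul_le_mul_of_nonneg_left (Real.rpow_le_rpow_of_exponent_le hΔ1 ?_) (by norm_num)
            have : β * 2 = 4 * η / c := by rw [hβ]; ring
            nlinarith
        _ = _ := by rw [Real.rpow_add hΔ0]
    have e2 : (r : ℝ) * Δ ^ (-(η * r ^ 2)) ≤ 1 := by
      refine le_trans ?_ hgain2
      have : (r : ℝ) ≤ r * (M * 4 ^ A) ^ r := le_mul_of_one_le_right (by positivity) hM4r
      gcongr
    have hη' : 0 ≤ Δ ^ (-η) := by positivity
    calc r * (M * K ^ 2 * (1 / Δ)) = r * M * (K ^ 2 * (1 / Δ)) := by ring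
      _ ≤ r * M * (4 * (Δ ^ (-η) * Δ ^ (-(η * r ^ 2)))) := by gcongr
      _ = 4 * M * Δ ^ (-η) * (r * Δ ^ (-(η * r ^ 2))) := by ring
      _ ≤ 4 * M * Δ ^ (-η) * 1 := by gcongr
      _ = _ := mul_one _
  have t2 : 2 * C * K ^ (-c) ≤ (√(2 * C) * Δ ^ (-η)) ^ 2 := by
    rw [mul_pow, Real.sq_sqrt (by positivity), ← Real.rpow_two, ← Real.rpow_mul hΔ0.le]
    refine mul_le_mul_of_nonneg_left ?_ (by positivity)
    calc K ^ (-c) ≤ y ^ (-c) := Real.rpow_le_rpow_of_nonpos hy0 hKy (by linarith)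
      _ = Δ ^ (-η * 2) := by
        rw [hy, ← Real.rpow_mul hΔ0.le]
        congr 1
        rw [hβ]; field_simp
  have t3 : b * Δ ^ (-ζ) * (M * K ^ (2 * A)) ^ q ≤ (√H₁ * Δ ^ (-η)) ^ 2 := by
    rw [mul_pow (√H₁), Real.sq_sqrt (by positivity), ← Real.rpow_two, ← Real.rpow_mul hΔ0.le]
    have e1 : (M * K ^ (2 * A)) ^ q ≤ (M * 4 ^ A) ^ r * Δ ^ (β * (2 * A * r)) := by
      have : M * K ^ (2 * A) ≤ (M * 4 ^ A) * y ^ (2 * A) := by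
        calc M * K ^ (2 * A) ≤ M * (2 * y) ^ (2 * A) := by gcongr
          _ = _ := by rw [mul_pow, pow_mul 2 2 A]; norm_num; ring
      have h1 : 1 ≤ (M * 4 ^ A) * y ^ (2 * A) :=
        one_le_mul_of_one_le_of_one_le hM4 (one_le_pow₀ hy1)
      calc (M * K ^ (2 * A)) ^ q ≤ ((M * 4 ^ A) * y ^ (2 * A)) ^ q := by gcongr
        _ ≤ ((M * 4 ^ A) * y ^ (2 * A)) ^ r := pow_le_pow_right₀ h1 hq
        _ = _ := by
          rw [mul_pow, ← pow_mul, Real.rpow_mul hΔ0.le, ← hy]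
          congr 1
          rw [← Real.rpow_natCast]
          push_cast
          rfl
    -- Twice `hζ`: the exponent `ζ` of the previous stage pays for the norms of the correlations,
    -- for the square root, and for the factors growing with `r`.
    have e2 : Δ ^ (-ζ) * Δ ^ (β * (2 * A * r)) ≤ Δ ^ (-η * 2) * Δ ^ (-(η * r ^ 2)) := by
      rw [← Real.rpow_add hΔ0, ← Real.rpow_add hΔ0]
      refine Real.rpow_le_rpow_of_exponent_le hΔ1 ?_
      have e : β * (2 * A * r) = 2 * η * (2 * A * r / c) := by rw [hβ]; ring
      rw [e]
      have : 0 ≤ η * (r : ℝ) ^ 2 := by positivity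
      nlinarith
    calc b * Δ ^ (-ζ) * (M * K ^ (2 * A)) ^ q
        ≤ (r * H₁) * Δ ^ (-ζ) * ((M * 4 ^ A) ^ r * Δ ^ (β * (2 * A * r))) := by gcongr
      _ = (r * H₁) * (M * 4 ^ A) ^ r * (Δ ^ (-ζ) * Δ ^ (β * (2 * A * r))) := by ring
      _ ≤ (r * H₁) * (M * 4 ^ A) ^ r * (Δ ^ (-η * 2) * Δ ^ (-(η * r ^ 2))) := by gcongr
      _ ≤ (r * H₁) * (M * 4 ^ A) ^ r * (Δ ^ (-η * 2) * (H₂ ^ r)⁻¹) := by gcongr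
      _ = H₁ * Δ ^ (-η * 2) * (r * (M * 4 ^ A) ^ r * (H₂ ^ r)⁻¹) := by ring
      _ ≤ H₁ * Δ ^ (-η * 2) * 1 := by gcongr
      _ = _ := mul_one _
  have t4 : √(2 * C * K ^ (-c) + b * Δ ^ (-ζ) * (M * K ^ (2 * A)) ^ q)
      ≤ √(2 * C) * Δ ^ (-η) + √H₁ * Δ ^ (-η) := by
    refine Real.sqrt_le_iff.2 ⟨by positivity, (add_le_add t2 t3).trans ?_⟩
    have : 0 ≤ (√(2 * C) * Δ ^ (-η)) * (√H₁ * Δ ^ (-η)) := by positivity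
    nlinarith
  calc _ ≤ 4 * M * Δ ^ (-η) + (√(2 * C) * Δ ^ (-η) + √H₁ * Δ ^ (-η)) := add_le_add t1 t4
    _ = _ := by ring

/-- For `r ≥ 1` every term on the left is at most a multiple of `r ^ 2`. With `a = A / c` this is
the condition on `ζ` in the choice of the averaging length, once `rate_succ` is inserted. -/
theorem one_add_sq_add_le {r a l : ℝ} (hr : 1 ≤ r) (ha : 0 ≤ a) (hl : 4 + 4 * a ≤ l) :
    1 + r ^ 2 + 2 * a * r ≤ r ^ 2 * l / 2 := by
  have h1 : 1 ≤ r ^ 2 := one_le_pow₀ hr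
  have h2 : r ≤ r ^ 2 := by nlinarith
  have h3 : a * r ≤ a * r ^ 2 := by gcongr
  have h4 : r ^ 2 * (4 + 4 * a) ≤ r ^ 2 * l := by gcongr
  linarith

/-- The rate of multiple equidistribution. -/
def rate (l : ℝ) (r : ℕ) : ℝ := 1 / ((r.factorial : ℝ) ^ 2 * l ^ r)

/-- The exponent of the threshold for multiple equidistribution. -/
def thresholdExp (l : ℝ) (r : ℕ) : ℝ := ((r - 1).factorial : ℝ) * (r.factorial : ℝ) * l ^ r

theorem rate_pos {l : ℝ} (hl : 1 < l) (r : ℕ) : 0 < rate l r := by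
  have : 0 < l := by linarith
  have := r.factorial_pos
  unfold rate
  positivity

/-- One more function divides the rate by `(r + 1) ^ 2 * l`. The square pays for the factors growing
with the number of functions, `l` for the square root and the growth of the norms. -/
theorem rate_succ {l : ℝ} (hl : 1 < l) (r : ℕ) :
    rate l r = ((r + 1 : ℕ) : ℝ) ^ 2 * l * rate l (r + 1) := by
  have : 0 < l := by linarith
  have := r.factorial_pos
  unfold rate
  rw [Nat.factorial_succ]
  push_cast
  field_simp
  ring

theorem rate_antitone {l : ℝ} (hl : 1 < l) : Antitone (rate l) := by
  refine antitone_nat_of_succ_le fun r => ?_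
  rw [rate_succ hl r]
  have h1 : (1 : ℝ) ≤ ((r + 1 : ℕ) : ℝ) ^ 2 := one_le_pow₀ (by exact_mod_cast Nat.succ_pos r)
  exact le_mul_of_one_le_left (rate_pos hl _).le (one_le_mul_of_one_le_of_one_le h1 hl.le)

theorem thresholdExp_mono {l : ℝ} (hl : 1 < l) : Monotone (thresholdExp l) := by
  have : 0 < l := by linarith
  intro a b hab
  unfold thresholdExp
  have h1 : ((a - 1).factorial : ℝ) ≤ (b - 1).factorial := by
    exact_mod_cast Nat.factorial_le (by omega)
  have h2 : (a.factorial : ℝ) ≤ b.factorial := by exact_mod_cast Nat.factorial_le hab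
  have h3 : l ^ a ≤ l ^ b := pow_le_pow_right₀ hl.le hab
  gcongr

theorem thresholdExp_nonneg {l : ℝ} (hl : 1 < l) (r : ℕ) : 0 ≤ thresholdExp l r := by
  have : 0 < l := by linarith
  unfold thresholdExp
  positivity

/-- This identity dictates the threshold: if `Δ` exceeds `H₂ ^ thresholdExp l r`, then `Δ ^ (rate l
r * r ^ 2)` exceeds `H₂ ^ r`, which absorbs the factors growing with `r`. -/
theorem thresholdExp_mul_rate {l : ℝ} (hl : 1 < l) {r : ℕ} (hr : 1 ≤ r) :
    thresholdExp l r * (rate l r * r ^ 2) = r := by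
  obtain ⟨r, rfl⟩ : ∃ k, r = k + 1 := ⟨r - 1, by omega⟩
  have : 0 < l := by linarith
  have := r.factorial_pos
  unfold thresholdExp rate
  rw [Nat.add_sub_cancel, Nat.factorial_succ]
  push_cast
  field_simp

theorem rate_mul_sq_le {l : ℝ} (hl : 1 < l) {r : ℕ} (hr : 1 ≤ r) : rate l r * r ^ 2 ≤ 1 / l := by
  obtain ⟨r, rfl⟩ : ∃ k, r = k + 1 := ⟨r - 1, by omega⟩
  have h0 : 0 < l := by linarith
  have h1 : rate l r ≤ 1 := by
    unfold rate
    rw [div_le_one (by have := r.factorial_pos; positivity)]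
    exact one_le_mul_of_one_le_of_one_le (one_le_pow₀ (by exact_mod_cast r.factorial_pos))
      (one_le_pow₀ hl.le)
  rw [rate_succ hl] at h1
  rw [le_div_iff₀ h0]
  linarith

variable {G X T ι : Type*} [Group G] [MulAction G X] [MeasurableSpace X] [Group T]
  {μ ν : Measure X} {𝒜 : Set (X → ℂ)} {S : ℕ → (X → ℂ) → ℝ}
    {u : ι → ℝ → G} {τ : T → G} {α : ι → T →* ℝˣ} {Tplus : Set T} {ρ : T → ℝ}
    {M : ℝ} {A : ℕ} {C c D δ : ℝ}

/-- Effective multiple equidistribution for `r` functions, with explicit constants. -/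
def MultipleBound (μ ν : Measure X) (𝒜 : Set (X → ℂ)) (S : ℕ → (X → ℂ) → ℝ)
    (u : ι → ℝ → G) (τ : T → G) (α : ι → T →* ℝˣ) (Tplus : Set T) (ρ : T → ℝ)
    (H₁ H₂ l : ℝ) (r : ℕ) : Prop :=
  ∀ (J : Type) (s : Finset J), s.card = r → ∀ (φ : J → X → ℂ), (∀ i, φ i ∈ 𝒜) →
    ∀ (t : J → T), (∀ i ∈ s, t i ∈ Tplus) → ∀ Δ : ℝ, H₂ ^ thresholdExp l r < Δ →
      (∀ i ∈ s, Δ ≤ ρ (t i)) →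
      (∀ i ∈ s, ∀ j ∈ s, i ≠ j → Δ ≤ starNorm α (t i * (t j)⁻¹)) →
      ∀ ψ : X → ℂ, IsEigenfunction ν u ψ →
        ‖∫ x, ψ x * ∏ i ∈ s, φ i (τ (t i) • x) ∂ν - (∫ x, ψ x ∂ν) * ∏ i ∈ s, ∫ x, φ i x ∂μ‖
          ≤ r * H₁ * Δ ^ (-rate l r) * ∏ i ∈ s, S (r + 1) (φ i)

theorem multipleBound_zero (H₁ H₂ l : ℝ) :
    MultipleBound μ ν 𝒜 S u τ α Tplus ρ H₁ H₂ l 0 := by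
  intro J s hs φ _ t _ Δ _ _ _ ψ _
  rw [Finset.card_eq_zero] at hs
  subst hs
  simp

namespace EquidistData

/-- The induction step for multiple equidistribution, once the functions have been separated. -/
theorem multiple_step [MeasurableConstSMul G X] [IsProbabilityMeasure μ] [IsProbabilityMeasure ν]
    (h : EquidistData μ ν 𝒜 S u τ α Tplus ρ M A C c D δ) {H₁ H₂ l : ℝ} (hl : 1 < l)
    (hl4 : 4 ≤ l) (hlc : 8 / c ≤ l) (hH₂ : 2 * (M * 4 ^ A) ≤ H₂)
    (hH₁1 : 1 ≤ H₁) (hH₁ : 2 * (4 * M + √(2 * C) + √H₁) ≤ H₁) {r : ℕ} (hr : 1 ≤ r)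
    (ih : MultipleBound μ ν 𝒜 S u τ α Tplus ρ H₁ H₂ l (r - 1))
    {J : Type} {s : Finset J} (hs : s.card = r) {φ : J → X → ℂ} (hφ : ∀ i, φ i ∈ 𝒜)
    {t : J → T} (ht : ∀ i ∈ s, t i ∈ Tplus) {Δ : ℝ} (hΔ : H₂ ^ thresholdExp l r < Δ)
    (hΔρ : ∀ i ∈ s, Δ ≤ ρ (t i))
    (hΔt : ∀ i ∈ s, ∀ j ∈ s, i ≠ j → Δ ≤ starNorm α (t i * (t j)⁻¹))
    {ψ : X → ℂ} (hψ : IsEigenfunction ν u ψ)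
    {I : Finset J} (hI : I ⊆ s) (i₀ : ι) {k : J} (hk : k ∈ I)
    (hαI : ∀ i ∈ I, |((α i₀ (t i) : ℝˣ) : ℝ)| ≤ |((α i₀ (t k) : ℝˣ) : ℝ)|)
    (hαJ : ∀ i ∈ s, i ∉ I → |((α i₀ (t i) : ℝˣ) : ℝ)| ≤ |((α i₀ (t k) : ℝˣ) : ℝ)| * (1 / Δ))
    {b ζ : ℝ} (hb0 : 0 ≤ b) (hb : b ≤ r * H₁)
    (hζ : rate l r * (1 + r ^ 2 + 2 * A * r / c) ≤ ζ / 2)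
    (hB : ∀ Φ : J → X → ℂ, (∀ i, Φ i ∈ 𝒜) →
      ‖∫ x, ∏ i ∈ I, Φ i (τ (t i) • x) ∂ν - ∏ i ∈ I, ∫ x, Φ i x ∂μ‖
        ≤ b * Δ ^ (-ζ) * ∏ i ∈ I, S r (Φ i)) :
    ‖∫ x, ψ x * ∏ i ∈ s, φ i (τ (t i) • x) ∂ν - (∫ x, ψ x ∂ν) * ∏ i ∈ s, ∫ x, φ i x ∂μ‖
          ≤ r * H₁ * Δ ^ (-rate l r) * ∏ i ∈ s, S (r + 1) (φ i) := by
  classical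
  have hM4 : 1 ≤ M * 4 ^ A :=
    one_le_mul_of_one_le_of_one_le h.one_le_M (one_le_pow₀ (by norm_num))
  have hH₂1 : 1 ≤ H₂ := by linarith
  have hΔ1 : 1 ≤ Δ := (Real.one_le_rpow hH₂1 (thresholdExp_nonneg hl r)).trans hΔ.le
  have hΔ0 : 0 < Δ := by linarith
  have hc := h.c_pos
  have hl0 : 0 < l := by linarith
  have hη := rate_pos hl r
  set η := rate l r with hηdef
  have hr2 : (1 : ℝ) ≤ (r : ℝ) ^ 2 := one_le_pow₀ (by exact_mod_cast hr)
  have hη2 := rate_mul_sq_le hl hr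
  rw [← hηdef] at hη2
  have hηl : η ≤ 1 / l := le_trans (le_mul_of_one_le_right hη.le hr2) hη2
  have hl' : 1 / l ≤ 1 / 4 := one_div_le_one_div_of_le (by norm_num) hl4
  have hlc' : 1 / l ≤ c / 8 := by
    rw [div_le_iff₀ hc] at hlc
    rw [div_le_iff₀ hl0]
    linarith
  obtain ⟨K, hK, hKb⟩ := exists_average_length (M := M) (C := C) (c := c) (η := η) (Δ := Δ)
    (H₁ := H₁) (H₂ := H₂) (b := b) (ζ := ζ) (A := A) (r := r) (q := I.card) hr
    (hs ▸ Finset.card_le_card hI) h.one_le_M h.one_le_C hc hη hΔ1 hH₁1 hH₂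
    (by
      calc H₂ ^ r = (H₂ ^ thresholdExp l r) ^ (η * r ^ 2) := by
            rw [← Real.rpow_mul (by linarith), thresholdExp_mul_rate hl hr, Real.rpow_natCast]
        _ ≤ _ := Real.rpow_le_rpow (by positivity) hΔ.le (by positivity))
    (by linarith)
    (by rw [div_le_iff₀ hc]; linarith) hb hζ
  have hks : k ∈ s := hI hk
  set m := ∫ x, φ k x ∂μ with hm
  have hφk := h.sub_const _ (hφ k) m
  -- Only the mean-zero part of `φ k` enters the van der Corput estimate; the constant `m` leaves a
  -- product over `s.erase k`.
  set φ' : J → X → ℂ := Function.update φ k (fun x => φ k x - m) with hφ'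
  have hφ'A : ∀ i, φ' i ∈ 𝒜 := by
    intro i
    by_cases hi : i = k
    · subst hi; simpa [hφ'] using hφk.1
    · simpa [hφ', hi] using hφ i
  have hφ'k : ∫ x, φ' k x ∂μ = 0 := by
    have : Integrable (φ k) μ := Integrable.of_bound (h.meas _ (hφ k)).aestronglyMeasurable _
      (.of_forall (h.norm_le _ (hφ k) 1))
    simp only [hφ', Function.update_self]
    rw [integral_sub this (integrable_const _)]
    simp [hm]
  have hα0 : 0 < |((α i₀ (t k) : ℝˣ) : ℝ)| := abs_pos.2 (Units.ne_zero _)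
  -- The unit of time `σ` makes `t k`, the fastest translation in `I`, move at unit speed; outside
  -- `I` the speed is then at most `1 / Δ`.
  have hZ := h.norm_integral_mul_prod_le_of_integral_eq_zero hI hφ'A t i₀
    (σ := |((α i₀ (t k) : ℝˣ) : ℝ)|⁻¹) (θ := 1 / Δ) (by positivity) (by positivity) hK
    (fun i hi => by rw [← div_eq_mul_inv, div_le_one hα0]; exact hαI i hi)
    (fun i hi hi' => by
      rw [← div_eq_mul_inv, div_le_iff₀ hα0, mul_comm]; exact hαJ i hi hi')
    hk (mul_inv_cancel₀ hα0.ne') hφ'k hr (by positivity) hB hψ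
  rw [hs] at hZ
  set p : J → ℝ := fun i => S (r + 1) (φ i) with hp
  have hp0 : ∀ i, 0 ≤ p i := fun i => h.nonneg (hφ i) _
  have hmp : ‖m‖ ≤ p k := h.norm_integral_le (hφ k) _
  set P := ∏ i ∈ s, p i with hP
  have hP0 : 0 ≤ P := Finset.prod_nonneg fun i _ => hp0 i
  have hPk : P = p k * ∏ i ∈ s.erase k, p i := (Finset.mul_prod_erase s p hks).symm
  -- Subtracting the mean at most doubles the norm of `φ k`; this is the factor `2` in `hH₁`.
  have hP' : ∏ i ∈ s, S (r + 1) (φ' i) ≤ 2 * P := by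
    rw [hPk, ← Finset.mul_prod_erase s _ hks, ← mul_assoc]
    have e : ∏ i ∈ s.erase k, S (r + 1) (φ' i) = ∏ i ∈ s.erase k, p i :=
      Finset.prod_congr rfl fun i hi => by
        simp [hφ', hp, Function.update_of_ne (Finset.ne_of_mem_erase hi)]
    rw [e]
    refine mul_le_mul_of_nonneg_right ?_ (Finset.prod_nonneg fun i _ => hp0 i)
    simp only [hφ', Function.update_self]
    exact (hφk.2 (r + 1)).trans (by simp only [hp] at hmp ⊢; linarith)
  have hΔη : 0 ≤ Δ ^ (-η) := by positivity
  have hZ' : ‖∫ x, ψ x * ∏ i ∈ s, φ' i (τ (t i) • x) ∂ν‖ ≤ H₁ * Δ ^ (-η) * P := by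
    refine hZ.trans ?_
    calc _ ≤ (4 * M + √(2 * C) + √H₁) * Δ ^ (-η) * (2 * P) :=
          mul_le_mul hKb hP' (Finset.prod_nonneg fun i _ => h.nonneg (hφ'A i) _)
            (by have := h.one_le_M; positivity)
      _ = 2 * (4 * M + √(2 * C) + √H₁) * (Δ ^ (-η) * P) := by ring
      _ ≤ H₁ * (Δ ^ (-η) * P) := by gcongr
      _ = _ := by ring
  -- the term with one function fewer
  have hih := ih J (s.erase k) (by rw [Finset.card_erase_of_mem hks, hs]) φ hφ t
    (fun i hi => ht i (Finset.mem_of_mem_erase hi)) Δ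
    ((Real.rpow_le_rpow_of_exponent_le hH₂1 (thresholdExp_mono hl (by omega))).trans_lt hΔ)
    (fun i hi => hΔρ i (Finset.mem_of_mem_erase hi))
    (fun i hi j hj => hΔt i (Finset.mem_of_mem_erase hi) j (Finset.mem_of_mem_erase hj)) ψ hψ
  have hih' : ‖m‖ * ‖∫ x, ψ x * ∏ i ∈ s.erase k, φ i (τ (t i) • x) ∂ν
      - (∫ x, ψ x ∂ν) * ∏ i ∈ s.erase k, ∫ x, φ i x ∂μ‖ ≤ (r - 1) * H₁ * Δ ^ (-η) * P := by
    have e1 : Δ ^ (-rate l (r - 1)) ≤ Δ ^ (-η) :=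
      Real.rpow_le_rpow_of_exponent_le hΔ1 (neg_le_neg (rate_antitone hl (by omega)))
    have e2 : ∏ i ∈ s.erase k, S (r - 1 + 1) (φ i) ≤ ∏ i ∈ s.erase k, p i :=
      Finset.prod_le_prod (fun i _ => h.nonneg (hφ i) _) fun i _ => h.mono_le (hφ i) (by omega)
    have e3 : ((r - 1 : ℕ) : ℝ) = r - 1 := by push_cast [hr]; ring
    rw [e3] at hih
    have hr0 : (0 : ℝ) ≤ r - 1 := by
      have : (1 : ℝ) ≤ r := by exact_mod_cast hr
      linarith
    calc _ ≤ p k * ((r - 1) * H₁ * Δ ^ (-rate l (r - 1))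
            * ∏ i ∈ s.erase k, S (r - 1 + 1) (φ i)) :=
          mul_le_mul hmp hih (norm_nonneg _) (hp0 k)
      _ ≤ p k * ((r - 1) * H₁ * Δ ^ (-η) * ∏ i ∈ s.erase k, p i) := by
          have := hp0 k
          have : 0 ≤ ∏ i ∈ s.erase k, S (r - 1 + 1) (φ i) :=
            Finset.prod_nonneg fun i _ => h.nonneg (hφ i) _
          gcongr
      _ = _ := by rw [hPk]; ring
  have hψi : Integrable ψ ν := hψ.memLp.integrable one_le_two
  have hint : ∀ (s : Finset J) (φ : J → X → ℂ), (∀ i, φ i ∈ 𝒜) →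
      Integrable (fun x => ψ x * ∏ i ∈ s, φ i (τ (t i) • x)) ν := by
    intro s φ hφ
    refine hψi.mul_bdd (c := ∏ i ∈ s, S 1 (φ i)) (Finset.measurable_prod _ fun i _ =>
      h.measurable_translate (hφ i) _).aestronglyMeasurable (.of_forall fun x => ?_)
    rw [norm_prod]
    exact Finset.prod_le_prod (fun _ _ => norm_nonneg _) fun i _ => h.norm_le _ (hφ i) _ _
  have hsplit : ∫ x, ψ x * ∏ i ∈ s, φ i (τ (t i) • x) ∂ν
      = ∫ x, ψ x * ∏ i ∈ s, φ' i (τ (t i) • x) ∂ν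
        + m * ∫ x, ψ x * ∏ i ∈ s.erase k, φ i (τ (t i) • x) ∂ν := by
    rw [← integral_const_mul, ← integral_add (hint s φ' hφ'A) ((hint _ φ hφ).const_mul _)]
    refine integral_congr_ae (.of_forall fun x => ?_)
    simp only
    rw [← Finset.mul_prod_erase s _ hks, ← Finset.mul_prod_erase s _ hks]
    have e : ∏ i ∈ s.erase k, φ' i (τ (t i) • x) = ∏ i ∈ s.erase k, φ i (τ (t i) • x) :=
      Finset.prod_congr rfl fun i hi => by
        simp [hφ', Function.update_of_ne (Finset.ne_of_mem_erase hi)]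
    rw [e]
    simp only [hφ', Function.update_self]
    ring
  rw [hsplit, ← Finset.mul_prod_erase s _ hks, ← hm]
  calc _ = ‖∫ x, ψ x * ∏ i ∈ s, φ' i (τ (t i) • x) ∂ν
        + m * (∫ x, ψ x * ∏ i ∈ s.erase k, φ i (τ (t i) • x) ∂ν
          - (∫ x, ψ x ∂ν) * ∏ i ∈ s.erase k, ∫ x, φ i x ∂μ)‖ := by congr 1; ring
    -- The mean-zero part costs `H₁` and the `r - 1` other functions cost `(r - 1) * H₁`, which
    -- explains the linear factor `r` in the bound.
    _ ≤ H₁ * Δ ^ (-η) * P + (r - 1) * H₁ * Δ ^ (-η) * P := by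
        refine (norm_add_le _ _).trans (add_le_add hZ' ?_)
        rw [norm_mul]; exact hih'
    _ = _ := by ring

theorem exists_starNorm_eq [Fintype ι] [Nonempty ι] (α : ι → T →* ℝˣ) (t : T) :
    ∃ i, starNorm α t = max |((α i t : ℝˣ) : ℝ)| |((α i t : ℝˣ) : ℝ)|⁻¹ := by
  obtain ⟨i, hi⟩ := exists_eq_ciSup_of_finite
    (f := fun i => max |((α i t : ℝˣ) : ℝ)| |((α i t : ℝˣ) : ℝ)|⁻¹)
  exact ⟨i, hi.symm⟩

theorem starNorm_of_isEmpty [IsEmpty ι] (α : ι → T →* ℝˣ) (t : T) : starNorm α t = 0 := by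
  simp [starNorm]

/-- Effective multiple equidistribution against eigenfunctions. -/
theorem multipleBound [Fintype ι] [Nonempty ι] [MeasurableConstSMul G X]
    [IsProbabilityMeasure μ] [IsProbabilityMeasure ν]
    (h : EquidistData μ ν 𝒜 S u τ α Tplus ρ M A C c D δ) :
    ∃ H₁ H₂ l : ℝ, 0 < H₁ ∧ 1 ≤ H₂ ∧ 1 < l ∧
      ∀ r, MultipleBound μ ν 𝒜 S u τ α Tplus ρ H₁ H₂ l r := by
  classical
  have hc := h.c_pos
  have hδ := h.δ_pos
  have hD := h.one_le_D
  have hM := h.one_le_M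
  set R := 4 * M + √(2 * C) with hR
  have hR0 : 0 ≤ R := by positivity
  -- From `√H₁ ≥ R + 2` follows `2 * (R + √H₁) ≤ H₁`, so the same constant survives every induction
  -- step. The factor `D` covers the case of one function.
  set H₁ := D * (R + 2) ^ 2 with hH₁
  set H₂ := 2 * (M * 4 ^ A) with hH₂
  -- The terms `4` and `8 / c` are for the averaging length, `4 + 4 * A / c` for the passage from
  -- `I` to `s`, and the last one for `r = 1`, where the available exponent is `δ`.
  set l := 4 + 8 / c + 4 * A / c + 2 / δ * (2 + 2 * A / c) with hldef
  have hAc : 0 ≤ (A : ℝ) / c := by positivity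
  have p1 : 0 < 8 / c := by positivity
  have p2 : 0 ≤ 4 * (A : ℝ) / c := by positivity
  have p3 : 0 < 2 / δ * (2 + 2 * A / c) := by positivity
  have hl4 : 4 ≤ l := by linarith
  have hl : 1 < l := by linarith
  have hlc : 8 / c ≤ l := by linarith
  have hH₁D : D ≤ H₁ := le_mul_of_one_le_right (by linarith) (one_le_pow₀ (by linarith))
  have hH₁1 : 1 ≤ H₁ := hD.trans hH₁D
  have hH₁R : 2 * (4 * M + √(2 * C) + √H₁) ≤ H₁ := by
    have h1 : R + 2 ≤ √H₁ := by
      refine Real.le_sqrt_of_sq_le ?_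
      exact le_mul_of_one_le_left (by positivity) hD
    have h2 : √H₁ ^ 2 = H₁ := Real.sq_sqrt (by positivity)
    rw [← hR]
    nlinarith
  have hM4 : 1 ≤ M * 4 ^ A := one_le_mul_of_one_le_of_one_le hM (one_le_pow₀ (by norm_num))
  have hH₂1 : 1 ≤ H₂ := by linarith
  refine ⟨H₁, H₂, l, by linarith, hH₂1, hl, fun r => ?_⟩
  induction r using Nat.strong_induction_on with
  | _ r ih =>
  rcases Nat.eq_zero_or_pos r with rfl | hr
  · exact multipleBound_zero _ _ _
  intro J s hs φ hφ t ht Δ hΔ hΔρ hΔt ψ hψ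
  have hΔ1 : 1 ≤ Δ := (Real.one_le_rpow hH₂1 (thresholdExp_nonneg hl r)).trans hΔ.le
  have hΔ0 : 0 < Δ := by linarith
  rcases Nat.lt_or_ge r 2 with hr2 | hr2
  · obtain rfl : r = 1 := by omega
    obtain ⟨k, rfl⟩ := Finset.card_eq_one.1 hs
    -- For one function any direction will do, and the bound required for `I = {k}` is the
    -- equidistribution of translates of `ν`, with exponent `δ` and constant `D`.
    refine h.multiple_step hl hl4 hlc le_rfl hH₁1 hH₁R hr (ih 0 one_pos) hs hφ ht hΔ hΔρ
      hΔt hψ (I := {k}) subset_rfl (Classical.arbitrary ι) (Finset.mem_singleton_self k) (b := D)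
      (ζ := δ) ?_ ?_ (by linarith) (by simpa using hH₁D) ?_ ?_
    · intro i hi; rw [Finset.mem_singleton.1 hi]
    · intro i hi hi'; exact absurd hi hi'
    · have e : rate l 1 = 1 / l := by simp [rate]
      rw [e]
      have : 2 / δ * (2 + 2 * A / c) ≤ l := by linarith
      rw [div_mul_eq_mul_div, div_le_iff₀ hδ] at this
      rw [div_mul_eq_mul_div, div_le_iff₀ (by linarith)]
      norm_num
      linarith
    · intro Φ hΦ
      simp only [Finset.prod_singleton]
      refine (h.equi _ (hΦ k) _ (ht k (Finset.mem_singleton_self k))).trans ?_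
      have : ρ (t k) ^ (-δ) ≤ Δ ^ (-δ) :=
        Real.rpow_le_rpow_of_nonpos hΔ0 (hΔρ k (Finset.mem_singleton_self k)) (by linarith)
      have := h.nonneg (hΦ k) 1
      gcongr
  · -- a direction in which two of the translations differ
    obtain ⟨a, ha, b, hb, hab⟩ := Finset.one_lt_card.1 (by omega : 1 < s.card)
    obtain ⟨i₀, hi₀⟩ := exists_starNorm_eq α (t a * (t b)⁻¹)
    have hw : ∀ i, 0 < |((α i₀ (t i) : ℝˣ) : ℝ)| := fun i => abs_pos.2 (Units.ne_zero _)
    -- The norm `starNorm` does not tell which of the two translations is the stronger one; `j`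
    -- names the weaker one.
    obtain ⟨j, hj, j', hj', hjj⟩ : ∃ j ∈ s, ∃ j' ∈ s,
        |((α i₀ (t j) : ℝˣ) : ℝ)| ≤ |((α i₀ (t j') : ℝˣ) : ℝ)| * (1 / Δ) := by
      have := hΔt a ha b hb hab
      rw [hi₀, map_mul, map_inv, Units.val_mul, abs_mul, Units.val_inv_eq_inv_val, abs_inv,
        le_max_iff, mul_inv, inv_inv] at this
      have ha0 := hw a
      have hb0 := hw b
      rcases this with h' | h'
      · refine ⟨b, hb, a, ha, ?_⟩
        rw [← div_eq_mul_inv, le_div_iff₀ hb0] at h'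
        rw [mul_one_div, le_div_iff₀ hΔ0]; linarith
      · refine ⟨a, ha, b, hb, ?_⟩
        rw [inv_mul_eq_div, le_div_iff₀ ha0] at h'
        rw [mul_one_div, le_div_iff₀ hΔ0]; linarith
    obtain ⟨k, hk, hkmax⟩ := s.exists_max_image (fun i => |((α i₀ (t i) : ℝˣ) : ℝ)|) ⟨j, hj⟩
    -- The translations that expand `i₀` within a factor `Δ` of the strongest. It contains `k` but
    -- not `j`, hence is nonempty and proper.
    set I := s.filter fun i => |((α i₀ (t k) : ℝˣ) : ℝ)| * (1 / Δ) < |((α i₀ (t i) : ℝˣ) : ℝ)|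
      with hI
    have hIs : I ⊆ s := Finset.filter_subset _ _
    have hΔgt : 1 < Δ := by
      refine lt_of_le_of_lt ?_ hΔ
      exact Real.one_le_rpow hH₂1 (thresholdExp_nonneg hl r)
    have hkI : k ∈ I := by
      rw [hI, Finset.mem_filter]
      refine ⟨hk, mul_lt_of_lt_one_right (hw k) ?_⟩
      rw [div_lt_one hΔ0]; exact hΔgt
    have hjI : j ∉ I := by
      rw [hI, Finset.mem_filter, not_and, not_lt]
      intro _
      refine hjj.trans ?_
      have := hkmax j' hj'
      gcongr
    have hIcard : I.card < r := by
      rw [← hs]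
      exact Finset.card_lt_card ⟨hIs, fun hsub => hjI (hsub hj)⟩
    have hIpos : 1 ≤ I.card := Finset.card_pos.2 ⟨k, hkI⟩
    have hthr : H₂ ^ thresholdExp l I.card < Δ :=
      (Real.rpow_le_rpow_of_exponent_le hH₂1 (thresholdExp_mono hl hIcard.le)).trans_lt hΔ
    refine h.multiple_step hl hl4 hlc le_rfl hH₁1 hH₁R hr (ih (r - 1) (by omega)) hs hφ ht hΔ
      hΔρ hΔt hψ hIs i₀ hkI (fun i hi => hkmax i (hIs hi)) (fun i hi hi' => ?_)
      (b := I.card * H₁) (ζ := rate l I.card) (by positivity) (by gcongr) ?_ ?_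
    · rw [hI, Finset.mem_filter, not_and, not_lt] at hi'
      exact hi' hi
    · have e1 : rate l (r - 1) ≤ rate l I.card := rate_antitone hl (by omega)
      have e2 := rate_succ hl (r - 1)
      rw [Nat.sub_add_cancel hr] at e2
      have hη := rate_pos hl r
      have hr1 : (1 : ℝ) ≤ r := by exact_mod_cast hr
      have e3 := one_add_sq_add_le (a := A / c) hr1 hAc (l := l) (by
        have : (4 : ℝ) * A / c = 4 * (A / c) := by ring
        linarith)
      rw [show 2 * (A / c) * (r : ℝ) = 2 * A * r / c by ring] at e3
      calc rate l r * (1 + r ^ 2 + 2 * A * r / c) ≤ rate l r * (r ^ 2 * l / 2) := by gcongr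
        _ = rate l (r - 1) / 2 := by rw [e2]; ring
        _ ≤ _ := by gcongr
    · intro Φ hΦ
      -- Since `I.card < r`, the norms `S (I.card + 1)` of this bound are at most `S r`, as the van
      -- der Corput estimate with `d = r` requires.
      have := ih I.card hIcard J I rfl Φ hΦ t (fun i hi => ht i (hIs hi)) Δ hthr
        (fun i hi => hΔρ i (hIs hi)) (fun i hi j hj => hΔt i (hIs hi) j (hIs hj)) (fun _ => 1)
        (isEigenfunction_one u)
      simp only [one_mul, integral_const, probReal_univ, one_smul] at this
      refine this.trans ?_
      refine mul_le_mul_of_nonneg_left ?_ (by positivity)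
      exact Finset.prod_le_prod (fun i _ => h.nonneg (hΦ i) _) fun i _ =>
        h.mono_le (hΦ i) (by omega)

end EquidistData

end Induction

/-! ### Differentials and velocities as maps of the model spaces -/

section Differential

variable {E F F' : Type*} [NormedAddCommGroup E] [NormedSpace ℝ E] [NormedAddCommGroup F]
  [NormedSpace ℝ F] [NormedAddCommGroup F'] [NormedSpace ℝ F']
  {M N N' : Type*} [TopologicalSpace M] [ChartedSpace E M] [TopologicalSpace N] [ChartedSpace F N]
  [TopologicalSpace N'] [ChartedSpace F' N']

/-- The differential of a map between manifolds, as a linear map between the model spaces. -/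
def differential (f : M → N) (x : M) : E →L[ℝ] F := mfderiv 𝓘(ℝ, E) 𝓘(ℝ, F) f x

/-- `f` has the differential `D` at `x`. -/
def HasDifferentialAt (f : M → N) (D : E →L[ℝ] F) (x : M) : Prop :=
  HasMFDerivAt 𝓘(ℝ, E) 𝓘(ℝ, F) f x D

theorem HasDifferentialAt.differential {f : M → N} {D : E →L[ℝ] F} {x : M}
    (h : HasDifferentialAt f D x) : differential f x = D :=
  HasMFDerivAt.mfderiv h

theorem HasDifferentialAt.comp {f : M → N} {g : N → N'} {D : E →L[ℝ] F} {D' : F →L[ℝ] F'}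
    {x : M} {y : N} (hg : HasDifferentialAt g D' y) (hf : HasDifferentialAt f D x) (hy : f x = y) :
    HasDifferentialAt (fun z => g (f z)) (D'.comp D) x := by
  subst hy
  exact HasMFDerivAt.comp x hg hf

theorem HasDifferentialAt.continuousAt {f : M → N} {D : E →L[ℝ] F} {x : M}
    (h : HasDifferentialAt f D x) : ContinuousAt f x :=
  HasMFDerivAt.continuousAt h

theorem hasDifferentialAt_iff_hasFDerivAt {f : E → F} {D : E →L[ℝ] F} {x : E} :
    HasDifferentialAt f D x ↔ HasFDerivAt f D x :=
  hasMFDerivAt_iff_hasFDerivAt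

theorem hasDifferentialAt_id (x : M) : HasDifferentialAt (fun y : M => y) (.id ℝ E) x :=
  hasMFDerivAt_id x

theorem _root_.ContMDiff.hasDifferentialAt {f : M → N} {n : WithTop ℕ∞}
    (h : ContMDiff 𝓘(ℝ, E) 𝓘(ℝ, F) n f) (hn : n ≠ 0) (x : M) :
    HasDifferentialAt f (MultiEquidist.differential f x : E →L[ℝ] F) x :=
  (h.contMDiffAt.mdifferentiableAt hn).hasMFDerivAt

/-- The curve `c` has velocity `v` at time `t`. -/
def HasVelocityAt (c : ℝ → M) (v : E) (t : ℝ) : Prop :=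
  HasDifferentialAt c (ContinuousLinearMap.smulRight (1 : ℝ →L[ℝ] ℝ) v) t

theorem HasVelocityAt.continuousAt {c : ℝ → M} {v : E} {t : ℝ} (h : HasVelocityAt c v t) :
    ContinuousAt c t :=
  HasDifferentialAt.continuousAt h

theorem HasDifferentialAt.comp_velocity {c : ℝ → M} {v : E} {t : ℝ} {x : M} {f : M → N}
    {D : E →L[ℝ] F} (hf : HasDifferentialAt f D x) (hc : HasVelocityAt c v t) (hx : c t = x) :
    HasVelocityAt (fun s => f (c s)) (D v) t := by
  have := HasDifferentialAt.comp hf hc hx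
  unfold HasVelocityAt
  convert this using 1
  ext
  simp

theorem HasVelocityAt.comp_deriv {c : ℝ → M} {v : E} {t s : ℝ} {f : ℝ → ℝ} {f' : ℝ}
    (hc : HasVelocityAt c v s) (hf : HasDerivAt f f' t) (hs : f t = s) :
    HasVelocityAt (fun s => c (f s)) (f' • v) t := by
  have := HasDifferentialAt.comp hc (hasDifferentialAt_iff_hasFDerivAt.2 hf.hasFDerivAt) hs
  unfold HasVelocityAt
  convert this using 1
  ext
  simp

theorem hasVelocityAt_iff_hasDerivAt {c : ℝ → E} {v : E} {t : ℝ} :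
    HasVelocityAt c v t ↔ HasDerivAt c v t := by
  unfold HasVelocityAt
  rw [hasDifferentialAt_iff_hasFDerivAt, hasDerivAt_iff_hasFDerivAt]
  rfl

theorem HasVelocityAt.differential_apply_one {c : ℝ → M} {v : E} {t : ℝ}
    (hc : HasVelocityAt c v t) : differential c t (1 : ℝ) = v := by
  rw [HasDifferentialAt.differential hc]
  simp

end Differential

/-! ### One-parameter subgroups of a Lie group -/

section Exponential

variable {E : Type*} [NormedAddCommGroup E] [NormedSpace ℝ E]
  {G : Type*} [TopologicalSpace G] [ChartedSpace E G] [Group G] [LieGroup 𝓘(ℝ, E) ∞ G]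

theorem lieGroup_minSmoothness (E G : Type*) [NormedAddCommGroup E] [NormedSpace ℝ E]
    [TopologicalSpace G] [ChartedSpace E G] [Group G] [LieGroup 𝓘(ℝ, E) ∞ G] :
    LieGroup 𝓘(ℝ, E) (minSmoothness ℝ 3) G :=
  LieGroup.of_le (n := ∞) (by
    rw [minSmoothness_of_isRCLikeNormedField]; exact ENat.LEInfty.out)

theorem contMDiff_invariantField (v : Lie𝔤 E G) :
    ContMDiff 𝓘(ℝ, E) 𝓘(ℝ, E).tangent 1
      (fun g : G => (⟨g, mulInvariantVectorField (I := 𝓘(ℝ, E)) v g⟩ :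
        TangentBundle 𝓘(ℝ, E) G)) := by
  have := lieGroup_minSmoothness E G
  have := contMDiff_mulInvariantVectorField (I := 𝓘(ℝ, E)) (G := G) v
  exact this.of_le (by rw [minSmoothness_of_isRCLikeNormedField]; exact one_le_two)

theorem hasDifferentialAt_mul_left (g h : G) :
    HasDifferentialAt (fun x : G => g * x) (differential (fun x : G => g * x) h : E →L[ℝ] E) h :=
  (contMDiff_mul_left (I := 𝓘(ℝ, E)) (n := ∞) (a := g)).hasDifferentialAt (by simp) h

theorem hasDifferentialAt_mul_right (g h : G) :
    HasDifferentialAt (fun x : G => x * g) (differential (fun x : G => x * g) h : E →L[ℝ] E) h :=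
  (contMDiff_mul_right (I := 𝓘(ℝ, E)) (n := ∞) (a := g)).hasDifferentialAt (by simp) h

/-- The left-invariant vector field defined by `v`. -/
def leftField (v : E) (g : G) : E := differential (fun x : G => g * x) 1 v

/-- The right-invariant vector field defined by `v`. -/
def rightField (v : E) (g : G) : E := differential (fun x : G => x * g) 1 v

theorem leftField_mul (v : E) (g h : G) :
    leftField v (g * h) = differential (fun x : G => g * x) h (leftField v h) := by
  have h1 := (hasDifferentialAt_mul_left (E := E) g h).comp
    (hasDifferentialAt_mul_left (E := E) h (1 : G)) (mul_one h)
  simp only [← mul_assoc] at h1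
  unfold leftField
  rw [h1.differential]
  rfl

theorem rightField_mul (v : E) (g h : G) :
    rightField v (h * g) = differential (fun x : G => x * g) h (rightField v h) := by
  have h1 := (hasDifferentialAt_mul_right (E := E) g h).comp
    (hasDifferentialAt_mul_right (E := E) h (1 : G)) (one_mul h)
  simp only [mul_assoc] at h1
  unfold rightField
  rw [h1.differential]
  rfl

theorem leftField_one (v : E) : leftField v (1 : G) = v := by
  have h1 := (hasDifferentialAt_id (E := E) (1 : G)).differential
  unfold leftField
  simp only [one_mul, h1]
  rfl

theorem rightField_one (v : E) : rightField v (1 : G) = v := by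
  have h1 := (hasDifferentialAt_id (E := E) (1 : G)).differential
  unfold rightField
  simp only [mul_one, h1]
  rfl

theorem isMIntegralCurveOn_iff_of_isOpen {γ : ℝ → G} {v : Lie𝔤 E G} {s : Set ℝ} (hs : IsOpen s) :
    IsMIntegralCurveOn (I := 𝓘(ℝ, E)) γ (mulInvariantVectorField (I := 𝓘(ℝ, E)) v) s ↔
      ∀ t ∈ s, HasVelocityAt γ (leftField (E := E) v (γ t)) t :=
  ⟨fun h t ht => (h t ht).hasMFDerivAt (hs.mem_nhds ht),
    fun h t ht => HasMFDerivAt.hasMFDerivWithinAt (h t ht)⟩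

theorem HasVelocityAt.mul_left {γ : ℝ → G} {v : E} {t : ℝ}
    (h : HasVelocityAt γ (leftField v (γ t)) t) (g : G) :
    HasVelocityAt (fun s => g * γ s) (leftField v (g * γ t)) t := by
  rw [leftField_mul]
  exact (hasDifferentialAt_mul_left g (γ t)).comp_velocity h rfl

variable [CompleteSpace E] [T2Space G]

/-- A local integral curve through `1` exists for some time `ε`. Its left translates are integral
curves through all other points with the same `ε`, and a uniform time of existence implies
completeness. -/
theorem exists_integralCurve (v : E) :
    ∃ γ : ℝ → G, γ 0 = 1 ∧ ∀ t, HasVelocityAt γ (leftField v (γ t)) t := by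
  obtain ⟨γ, hγ0, hγ⟩ := exists_isMIntegralCurveAt_of_contMDiffAt_boundaryless (t₀ := 0)
    ((contMDiff_invariantField (E := E) (G := G) v).contMDiffAt (x := 1))
  rw [isMIntegralCurveAt_iff'] at hγ
  obtain ⟨ε, hε, hγ⟩ := hγ
  replace hγ := (isMIntegralCurveOn_iff_of_isOpen Metric.isOpen_ball).1 hγ
  rw [Real.ball_eq_Ioo, zero_sub, zero_add] at hγ
  refine exists_isMIntegralCurve_of_isMIntegralCurveOn (contMDiff_invariantField (E := E) v) hε
    (fun g => ⟨fun t => g * γ t, by simp [hγ0], ?_⟩) 1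
  exact (isMIntegralCurveOn_iff_of_isOpen isOpen_Ioo).2 fun t ht => (hγ t ht).mul_left g

theorem integralCurve_unique {v : E} {γ γ' : ℝ → G} (h0 : γ 0 = γ' 0)
    (h : ∀ t, HasVelocityAt γ (leftField v (γ t)) t)
    (h' : ∀ t, HasVelocityAt γ' (leftField v (γ' t)) t) : γ = γ' :=
  isMIntegralCurve_Ioo_eq_of_contMDiff_boundaryless (t₀ := 0)
    (contMDiff_invariantField (E := E) v) h h' h0

theorem lieExp_eq {v : E} {γ : ℝ → G} (h0 : γ 0 = 1)
    (h : ∀ t, HasVelocityAt γ (leftField v (γ t)) t) : lieExp (v : Lie𝔤 E G) = γ 1 := by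
  have hex : ∃ γ : ℝ → G, γ 0 = 1 ∧ IsMIntegralCurve (I := 𝓘(ℝ, E)) γ
      (mulInvariantVectorField (I := 𝓘(ℝ, E)) (v : Lie𝔤 E G)) := ⟨γ, h0, h⟩
  unfold lieExp
  rw [dif_pos hex]
  exact congrFun (integralCurve_unique (hex.choose_spec.1.trans h0.symm) hex.choose_spec.2 h) 1

theorem lieExp_smul_eq {v : E} {γ : ℝ → G} (h0 : γ 0 = 1)
    (h : ∀ t, HasVelocityAt γ (leftField v (γ t)) t) (s : ℝ) :
    lieExp (s • v : Lie𝔤 E G) = γ s := by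
  have := lieExp_eq (v := s • v) (γ := fun t => γ (s * t)) (by simp [h0]) fun t => by
    have e : leftField (s • v) (γ (s * t)) = s • leftField v (γ (s * t)) := by
      simp [leftField]
    rw [e]
    exact (h (s * t)).comp_deriv (by simpa using (hasDerivAt_id t).const_mul s) rfl
  simpa using this

/-- The one-parameter subgroup `s ↦ exp (s v)`. -/
def oneParam (v : E) (s : ℝ) : G := lieExp (s • v : Lie𝔤 E G)

theorem oneParam_hasVelocityAt_leftField (v : E) (t : ℝ) :
    HasVelocityAt (oneParam v : ℝ → G) (leftField v (oneParam v t : G)) t := by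
  obtain ⟨γ, h0, h⟩ := exists_integralCurve (G := G) v
  have e : (oneParam v : ℝ → G) = γ := funext fun s => lieExp_smul_eq h0 h s
  rw [e]
  exact h t

@[simp] theorem oneParam_zero (v : E) : (oneParam v 0 : G) = 1 := by
  obtain ⟨γ, h0, h⟩ := exists_integralCurve (G := G) v
  exact (lieExp_smul_eq h0 h 0).trans h0

theorem oneParam_hasVelocityAt_zero (v : E) : HasVelocityAt (oneParam v : ℝ → G) v 0 := by
  have := oneParam_hasVelocityAt_leftField (G := G) v 0
  rwa [oneParam_zero, leftField_one] at this

/-- As functions of `t` both sides are integral curves of the same left-invariant field through the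
same point. -/
theorem oneParam_add (v : E) (s t : ℝ) :
    (oneParam v (s + t) : G) = oneParam v s * oneParam v t := by
  have h := oneParam_hasVelocityAt_leftField (G := G) v
  refine congrFun (integralCurve_unique (v := v) (γ := fun t => oneParam v (s + t))
    (γ' := fun t => oneParam v s * oneParam v t) (by simp) (fun t => ?_)
    fun t => (h t).mul_left _) t
  simpa using (h (s + t)).comp_deriv ((hasDerivAt_id t).const_add s) rfl

theorem oneParam_neg (v : E) (s : ℝ) : (oneParam v (-s) : G) = (oneParam v s)⁻¹ := by
  rw [eq_inv_iff_mul_eq_one, ← oneParam_add]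
  simp

theorem oneParam_smul (v : E) (a s : ℝ) : (oneParam (a • v) s : G) = oneParam v (s * a) := by
  unfold oneParam
  rw [smul_smul]

theorem oneParam_continuous (v : E) : Continuous (oneParam v : ℝ → G) :=
  continuous_iff_continuousAt.2 fun t => (oneParam_hasVelocityAt_leftField v t).continuousAt

/-- A one-parameter subgroup is determined by its velocity at time zero. -/
theorem eq_oneParam {c : ℝ → G} {v : E} (hadd : ∀ s t, c (s + t) = c s * c t)
    (hv : HasVelocityAt c v 0) (s : ℝ) : c s = oneParam v s := by
  have h0 : c 0 = 1 := by simpa using hadd 0 0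
  refine congrFun (integralCurve_unique (v := v) (γ := c) (γ' := oneParam v) (by simp [h0])
    (fun t => ?_) (oneParam_hasVelocityAt_leftField v)) s
  have h1 : HasVelocityAt (fun s => c (s - t)) v t := by
    simpa using hv.comp_deriv ((hasDerivAt_id t).sub_const t) (by simp)
  have h2 := (hasDifferentialAt_mul_left (E := E) (c t) 1).comp_velocity h1 (by simp [h0])
  have e : (fun s => c t * c (s - t)) = c := by
    funext s; rw [← hadd]; congr 1; ring
  rw [e] at h2
  exact h2

theorem hasDifferentialAt_conj (g : G) :
    HasDifferentialAt (fun x : G => g * x * g⁻¹)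
      (differential (fun x : G => g * x * g⁻¹) 1 : E →L[ℝ] E) 1 := by
  have h : ContMDiff 𝓘(ℝ, E) 𝓘(ℝ, E) ∞ fun x : G => g * x * g⁻¹ :=
    (contMDiff_mul_right (I := 𝓘(ℝ, E)) (n := ∞) (a := g⁻¹)).comp contMDiff_mul_left
  exact h.hasDifferentialAt (by simp) 1

/-- The conjugate is a one-parameter subgroup, with velocity `Ad g v` at time zero by definition of
`Ad`. -/
theorem conj_oneParam (g : G) (v : E) (s : ℝ) :
    g * oneParam v s * g⁻¹ = oneParam (E := E) (Ad g (v : Lie𝔤 E G)) s := by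
  refine eq_oneParam (c := fun s => g * oneParam v s * g⁻¹) (fun s t => ?_) ?_ s
  · rw [oneParam_add]; group
  · exact (hasDifferentialAt_conj g).comp_velocity (oneParam_hasVelocityAt_zero v) (by simp)

/-- Writing the curve as `oneParam v (s - t) * oneParam v t` shows that it also follows the
right-invariant field. The action on `G ⧸ Γ` is from the left, so that derivatives and metric are
expressed by right-invariant fields. -/
theorem oneParam_hasVelocityAt_rightField (v : E) (t : ℝ) :
    HasVelocityAt (oneParam v : ℝ → G) (rightField v (oneParam v t : G)) t := by
  have h1 : HasVelocityAt (fun s => (oneParam v (s - t) : G)) v t := by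
    simpa using (oneParam_hasVelocityAt_zero v).comp_deriv ((hasDerivAt_id t).sub_const t) (by simp)
  have h2 := (hasDifferentialAt_mul_right (E := E) (oneParam v t : G) 1).comp_velocity h1
    (by simp)
  have e : (fun s => (oneParam v (s - t) : G) * oneParam v t) = oneParam v := by
    funext s; rw [← oneParam_add]; congr 1; ring
  rw [e] at h2
  exact h2

end Exponential

/-! ### One-parameter subgroups inside a closed subgroup -/

section ClosedSubgroup

open Filter Topology

variable {E : Type*} [NormedAddCommGroup E] [NormedSpace ℝ E]
  {G : Type*} [TopologicalSpace G] [ChartedSpace E G] [Group G]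

/-- The coordinates near the identity, centered at the identity. -/
def logChart (E : Type*) {G : Type*} [NormedAddCommGroup E] [NormedSpace ℝ E] [TopologicalSpace G]
    [ChartedSpace E G] [Group G] (g : G) : E :=
  extChartAt 𝓘(ℝ, E) (1 : G) g - extChartAt 𝓘(ℝ, E) (1 : G) 1

/-- The inverse of the centered coordinates. -/
def expChart {E : Type*} (G : Type*) [NormedAddCommGroup E] [NormedSpace ℝ E] [TopologicalSpace G]
    [ChartedSpace E G] [Group G] (x : E) : G :=
  (extChartAt 𝓘(ℝ, E) (1 : G)).symm (x + extChartAt 𝓘(ℝ, E) (1 : G) 1)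

theorem logChart_one : logChart E (1 : G) = 0 := sub_self _

theorem expChart_zero : expChart G (0 : E) = 1 := by
  simp [expChart]

theorem expChart_logChart {g : G} (hg : g ∈ (extChartAt 𝓘(ℝ, E) (1 : G)).source) :
    expChart G (logChart E g) = g := by
  rw [expChart, logChart, sub_add_cancel, (extChartAt 𝓘(ℝ, E) (1 : G)).left_inv hg]

theorem eventually_logChart_expChart : ∀ᶠ x in 𝓝 (0 : E), logChart E (expChart G x) = x := by
  have h : ∀ᶠ x in 𝓝 (0 : E), x + extChartAt 𝓘(ℝ, E) (1 : G) 1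
      ∈ (extChartAt 𝓘(ℝ, E) (1 : G)).target := by
    have : ContinuousAt (fun x : E => x + extChartAt 𝓘(ℝ, E) (1 : G) 1) 0 := by fun_prop
    refine this.eventually ?_
    simp only [zero_add]
    exact extChartAt_target_mem_nhds (I := 𝓘(ℝ, E)) (1 : G)
  filter_upwards [h] with x hx
  rw [logChart, expChart, (extChartAt 𝓘(ℝ, E) (1 : G)).right_inv hx, add_sub_cancel_right]

variable [LieGroup 𝓘(ℝ, E) ∞ G]

theorem contMDiffAt_logChart {g : G} (hg : g ∈ (extChartAt 𝓘(ℝ, E) (1 : G)).source) :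
    ContMDiffAt 𝓘(ℝ, E) 𝓘(ℝ, E) ∞ (logChart E : G → E) g := by
  have h1 : ContMDiffAt 𝓘(ℝ, E) 𝓘(ℝ, E) ∞ (extChartAt 𝓘(ℝ, E) (1 : G)) g :=
    contMDiffAt_extChartAt' (by rwa [extChartAt_source] at hg)
  have h2 : ContMDiff 𝓘(ℝ, E) 𝓘(ℝ, E) ∞ fun x : E => x - extChartAt 𝓘(ℝ, E) (1 : G) 1 := by
    rw [contMDiff_iff_contDiff]; fun_prop
  exact h2.contMDiffAt.comp g h1

theorem contMDiffAt_expChart : ContMDiffAt 𝓘(ℝ, E) 𝓘(ℝ, E) ∞ (expChart G : E → G) 0 := by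
  have h1 : ContMDiffAt 𝓘(ℝ, E) 𝓘(ℝ, E) ∞ (extChartAt 𝓘(ℝ, E) (1 : G)).symm
      (0 + extChartAt 𝓘(ℝ, E) (1 : G) 1) := by
    rw [zero_add]
    exact (contMDiffOn_extChartAt_symm (1 : G)).contMDiffAt
      (extChartAt_target_mem_nhds (I := 𝓘(ℝ, E)) (1 : G))
  have h2 : ContMDiff 𝓘(ℝ, E) 𝓘(ℝ, E) ∞ fun x : E => x + extChartAt 𝓘(ℝ, E) (1 : G) 1 := by
    rw [contMDiff_iff_contDiff]; fun_prop
  exact h1.comp (0 : E) h2.contMDiffAt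

theorem hasDifferentialAt_logChart :
    HasDifferentialAt (logChart E : G → E) (.id ℝ E) 1 := by
  refine ⟨(contMDiffAt_logChart (mem_extChartAt_source _)).continuousAt, ?_⟩
  have : writtenInExtChartAt 𝓘(ℝ, E) 𝓘(ℝ, E) (1 : G) (logChart E : G → E)
      =ᶠ[𝓝 (extChartAt 𝓘(ℝ, E) (1 : G) 1)] fun x => x - extChartAt 𝓘(ℝ, E) (1 : G) 1 := by
    filter_upwards [extChartAt_target_mem_nhds (I := 𝓘(ℝ, E)) (1 : G)] with x hx
    simp only [writtenInExtChartAt, logChart, Function.comp_apply,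
      (extChartAt 𝓘(ℝ, E) (1 : G)).right_inv hx]
    rfl
  have h := ((hasFDerivAt_id (𝕜 := ℝ) (extChartAt 𝓘(ℝ, E) (1 : G) 1)).sub_const
    (extChartAt 𝓘(ℝ, E) (1 : G) 1)).congr_of_eventuallyEq this
  exact h.hasFDerivWithinAt

/-- Multiplication in coordinates. -/
theorem contDiffAt_mul_chart :
    ContDiffAt ℝ 1 (fun p : E × E => logChart E (expChart G p.1 * expChart G p.2)) 0 := by
  rw [← contMDiffAt_iff_contDiffAt]
  have h1 : ContMDiffAt 𝓘(ℝ, E × E) 𝓘(ℝ, E) ∞ (fun p : E × E => expChart G p.1) 0 :=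
    ContMDiffAt.comp (x := (0 : E × E)) (g := (expChart G : E → G)) contMDiffAt_expChart
      (contMDiff_iff_contDiff.2 contDiff_fst).contMDiffAt
  have h2 : ContMDiffAt 𝓘(ℝ, E × E) 𝓘(ℝ, E) ∞ (fun p : E × E => expChart G p.2) 0 :=
    ContMDiffAt.comp (x := (0 : E × E)) (g := (expChart G : E → G)) contMDiffAt_expChart
      (contMDiff_iff_contDiff.2 contDiff_snd).contMDiffAt
  have h3 := h1.mul h2
  refine ContMDiffAt.of_le (n := ∞) (ContMDiffAt.comp (x := (0 : E × E)) (g := (logChart E : G → E))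
    (contMDiffAt_logChart ?_) h3) (by simp)
  simp [expChart_zero]

/-- Conjugation in coordinates. -/
theorem contDiffAt_conj_chart :
    ContDiffAt ℝ 1 (fun p : E × E =>
      logChart E (expChart G p.1 * expChart G p.2 * (expChart G p.1)⁻¹)) 0 := by
  rw [← contMDiffAt_iff_contDiffAt]
  have h1 : ContMDiffAt 𝓘(ℝ, E × E) 𝓘(ℝ, E) ∞ (fun p : E × E => expChart G p.1) 0 :=
    ContMDiffAt.comp (x := (0 : E × E)) (g := (expChart G : E → G)) contMDiffAt_expChart
      (contMDiff_iff_contDiff.2 contDiff_fst).contMDiffAt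
  have h2 : ContMDiffAt 𝓘(ℝ, E × E) 𝓘(ℝ, E) ∞ (fun p : E × E => expChart G p.2) 0 :=
    ContMDiffAt.comp (x := (0 : E × E)) (g := (expChart G : E → G)) contMDiffAt_expChart
      (contMDiff_iff_contDiff.2 contDiff_snd).contMDiffAt
  have h3 := (h1.mul h2).mul h1.inv
  refine ContMDiffAt.of_le (n := ∞) (ContMDiffAt.comp (x := (0 : E × E)) (g := (logChart E : G → E))
    (contMDiffAt_logChart ?_) h3) (by simp)
  simp [expChart_zero]

/-- Lipschitz estimates for multiplication and conjugation near the identity. -/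
theorem exists_chart_estimates :
    ∃ K ε : ℝ, 0 < K ∧ 0 < ε ∧
      let V := {g : G | g ∈ (extChartAt 𝓘(ℝ, E) (1 : G)).source ∧ ‖logChart E g‖ < ε}
      ∀ x ∈ V, ∀ y ∈ V,
        (x * y ∈ (extChartAt 𝓘(ℝ, E) (1 : G)).source ∧
          ∀ y' ∈ V, ‖logChart E (y * x) - logChart E (y' * x)‖
            ≤ K * ‖logChart E y - logChart E y'‖ ∧
          ‖logChart E (x * y) - logChart E (x * y')‖ ≤ K * ‖logChart E y - logChart E y'‖) ∧
        (x * y * x⁻¹ ∈ (extChartAt 𝓘(ℝ, E) (1 : G)).source ∧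
          ‖logChart E (x * y * x⁻¹)‖ ≤ K * ‖logChart E y‖) := by
  have := topologicalGroup_of_lieGroup 𝓘(ℝ, E) (∞ : WithTop ℕ∞) (G := G)
  -- In coordinates, multiplication and conjugation are `C^1` near the origin, hence Lipschitz
  -- there.
  obtain ⟨K₁, s₁, hs₁, hK₁⟩ := (contDiffAt_mul_chart (E := E) (G := G)).exists_lipschitzOnWith
  obtain ⟨K₂, s₂, hs₂, hK₂⟩ := (contDiffAt_conj_chart (E := E) (G := G)).exists_lipschitzOnWith
  have hexp : ContinuousAt (expChart G : E → G) 0 := contMDiffAt_expChart.continuousAt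
  have hsrc : (extChartAt 𝓘(ℝ, E) (1 : G)).source ∈ 𝓝 (1 : G) :=
    extChartAt_source_mem_nhds (I := 𝓘(ℝ, E)) (1 : G)
  have c1 : ContinuousAt (fun p : E × E => expChart G p.1 * expChart G p.2) 0 :=
    (hexp.comp_of_eq continuousAt_fst rfl).mul (hexp.comp_of_eq continuousAt_snd rfl)
  have c2 : ContinuousAt (fun p : E × E => expChart G p.1 * expChart G p.2 * (expChart G p.1)⁻¹) 0 :=
    c1.mul (hexp.comp_of_eq continuousAt_fst rfl).inv
  have e1 : ∀ᶠ p : E × E in 𝓝 0,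
      expChart G p.1 * expChart G p.2 ∈ (extChartAt 𝓘(ℝ, E) (1 : G)).source :=
    c1.eventually (by simpa [expChart_zero] using hsrc)
  have e2 : ∀ᶠ p : E × E in 𝓝 0, expChart G p.1 * expChart G p.2 * (expChart G p.1)⁻¹
      ∈ (extChartAt 𝓘(ℝ, E) (1 : G)).source :=
    c2.eventually (by simpa [expChart_zero] using hsrc)
  obtain ⟨ε, hε, hball⟩ := Metric.mem_nhds_iff.1 (inter_mem (inter_mem hs₁ hs₂) (inter_mem e1 e2))
  have hmem : ∀ x y : E, ‖x‖ < ε → ‖y‖ < ε → (x, y) ∈ Metric.ball (0 : E × E) ε := fun x y hx hy => by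
    rw [mem_ball_zero_iff, Prod.norm_def]; exact max_lt hx hy
  refine ⟨K₁ + K₂ + 1, ε, by positivity, hε, ?_⟩
  intro V x hx y hy
  have hxy := hball (hmem _ _ hx.2 hy.2)
  have ex := expChart_logChart hx.1
  have ey := expChart_logChart hy.1
  have hKm : (K₁ : ℝ) ≤ K₁ + K₂ + 1 := by have := K₂.2; linarith [K₂.coe_nonneg]
  have hKc : (K₂ : ℝ) ≤ K₁ + K₂ + 1 := by linarith [K₁.coe_nonneg]
  refine ⟨⟨?_, fun y' hy' => ⟨?_, ?_⟩⟩, ?_, ?_⟩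
  · have := hxy.2.1
    simpa [ex, ey] using this
  · have ey' := expChart_logChart hy'.1
    have := hK₁.dist_le_mul _ (hball (hmem _ _ hy.2 hx.2)).1.1 _
      (hball (hmem _ _ hy'.2 hx.2)).1.1
    simp only [ex, ey, ey', dist_eq_norm, Prod.mk_sub_mk, sub_self, Prod.norm_mk, norm_zero] at this
    refine this.trans ?_
    rw [max_eq_left (norm_nonneg _)]
    gcongr
  · have ey' := expChart_logChart hy'.1
    have := hK₁.dist_le_mul _ hxy.1.1 _ (hball (hmem _ _ hx.2 hy'.2)).1.1
    simp only [ex, ey, ey', dist_eq_norm, Prod.mk_sub_mk, sub_self, Prod.norm_mk, norm_zero] at this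
    refine this.trans ?_
    rw [max_eq_right (norm_nonneg _)]
    gcongr
  · have := hxy.2.2
    simpa [ex, ey] using this
  -- Conjugates of `1` are `1`, so the Lipschitz bound against the point `(logChart E x, 0)` is a
  -- bound for the norm itself.
  · have := hK₂.dist_le_mul _ hxy.1.2 _ (hball (hmem (logChart E x) 0 hx.2 (by simpa using hε))).1.2
    simp only [ex, ey, dist_eq_norm, Prod.mk_sub_mk, sub_self, Prod.norm_mk, norm_zero,
      expChart_zero, mul_one, mul_inv_cancel, logChart_one, sub_zero] at this
    refine this.trans ?_
    rw [max_eq_right (norm_nonneg _)]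
    gcongr

theorem tendsto_one_of_logChart {u : ℕ → G}
    (hu : ∀ᶠ n in atTop, u n ∈ (extChartAt 𝓘(ℝ, E) (1 : G)).source)
    (h : Tendsto (fun n => logChart E (u n)) atTop (𝓝 0)) : Tendsto u atTop (𝓝 1) := by
  have h1 : Tendsto (fun n => expChart G (logChart E (u n))) atTop (𝓝 (expChart G (0 : E))) :=
    (contMDiffAt_expChart (E := E) (G := G)).continuousAt.tendsto.comp h
  rw [expChart_zero] at h1
  exact h1.congr' (hu.mono fun n hn => expChart_logChart hn)

variable [CompleteSpace E] [T2Space G]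

theorem logChart_oneParam_hasDerivAt (v : E) :
    HasDerivAt (fun s => logChart E (oneParam v s : G)) v 0 := by
  have := hasDifferentialAt_logChart.comp_velocity (oneParam_hasVelocityAt_zero (G := G) v)
    (by simp)
  simpa using hasVelocityAt_iff_hasDerivAt.1 this

/-- If elements `u n` of a closed subgroup approach the identity in the direction `v`, then the
subgroup contains the one-parameter subgroup of `v`. -/
theorem oneParam_mem_of_tendsto {U : Subgroup G} (hU : IsClosed (U : Set G)) {u : ℕ → G}
    (hu : ∀ n, u n ∈ U) {h : ℕ → ℝ} (hpos : ∀ n, 0 < h n) (h0 : Tendsto h atTop (𝓝 0))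
    (hu1 : Tendsto u atTop (𝓝 1)) {v : E}
    (hv : Tendsto (fun n => (h n)⁻¹ • logChart E (u n)) atTop (𝓝 v)) (s : ℝ) :
    oneParam v s ∈ U := by
  have := topologicalGroup_of_lieGroup 𝓘(ℝ, E) (∞ : WithTop ℕ∞) (G := G)
  obtain ⟨K, ε, hK, hε, hest⟩ := exists_chart_estimates (E := E) (G := G)
  set V := {g : G | g ∈ (extChartAt 𝓘(ℝ, E) (1 : G)).source ∧ ‖logChart E g‖ < ε} with hVdef
  have hVn : V ∈ 𝓝 (1 : G) := by
    refine inter_mem (extChartAt_source_mem_nhds (I := 𝓘(ℝ, E)) (1 : G)) ?_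
    have : ContinuousAt (logChart E : G → E) 1 :=
      (contMDiffAt_logChart (mem_extChartAt_source _)).continuousAt
    exact this.norm.eventually_lt_const (by simpa [logChart_one] using hε)
  have h1V : (1 : G) ∈ V := mem_of_mem_nhds hVn
  set γ : ℝ → G := oneParam v with hγ
  have hγc : Continuous γ := oneParam_continuous v
  have hγ0 : γ 0 = 1 := oneParam_zero v
  obtain ⟨s₀, hs₀, hγV⟩ : ∃ s₀ > 0, ∀ s, |s| ≤ s₀ → γ s ∈ V := by
    have : ∀ᶠ s in 𝓝 (0 : ℝ), γ s ∈ V := hγc.continuousAt.eventually (by rwa [hγ0])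
    obtain ⟨r, hr, hb⟩ := Metric.eventually_nhds_iff.1 this
    exact ⟨r / 2, by linarith, fun s hs => hb (by rw [Real.dist_eq, sub_zero]; linarith)⟩
  -- the error at one step
  have huV : ∀ᶠ n in atTop, u n ∈ V := hu1.eventually hVn
  have hhs : ∀ᶠ n in atTop, h n < s₀ := h0.eventually_lt_const hs₀
  -- `w n` measures how far `u n` is from `γ (h n)`. Both have the same first-order behaviour, so
  -- its coordinates are `o(h n)`, quantified by `h n * d n` with `d n → 0`.
  set w : ℕ → G := fun n => u n * γ (-h n) with hw
  have hγh : Tendsto (fun n => γ (-h n)) atTop (𝓝 1) := by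
    rw [← hγ0]
    exact hγc.continuousAt.tendsto.comp (by simpa using h0.neg)
  have hw1 : Tendsto w atTop (𝓝 1) := by simpa using hu1.mul hγh
  have hwV : ∀ᶠ n in atTop, w n ∈ V := hw1.eventually hVn
  have hder : Tendsto (fun n => (h n)⁻¹ • logChart E (γ (h n))) atTop (𝓝 v) := by
    have := (logChart_oneParam_hasDerivAt (G := G) v).tendsto_slope
    have hh : Tendsto h atTop (𝓝[≠] 0) :=
      tendsto_nhdsWithin_iff.2 ⟨h0, .of_forall fun n => (hpos n).ne'⟩
    refine (this.comp hh).congr fun n => ?_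
    simp [slope_def_module, logChart_one, hγ]
  set d : ℕ → ℝ := fun n => K * ((h n)⁻¹ * ‖logChart E (u n) - logChart E (γ (h n))‖) with hd
  have hd0 : Tendsto d atTop (𝓝 0) := by
    have := ((hv.sub hder).norm.const_mul K)
    simp only [sub_self, norm_zero, mul_zero] at this
    refine this.congr fun n => ?_
    rw [hd, ← smul_sub, norm_smul, norm_inv, Real.norm_of_nonneg (hpos n).le]
  have hwd : ∀ᶠ n in atTop, ‖logChart E (w n)‖ ≤ h n * d n := by
    filter_upwards [huV, hhs] with n hn hhn
    have a1 := hγV (h n) (by rw [abs_of_pos (hpos n)]; exact hhn.le)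
    have a2 := hγV (-h n) (by rw [abs_neg, abs_of_pos (hpos n)]; exact hhn.le)
    have := ((hest _ a2 _ hn).1.2 _ a1).1
    have e : γ (h n) * γ (-h n) = 1 := by rw [hγ, ← oneParam_add]; simp
    rw [e, logChart_one, sub_zero] at this
    refine this.trans (le_of_eq ?_)
    have := (hpos n).ne'
    simp only [hd]
    field_simp
  -- short times
  have hmain : ∀ s, 0 ≤ s → s ≤ s₀ → γ s ∈ U := by
    intro s hs hss
    -- The point `γ s` is the limit of the powers `u n ^ k n`, as `k n * h n → s`.
    set k : ℕ → ℕ := fun n => ⌊s / h n⌋₊ with hk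
    have hkh : ∀ n, k n * h n ≤ s := fun n => by
      have := Nat.floor_le (div_nonneg hs (hpos n).le)
      rwa [le_div_iff₀ (hpos n)] at this
    have hkh' : Tendsto (fun n => k n * h n) atTop (𝓝 s) := by
      have h2 : Tendsto (fun n => s - h n) atTop (𝓝 s) := by simpa using h0.const_sub s
      refine tendsto_of_tendsto_of_tendsto_of_le_of_le h2 tendsto_const_nhds (fun n => ?_) hkh
      have := Nat.lt_floor_add_one (s / h n)
      rw [div_lt_iff₀ (hpos n)] at this
      simp only [hk]
      linarith
    -- The accumulated error of `u n ^ j` against `γ (j * h n)`; passing to `j + 1` multiplies it by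
    -- a conjugate of `w n`.
    set p : ℕ → ℕ → G := fun n j => u n ^ j * γ (-(j * h n)) with hp
    have hpstep : ∀ n j, p n (j + 1)
        = p n j * (γ (j * h n) * w n * (γ (j * h n))⁻¹) := fun n j => by
      simp only [hp, hw, pow_succ]
      have e1 : γ (-(((j + 1 : ℕ) : ℝ) * h n)) = γ (-h n) * γ (-(j * h n)) := by
        rw [hγ, ← oneParam_add]; congr 1; push_cast; ring
      have e2 : γ (-(j * h n)) = (γ (j * h n))⁻¹ := oneParam_neg v _
      rw [e1, e2]
      group
    have hsmall : ∀ᶠ n in atTop, K ^ 2 * (s₀ * d n) + K * (h n * d n) < ε := by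
      have : Tendsto (fun n => K ^ 2 * (s₀ * d n) + K * (h n * d n)) atTop (𝓝 0) := by
        simpa using ((hd0.const_mul s₀).const_mul (K ^ 2)).add ((h0.mul hd0).const_mul K)
      exact this.eventually_lt_const hε
    have hd_nonneg : ∀ n, 0 ≤ d n := fun n => by
      have := (hpos n).le
      simp only [hd]; positivity
    -- Every step adds at most `K * K * (h n * d n)`, one `K` from multiplication and one from
    -- conjugation. As `j * h n ≤ s₀`, the total stays below `ε`, so the estimates remain
    -- applicable.
    have hind : ∀ᶠ n in atTop, ∀ j, j ≤ k n → p n j ∈ (extChartAt 𝓘(ℝ, E) (1 : G)).source ∧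
        ‖logChart E (p n j)‖ ≤ K ^ 2 * (j * h n * d n) := by
      filter_upwards [hsmall, hwV, hwd] with n hn hwn hwdn j
      induction j with
      | zero =>
        intro _
        have : p n 0 = 1 := by simp [hp, hγ0]
        rw [this, logChart_one]
        simp
      | succ j ih =>
        intro hj
        obtain ⟨i1, i2⟩ := ih (by omega)
        have hjh : j * h n ≤ s₀ := by
          refine le_trans ?_ ((hkh n).trans hss)
          have := (hpos n).le
          gcongr
          omega
        have hdn := hd_nonneg n
        have hhn := hpos n
        have hpV : p n j ∈ V := by
          refine ⟨i1, i2.trans_lt (lt_of_le_of_lt ?_ hn)⟩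
          have : K ^ 2 * (j * h n * d n) ≤ K ^ 2 * (s₀ * d n) := by gcongr
          have : 0 ≤ K * (h n * d n) := by positivity
          linarith
        have hγj : γ (j * h n) ∈ V := hγV _ (by rw [abs_of_nonneg (by positivity)]; exact hjh)
        obtain ⟨c1, c2⟩ := (hest _ hγj _ hwn).2
        have c3 : ‖logChart E (γ (j * h n) * w n * (γ (j * h n))⁻¹)‖ ≤ K * (h n * d n) :=
          c2.trans (by gcongr)
        have hcV : γ (j * h n) * w n * (γ (j * h n))⁻¹ ∈ V := by
          refine ⟨c1, c3.trans_lt (lt_of_le_of_lt ?_ hn)⟩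
          have : 0 ≤ K ^ 2 * (s₀ * d n) := by positivity
          linarith
        obtain ⟨m1, m2⟩ := (hest _ hpV _ hcV).1
        have m3 := (m2 1 h1V).2
        rw [mul_one, logChart_one, sub_zero] at m3
        rw [hpstep]
        refine ⟨m1, ?_⟩
        calc _ = ‖(logChart E (p n j * (γ (j * h n) * w n * (γ (j * h n))⁻¹))
              - logChart E (p n j)) + logChart E (p n j)‖ := by rw [sub_add_cancel]
          _ ≤ K * (K * (h n * d n)) + K ^ 2 * (j * h n * d n) :=
            (norm_add_le _ _).trans (add_le_add (m3.trans (by gcongr)) i2)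
          _ = _ := by push_cast; ring
    have hplim : Tendsto (fun n => p n (k n)) atTop (𝓝 1) := by
      refine tendsto_one_of_logChart (E := E) (hind.mono fun n hn => (hn _ le_rfl).1) ?_
      refine squeeze_zero_norm' (a := fun n => K ^ 2 * (s₀ * d n)) (hind.mono fun n hn => ?_)
        (by simpa using (hd0.const_mul s₀).const_mul (K ^ 2))
      refine (hn _ le_rfl).2.trans ?_
      have := hd_nonneg n
      have := (hkh n).trans hss
      gcongr
    have hlim : Tendsto (fun n => u n ^ k n) atTop (𝓝 (γ s)) := by
      have h2 : Tendsto (fun n => γ (k n * h n)) atTop (𝓝 (γ s)) :=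
        hγc.continuousAt.tendsto.comp hkh'
      have h3 := hplim.mul h2
      rw [one_mul] at h3
      refine h3.congr fun n => ?_
      simp only [hp]
      have e2 : γ (-(k n * h n)) = (γ (k n * h n))⁻¹ := oneParam_neg v _
      rw [e2, inv_mul_cancel_right]
    exact hU.mem_of_tendsto hlim (.of_forall fun n => U.pow_mem (hu n) _)
  -- all times
  have hpow : ∀ (n : ℕ) (s : ℝ), γ (n * s) = γ s ^ n := by
    intro n s
    induction n with
    | zero => simp [hγ0]
    | succ n ih =>
      rw [pow_succ, ← ih, hγ, ← oneParam_add]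
      congr 1; push_cast; ring
  have hnn : ∀ s, 0 ≤ s → γ s ∈ U := by
    intro s hs
    obtain ⟨n, hn⟩ := exists_nat_gt (s / s₀)
    have hn0 : (0 : ℝ) < n := lt_of_le_of_lt (by positivity) hn
    have : γ s = γ (s / n) ^ n := by rw [← hpow]; congr 1; field_simp
    rw [this]
    refine U.pow_mem (hmain _ (by positivity) ?_) _
    rw [div_lt_iff₀ hs₀] at hn
    rw [div_le_iff₀ hn0]; linarith
  rcases le_total 0 s with hs | hs
  · exact hnn s hs
  · have := U.inv_mem (hnn (-s) (by linarith))
    rwa [hγ, oneParam_neg, inv_inv] at this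

end ClosedSubgroup

/-! ### The Lie algebra of a closed subgroup -/

section LieAlgebraOfSubgroup

open Filter Topology

variable {E : Type*} [NormedAddCommGroup E] [NormedSpace ℝ E] [CompleteSpace E]
  {G : Type*} [TopologicalSpace G] [ChartedSpace E G] [Group G] [LieGroup 𝓘(ℝ, E) ∞ G] [T2Space G]

/-- In coordinates multiplication is the identity on either axis, so its derivative at the origin is
addition. -/
theorem logChart_mul_oneParam_hasDerivAt (v w : E) :
    HasDerivAt (fun s => logChart E (oneParam v s * oneParam w s : G)) (v + w) 0 := by
  set f : E × E → E := fun p => logChart E (expChart G p.1 * expChart G p.2) with hf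
  have hfd := ((contDiffAt_mul_chart (E := E) (G := G)).differentiableAt one_ne_zero).hasFDerivAt
  set D := fderiv ℝ f 0 with hD
  have h1 : ∀ x : E, D (x, 0) = x := by
    have h : HasFDerivAt (fun x : E => f (x, 0)) (D.comp (.inl ℝ E E)) 0 :=
      HasFDerivAt.comp (0 : E) (f := fun x => (x, (0 : E))) hfd
        (ContinuousLinearMap.inl ℝ E E).hasFDerivAt
    have e : (fun x : E => f (x, 0)) =ᶠ[𝓝 0] fun x => x := by
      filter_upwards [eventually_logChart_expChart (E := E) (G := G)] with x hx
      simp [hf, expChart_zero, hx]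
    have := (h.congr_of_eventuallyEq e.symm).unique (hasFDerivAt_id 0)
    intro x
    simpa using congrArg (fun L => L x) this
  have h2 : ∀ x : E, D (0, x) = x := by
    have h : HasFDerivAt (fun x : E => f (0, x)) (D.comp (.inr ℝ E E)) 0 :=
      HasFDerivAt.comp (0 : E) (f := fun x => ((0 : E), x)) hfd
        (ContinuousLinearMap.inr ℝ E E).hasFDerivAt
    have e : (fun x : E => f (0, x)) =ᶠ[𝓝 0] fun x => x := by
      filter_upwards [eventually_logChart_expChart (E := E) (G := G)] with x hx
      simp [hf, expChart_zero, hx]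
    have := (h.congr_of_eventuallyEq e.symm).unique (hasFDerivAt_id 0)
    intro x
    simpa using congrArg (fun L => L x) this
  have hpair := (logChart_oneParam_hasDerivAt (G := G) v).prodMk
    (logChart_oneParam_hasDerivAt (G := G) w)
  have hcomp := HasFDerivAt.comp_hasDerivAt_of_eq (0 : ℝ) hfd hpair (by
    simp only [oneParam_zero, logChart_one]; rfl)
  have e1 : D (v, w) = v + w := by
    have : ((v, w) : E × E) = (v, 0) + (0, w) := by simp
    rw [this, map_add, h1, h2]
  rw [e1] at hcomp
  refine hcomp.congr_of_eventuallyEq ?_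
  have hsrc : ∀ v : E, ∀ᶠ s in 𝓝 (0 : ℝ),
      (oneParam v s : G) ∈ (extChartAt 𝓘(ℝ, E) (1 : G)).source := fun v =>
    (oneParam_continuous v).continuousAt.eventually (by
      rw [oneParam_zero]; exact extChartAt_source_mem_nhds (I := 𝓘(ℝ, E)) (1 : G))
  filter_upwards [hsrc v, hsrc w] with s hv hw
  simp [expChart_logChart hv, expChart_logChart hw]

/-- The elements `oneParam v (1 / n) * oneParam w (1 / n)` of `U` approach `1` in the direction `v +
w`. -/
theorem oneParam_add_mem {U : Subgroup G} (hU : IsClosed (U : Set G)) {v w : E}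
    (hv : ∀ s, oneParam v s ∈ U) (hw : ∀ s, oneParam w s ∈ U) (s : ℝ) :
    oneParam (v + w) s ∈ U := by
  have := topologicalGroup_of_lieGroup 𝓘(ℝ, E) (∞ : WithTop ℕ∞) (G := G)
  have hpos : ∀ n : ℕ, (0 : ℝ) < 1 / ((n : ℝ) + 1) := fun n => Nat.one_div_pos_of_nat
  have h0 : Tendsto (fun n : ℕ => 1 / ((n : ℝ) + 1)) atTop (𝓝 0) :=
    tendsto_one_div_add_atTop_nhds_zero_nat
  refine oneParam_mem_of_tendsto (E := E) hU
    (u := fun n => oneParam v (1 / ((n : ℝ) + 1)) * oneParam w (1 / ((n : ℝ) + 1)))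
    (fun n => U.mul_mem (hv _) (hw _)) hpos h0 ?_ ?_ s
  · have h : Tendsto (fun s => (oneParam v s * oneParam w s : G)) (𝓝 0)
        (𝓝 (oneParam v 0 * oneParam w 0)) :=
      ((oneParam_continuous (G := G) v).mul (oneParam_continuous (G := G) w)).tendsto 0
    rw [oneParam_zero, oneParam_zero, mul_one] at h
    exact h.comp h0
  · have h := (logChart_mul_oneParam_hasDerivAt (G := G) v w).tendsto_slope
    have hh : Tendsto (fun n : ℕ => 1 / ((n : ℝ) + 1)) atTop (𝓝[≠] 0) :=
      tendsto_nhdsWithin_iff.2 ⟨h0, .of_forall fun n => (hpos n).ne'⟩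
    refine (h.comp hh).congr fun n => ?_
    simp [slope_def_module, logChart_one]

theorem oneParam_smul_mem {U : Subgroup G} {v : E} (hv : ∀ s, oneParam v s ∈ U) (a s : ℝ) :
    oneParam (a • v) s ∈ U := by
  rw [oneParam_smul]
  exact hv _

theorem oneParam_zero_mem (U : Subgroup G) (s : ℝ) : oneParam (0 : E) s ∈ U := by
  have h := oneParam_smul (G := G) (0 : E) 0 s
  rw [smul_zero, mul_zero, oneParam_zero] at h
  exact h ▸ U.one_mem

/-- The span in `lieAlgOf` adds nothing new. Hence the measure `ν` is invariant under the flow of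
every basis vector, not only of the spanning ones. -/
theorem oneParam_mem_of_mem_lieAlgOf {U : Subgroup G} (hU : IsClosed (U : Set G))
    {w : Lie𝔤 E G} (hw : w ∈ lieAlgOf E U) (s : ℝ) : oneParam (E := E) w s ∈ U := by
  unfold lieAlgOf at hw
  induction hw using Submodule.span_induction generalizing s with
  | mem w hw => exact hw s
  | zero => exact oneParam_zero_mem (E := E) U s
  | add v w _ _ hv hw => exact oneParam_add_mem (E := E) hU hv hw s
  | smul a w _ hw => exact oneParam_smul_mem (E := E) hw a s

/-- If a connected `U` is not trivial, its elements different from `1` accumulate at `1`. A limit of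
their normalised coordinates is a unit vector whose one-parameter subgroup lies in `U`. -/
theorem eq_bot_of_lieAlgOf_eq_bot [FiniteDimensional ℝ E] {U : Subgroup G}
    (hU : IsClosed (U : Set G)) (hconn : IsConnected (U : Set G)) (h : lieAlgOf E U = ⊥) :
    U = ⊥ := by
  have := topologicalGroup_of_lieGroup 𝓘(ℝ, E) (∞ : WithTop ℕ∞) (G := G)
  by_contra hne
  obtain ⟨g, hgU, hg1⟩ := U.ne_bot_iff_exists_ne_one.1 hne |>.elim fun a ha =>
    (⟨a, a.2, fun h => ha (Subtype.ext h)⟩ : ∃ g, g ∈ U ∧ g ≠ 1)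
  -- nontrivial elements of `U` accumulate at the identity
  have hacc : ∀ O : Set G, IsOpen O → (1 : G) ∈ O → ∃ u ∈ U, u ∈ O ∧ u ≠ 1 := by
    intro O hO h1
    obtain ⟨x, hxU, hxO, hx1⟩ := hconn.isPreconnected O {1}ᶜ hO isOpen_compl_singleton
      (fun x _ => by
        by_cases hx : x = 1
        · exact Or.inl (hx ▸ h1)
        · exact Or.inr hx)
      ⟨1, U.one_mem, h1⟩ ⟨g, hgU, hg1⟩
    exact ⟨x, hxU, hxO, hx1⟩
  have hsmall : ∀ n : ℕ, ∃ u ∈ U, u ≠ 1 ∧ u ∈ (extChartAt 𝓘(ℝ, E) (1 : G)).source ∧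
      ‖logChart E u‖ < 1 / ((n : ℝ) + 1) := by
    intro n
    have hn : {g : G | g ∈ (extChartAt 𝓘(ℝ, E) (1 : G)).source ∧
        ‖logChart E g‖ < 1 / ((n : ℝ) + 1)} ∈ 𝓝 (1 : G) := by
      refine inter_mem (extChartAt_source_mem_nhds (I := 𝓘(ℝ, E)) (1 : G)) ?_
      have : ContinuousAt (logChart E : G → E) 1 :=
        (contMDiffAt_logChart (mem_extChartAt_source _)).continuousAt
      exact this.norm.eventually_lt_const (by
        simp only [logChart_one, norm_zero]; exact Nat.one_div_pos_of_nat)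
    obtain ⟨O, hO, hOo, hO1⟩ := mem_nhds_iff.1 hn
    obtain ⟨u, huU, huO, hu1⟩ := hacc O hOo hO1
    exact ⟨u, huU, hu1, hO huO⟩
  choose u huU hu1 husrc hun using hsmall
  have hpos : ∀ n, 0 < ‖logChart E (u n)‖ := fun n => by
    rw [norm_pos_iff]
    intro h0
    have := expChart_logChart (E := E) (husrc n)
    rw [h0, expChart_zero] at this
    exact hu1 n this.symm
  have hlim : Tendsto (fun n => ‖logChart E (u n)‖) atTop (𝓝 0) :=
    squeeze_zero (fun n => norm_nonneg _) (fun n => (hun n).le)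
      tendsto_one_div_add_atTop_nhds_zero_nat
  have hu_lim : Tendsto u atTop (𝓝 1) :=
    tendsto_one_of_logChart (E := E) (.of_forall husrc) (tendsto_zero_iff_norm_tendsto_zero.2 hlim)
  have : ProperSpace E := FiniteDimensional.proper ℝ E
  obtain ⟨v, hv, φ, hφ, hφv⟩ := (isCompact_sphere (0 : E) 1).tendsto_subseq
    (x := fun n => ‖logChart E (u n)‖⁻¹ • logChart E (u n)) fun n => by
      rw [mem_sphere_zero_iff_norm, norm_smul, norm_inv, norm_norm]
      exact inv_mul_cancel₀ (hpos n).ne'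
  have hmem := oneParam_mem_of_tendsto (E := E) hU (u := u ∘ φ) (fun n => huU _)
    (h := fun n => ‖logChart E (u (φ n))‖) (fun n => hpos _) (hlim.comp hφ.tendsto_atTop)
    (hu_lim.comp hφ.tendsto_atTop) (v := v) hφv
  have hv0 : v = (0 : E) := by
    have hvU : ∀ w : Lie𝔤 E G, (∀ s : ℝ, lieExp (s • w) ∈ U) → w = 0 := fun w hw => by
      have : w ∈ lieAlgOf E U := Submodule.subset_span hw
      rwa [h, Submodule.mem_bot] at this
    exact hvU v hmem
  rw [hv0] at hv
  simp at hv

end LieAlgebraOfSubgroup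

/-! ### Derivatives of smooth functions on the quotient -/

section SmoothFunctions

open Filter Topology

variable {E : Type*} [NormedAddCommGroup E] [NormedSpace ℝ E] [CompleteSpace E]
  {G : Type*} [TopologicalSpace G] [ChartedSpace E G] [Group G] [LieGroup 𝓘(ℝ, E) ∞ G] [T2Space G]
  [IsTopologicalGroup G] {Γ : Subgroup G}

variable (E) in
/-- A function on `G/Γ` is smooth if its pull-back to `G` is smooth. -/
def IsSmooth (φ : G ⧸ Γ → ℂ) : Prop :=
  ContMDiff 𝓘(ℝ, E) 𝓘(ℝ, ℂ) ∞ (fun g : G => φ (g : G ⧸ Γ))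

theorem IsSmooth.continuous {φ : G ⧸ Γ → ℂ} (hφ : IsSmooth E φ) : Continuous φ :=
  (QuotientGroup.isQuotientMap_mk Γ).continuous_iff.2 (ContMDiff.continuous hφ)

theorem isSmooth_const (c : ℂ) : IsSmooth E (fun _ : G ⧸ Γ => c) := contMDiff_const

theorem IsSmooth.add {φ φ' : G ⧸ Γ → ℂ} (h : IsSmooth E φ) (h' : IsSmooth E φ') :
    IsSmooth E fun x => φ x + φ' x := ContMDiff.add h h'

theorem IsSmooth.mul {φ φ' : G ⧸ Γ → ℂ} (h : IsSmooth E φ) (h' : IsSmooth E φ') :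
    IsSmooth E fun x => φ x * φ' x :=
  ((contDiff_fst.mul contDiff_snd).contMDiff (f := fun p : ℂ × ℂ => p.1 * p.2)).comp
    (ContMDiff.prodMk_space h h')

theorem IsSmooth.conj {φ : G ⧸ Γ → ℂ} (h : IsSmooth E φ) : IsSmooth E fun x => conj (φ x) :=
  (Complex.conjCLE.contDiff.contMDiff (f := fun z : ℂ => conj z)).comp h

theorem IsSmooth.comp_smul {φ : G ⧸ Γ → ℂ} (h : IsSmooth E φ) (g : G) :
    IsSmooth E fun x => φ (g • x) :=
  ContMDiff.comp (g := fun g : G => φ (g : G ⧸ Γ)) h (contMDiff_mul_left (I := 𝓘(ℝ, E)) (a := g))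

theorem IsSmooth.hasDifferentialAt {φ : G ⧸ Γ → ℂ} (h : IsSmooth E φ) (g : G) :
    HasDifferentialAt (fun g : G => φ g)
      (differential (fun g : G => φ g) g : E →L[ℝ] ℂ) g :=
  ContMDiff.hasDifferentialAt h (by simp) g

theorem IsSmooth.hasDerivAt_oneParam_mul {φ : G ⧸ Γ → ℂ} (h : IsSmooth E φ) (Y : E) (g : G) :
    HasDerivAt (fun s => φ ((oneParam Y s * g : G) : G ⧸ Γ))
      (differential (fun g : G => φ g) g (rightField Y g)) 0 := by
  have h1 := (hasDifferentialAt_mul_right (E := E) g 1).comp_velocity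
    (oneParam_hasVelocityAt_zero (G := G) Y) (oneParam_zero Y)
  exact hasVelocityAt_iff_hasDerivAt.1 ((h.hasDifferentialAt g).comp_velocity h1 (by simp))

theorem IsSmooth.lieDeriv_coe {φ : G ⧸ Γ → ℂ} (h : IsSmooth E φ) (Y : E) (g : G) :
    lieDeriv (E := E) Y φ g = differential (fun g : G => φ g) g (rightField Y g) :=
  (h.hasDerivAt_oneParam_mul Y g).deriv

theorem IsSmooth.hasDerivAt_smul {φ : G ⧸ Γ → ℂ} (h : IsSmooth E φ) (Y : E) (x : G ⧸ Γ) (t : ℝ) :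
    HasDerivAt (fun s => φ ((oneParam Y s : G) • x))
      (lieDeriv (E := E) Y φ ((oneParam Y t : G) • x)) t := by
  induction x using QuotientGroup.induction_on with
  | H g =>
    have h1 := h.hasDerivAt_oneParam_mul Y (oneParam Y t * g)
    rw [← h.lieDeriv_coe] at h1
    have h2 := HasDerivAt.comp_sub_const (x := t) (a := t) (by rw [sub_self]; exact h1)
    refine h2.congr_of_eventuallyEq (.of_forall fun s => ?_)
    simp only [← mul_assoc, ← oneParam_add, sub_add_cancel]
    rfl

theorem rightField_add (Y Z : E) (g : G) :
    rightField (Y + Z) g = rightField Y g + rightField Z g := map_add _ _ _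

theorem rightField_smul (a : ℝ) (Y : E) (g : G) :
    rightField (a • Y) g = a • rightField Y g := map_smul _ _ _

theorem IsSmooth.differential_rightField_add {φ : G ⧸ Γ → ℂ} (h : IsSmooth E φ) (Y Z : E) (g : G) :
    lieDeriv (E := E) (Y + Z : E) φ g = lieDeriv (E := E) Y φ g + lieDeriv (E := E) Z φ g := by
  rw [h.lieDeriv_coe, h.lieDeriv_coe, h.lieDeriv_coe, rightField_add, map_add]

theorem IsSmooth.differential_rightField_smul {φ : G ⧸ Γ → ℂ} (h : IsSmooth E φ) (a : ℝ) (Y : E)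
    (g : G) : lieDeriv (E := E) (a • Y : E) φ g = (a : ℂ) * lieDeriv (E := E) Y φ g := by
  rw [h.lieDeriv_coe, h.lieDeriv_coe, rightField_smul, map_smul, Complex.real_smul]

theorem IsSmooth.lieDeriv_add_left {φ : G ⧸ Γ → ℂ} (h : IsSmooth E φ) (Y Z : Lie𝔤 E G) :
    lieDeriv (Y + Z) φ = fun x => lieDeriv Y φ x + lieDeriv Z φ x := by
  funext x
  induction x using QuotientGroup.induction_on with
  | H g => exact h.differential_rightField_add Y Z g

theorem IsSmooth.lieDeriv_smul_left {φ : G ⧸ Γ → ℂ} (h : IsSmooth E φ) (a : ℝ) (Y : Lie𝔤 E G) :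
    lieDeriv (a • Y) φ = fun x => (a : ℂ) * lieDeriv Y φ x := by
  funext x
  induction x using QuotientGroup.induction_on with
  | H g => exact h.differential_rightField_smul a Y g

theorem IsSmooth.lieDeriv_sum_left {φ : G ⧸ Γ → ℂ} (h : IsSmooth E φ) {κ : Type*} (s : Finset κ)
    (a : κ → ℝ) (e : κ → Lie𝔤 E G) :
    lieDeriv (∑ i ∈ s, a i • e i) φ = fun x => ∑ i ∈ s, (a i : ℂ) * lieDeriv (e i) φ x := by
  classical
  induction s using Finset.induction_on with
  | empty =>
    have := h.lieDeriv_smul_left 0 (0 : Lie𝔤 E G)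
    simpa using this
  | insert i s hi ih =>
    rw [Finset.sum_insert hi, h.lieDeriv_add_left, ih, h.lieDeriv_smul_left]
    funext x
    rw [Finset.sum_insert hi]

theorem lieDeriv_const (Y : Lie𝔤 E G) (c : ℂ) : lieDeriv Y (fun _ : G ⧸ Γ => c) = fun _ => 0 := by
  funext x
  simp [lieDeriv]

theorem IsSmooth.hasDerivAt_zero {φ : G ⧸ Γ → ℂ} (h : IsSmooth E φ) (Y : E) (x : G ⧸ Γ) :
    HasDerivAt (fun s => φ ((oneParam (E := E) Y s : G) • x)) (lieDeriv (E := E) Y φ x) 0 := by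
  have := h.hasDerivAt_smul (E := E) Y x 0
  rwa [oneParam_zero, one_smul] at this

theorem IsSmooth.lieDeriv_add {φ φ' : G ⧸ Γ → ℂ} (h : IsSmooth E φ) (h' : IsSmooth E φ')
    (Y : Lie𝔤 E G) :
    lieDeriv Y (fun x => φ x + φ' x) = fun x => lieDeriv Y φ x + lieDeriv Y φ' x := by
  funext x
  exact ((h.hasDerivAt_zero Y x).add (h'.hasDerivAt_zero Y x)).deriv

theorem IsSmooth.lieDeriv_mul {φ φ' : G ⧸ Γ → ℂ} (h : IsSmooth E φ) (h' : IsSmooth E φ')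
    (Y : Lie𝔤 E G) :
    lieDeriv Y (fun x => φ x * φ' x) = fun x => lieDeriv Y φ x * φ' x + φ x * lieDeriv Y φ' x := by
  funext x
  have e : (oneParam (E := E) Y 0 : G) • x = x := by
    have := oneParam_zero (G := G) (E := E) Y
    exact (congrArg (· • x) this).trans (one_smul _ _)
  have := ((h.hasDerivAt_zero Y x).mul (h'.hasDerivAt_zero Y x)).deriv
  rw [e] at this
  exact this

theorem IsSmooth.lieDeriv_conj {φ : G ⧸ Γ → ℂ} (h : IsSmooth E φ) (Y : Lie𝔤 E G) :
    lieDeriv Y (fun x => conj (φ x)) = fun x => conj (lieDeriv Y φ x) := by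
  funext x
  exact (h.hasDerivAt_zero Y x).star.deriv

/-- This is `g * exp (s Y) = exp (s Ad g Y) * g`. -/
theorem lieDeriv_comp_smul {φ : G ⧸ Γ → ℂ} (g : G) (Y : Lie𝔤 E G) :
    lieDeriv Y (fun x => φ (g • x)) = fun x => lieDeriv (Ad g Y) φ (g • x) := by
  funext x
  have e : ∀ s : ℝ, g • (oneParam (E := E) Y s : G) • x
      = (oneParam (E := E) (Ad g Y) s : G) • g • x := fun s => by
    rw [smul_smul, smul_smul]
    congr 1
    have := conj_oneParam (E := E) g Y s
    rw [← this]; group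
  exact congrArg (fun f => deriv f 0) (funext fun s => congrArg φ (e s))

/-- The derivative of a smooth function is smooth. -/
theorem IsSmooth.lieDeriv {φ : G ⧸ Γ → ℂ} (h : IsSmooth E φ) (Y : E) :
    IsSmooth E (lieDeriv (E := E) Y φ : G ⧸ Γ → ℂ) := by
  intro g₀
  -- The chart replaces the exponential map: only the velocity of the curve at time zero matters,
  -- and `expChart` is known to be smooth. The derivative in `x` at `0` then depends smoothly on
  -- `g`.
  set Ψ : G → E → ℂ := fun g x => φ ((expChart G x * g : G) : G ⧸ Γ) with hΨ
  have h1 : ContMDiffAt (𝓘(ℝ, E).prod 𝓘(ℝ, E)) 𝓘(ℝ, ℂ) ∞ (Function.uncurry Ψ) (g₀, (0 : E)) := by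
    have e1 : ContMDiffAt (𝓘(ℝ, E).prod 𝓘(ℝ, E)) 𝓘(ℝ, E) ∞
        (fun p : G × E => expChart G p.2) (g₀, (0 : E)) :=
      ContMDiffAt.comp (x := (g₀, (0 : E))) (g := (expChart G : E → G)) contMDiffAt_expChart
        contMDiffAt_snd
    exact ContMDiffAt.comp (x := (g₀, (0 : E))) (g := fun g : G => φ (g : G ⧸ Γ))
      (ContMDiff.contMDiffAt h) (e1.mul contMDiffAt_fst)
  have h2 := ContMDiffAt.mfderiv (m := ∞) Ψ (fun _ => (0 : E)) h1 contMDiffAt_const (by simp)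
  have h3 : ContMDiffAt 𝓘(ℝ, E) 𝓘(ℝ, ℂ) ∞ (fun g => (fderiv ℝ (Ψ g) 0 : E →L[ℝ] ℂ) Y) g₀ := by
    have h4 : ContMDiffAt 𝓘(ℝ, E) 𝓘(ℝ, E →L[ℝ] ℂ) ∞ (fun g => fderiv ℝ (Ψ g) 0) g₀ := by
      -- Between vector spaces the tangent coordinates are trivial.
      have e : inTangentCoordinates 𝓘(ℝ, E) 𝓘(ℝ, ℂ) (fun _ : G => (0 : E)) (fun g => Ψ g 0)
          (fun g => (mfderiv 𝓘(ℝ, E) 𝓘(ℝ, ℂ) (Ψ g) 0 : E →L[ℝ] ℂ)) g₀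
          = fun g => fderiv ℝ (Ψ g) 0 := by
        simp only [mfderiv_eq_fderiv]
        ext1 g
        simp [inTangentCoordinates, inCoordinates_tangent_bundle_core_model_space]
      rw [← e]
      exact h2
    exact h4.clm_apply contMDiffAt_const
  have e : (fun g : G => MultiEquidist.lieDeriv (E := E) Y φ (g : G ⧸ Γ))
      = fun g => (fderiv ℝ (Ψ g) 0 : E →L[ℝ] ℂ) Y := by
    funext g
    have hd : DifferentiableAt ℝ (Ψ g) 0 := by
      have d1 : ContMDiffAt 𝓘(ℝ, E) 𝓘(ℝ, E) ∞ (fun x : E => expChart G x * g) 0 :=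
        contMDiffAt_expChart.mul contMDiffAt_const
      have d2 : ContMDiffAt 𝓘(ℝ, E) 𝓘(ℝ, ℂ) ∞ (Ψ g) 0 :=
        ContMDiffAt.comp (x := (0 : E)) (g := fun g : G => φ (g : G ⧸ Γ))
          (ContMDiff.contMDiffAt h) d1
      exact (contMDiffAt_iff_contDiffAt.1 d2).differentiableAt (by simp)
    -- In coordinates the curve `oneParam Y` has velocity `Y` at time zero, so the chain rule turns
    -- the derivative of `Ψ g` in direction `Y` into `lieDeriv`.
    have d3 := HasFDerivAt.comp_hasDerivAt_of_eq (0 : ℝ) hd.hasFDerivAt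
      (logChart_oneParam_hasDerivAt (E := E) (G := G) Y) (by rw [oneParam_zero, logChart_one])
    have d4 : (Ψ g ∘ fun s => logChart E (oneParam (E := E) Y s : G))
        =ᶠ[𝓝 0] fun s => φ ((oneParam (E := E) Y s * g : G) : G ⧸ Γ) := by
      have : ∀ᶠ s in 𝓝 (0 : ℝ),
          (oneParam (E := E) Y s : G) ∈ (extChartAt 𝓘(ℝ, E) (1 : G)).source :=
        (oneParam_continuous (E := E) Y).continuousAt.eventually (by
          rw [oneParam_zero]; exact extChartAt_source_mem_nhds (I := 𝓘(ℝ, E)) (1 : G))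
      filter_upwards [this] with s hs
      simp [hΨ, expChart_logChart hs]
    exact (d3.congr_of_eventuallyEq d4.symm).deriv
  rw [e]
  exact h3

/-! ### The algebra of smooth functions that are constant outside of a compact set -/

theorem mem_smoothAlg_iff {φ : G ⧸ Γ → ℂ} : φ ∈ smoothAlg E Γ ↔
    ∃ (c : ℂ) (f : G ⧸ Γ → ℂ), HasCompactSupport f ∧ IsSmooth E f ∧ φ = fun x => c + f x :=
  Iff.rfl

theorem isSmooth_of_mem {φ : G ⧸ Γ → ℂ} (h : φ ∈ smoothAlg E Γ) : IsSmooth E φ := by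
  obtain ⟨c, f, -, hs, rfl⟩ := mem_smoothAlg_iff.1 h
  exact (isSmooth_const c).add hs

theorem continuous_of_mem {φ : G ⧸ Γ → ℂ} (h : φ ∈ smoothAlg E Γ) : Continuous φ :=
  (isSmooth_of_mem h).continuous

theorem exists_norm_le_of_mem {φ : G ⧸ Γ → ℂ} (h : φ ∈ smoothAlg E Γ) : ∃ C, ∀ x, ‖φ x‖ ≤ C := by
  obtain ⟨c, f, hf, hs, rfl⟩ := mem_smoothAlg_iff.1 h
  obtain ⟨C, hC⟩ := hf.exists_bound_of_continuous hs.continuous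
  exact ⟨‖c‖ + C, fun x => (norm_add_le _ _).trans (by gcongr; exact hC x)⟩

theorem const_mem_smoothAlg (c : ℂ) : (fun _ => c) ∈ smoothAlg E Γ :=
  mem_smoothAlg_iff.2 ⟨c, fun _ => 0, HasCompactSupport.zero, isSmooth_const 0, by simp⟩

theorem add_mem_smoothAlg {φ φ' : G ⧸ Γ → ℂ} (h : φ ∈ smoothAlg E Γ) (h' : φ' ∈ smoothAlg E Γ) :
    (fun x => φ x + φ' x) ∈ smoothAlg E Γ := by
  obtain ⟨c, f, hf, hs, rfl⟩ := mem_smoothAlg_iff.1 h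
  obtain ⟨c', f', hf', hs', rfl⟩ := mem_smoothAlg_iff.1 h'
  exact mem_smoothAlg_iff.2 ⟨c + c', fun x => f x + f' x, hf.add hf', hs.add hs', by
    funext x; ring⟩

theorem mul_mem_smoothAlg {φ φ' : G ⧸ Γ → ℂ} (h : φ ∈ smoothAlg E Γ) (h' : φ' ∈ smoothAlg E Γ) :
    (fun x => φ x * φ' x) ∈ smoothAlg E Γ := by
  obtain ⟨c, f, hf, hs, rfl⟩ := mem_smoothAlg_iff.1 h
  obtain ⟨c', f', hf', hs', rfl⟩ := mem_smoothAlg_iff.1 h'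
  refine mem_smoothAlg_iff.2 ⟨c * c', fun x => (f x * c' + c * f' x) + f x * f' x, ?_, ?_, by
    funext x; ring⟩
  · exact ((hf.mul_right (f' := fun _ => c')).add (hf'.mul_left (f := fun _ => c))).add hf.mul_right
  · exact ((hs.mul (isSmooth_const c')).add ((isSmooth_const c).mul hs')).add (hs.mul hs')

theorem conj_mem_smoothAlg {φ : G ⧸ Γ → ℂ} (h : φ ∈ smoothAlg E Γ) :
    (fun x => conj (φ x)) ∈ smoothAlg E Γ := by
  obtain ⟨c, f, hf, hs, rfl⟩ := mem_smoothAlg_iff.1 h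
  exact mem_smoothAlg_iff.2 ⟨conj c, fun x => conj (f x), hf.comp_left (map_zero _), hs.conj, by
    funext x; simp⟩

theorem comp_smul_mem_smoothAlg {φ : G ⧸ Γ → ℂ} (h : φ ∈ smoothAlg E Γ) (g : G) :
    (fun x => φ (g • x)) ∈ smoothAlg E Γ := by
  obtain ⟨c, f, hf, hs, rfl⟩ := mem_smoothAlg_iff.1 h
  exact mem_smoothAlg_iff.2 ⟨c, fun x => f (g • x), hf.comp_homeomorph (Homeomorph.smul g),
    hs.comp_smul g, rfl⟩

theorem lieDeriv_mem_smoothAlg {φ : G ⧸ Γ → ℂ} (h : φ ∈ smoothAlg E Γ) (Y : Lie𝔤 E G) :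
    lieDeriv Y φ ∈ smoothAlg E Γ := by
  obtain ⟨c, f, hf, hs, rfl⟩ := mem_smoothAlg_iff.1 h
  refine mem_smoothAlg_iff.2 ⟨0, lieDeriv Y f, ?_, hs.lieDeriv Y, ?_⟩
  -- Outside the closed support of `f` the curve `oneParam Y s • x` stays, for small `s`, where `f`
  -- vanishes; so the derivative has its support inside that of `f`.
  · refine hf.mono' fun x hx => ?_
    by_contra hx'
    apply hx
    have h0 : f =ᶠ[𝓝 x] 0 := notMem_tsupport_iff_eventuallyEq.1 hx'
    have hc : Tendsto (fun s : ℝ => (oneParam (E := E) Y s : G) • x) (𝓝 0) (𝓝 x) := by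
      have : Continuous fun s : ℝ => (oneParam (E := E) Y s : G) • x :=
        continuous_smul.comp ((oneParam_continuous (E := E) Y).prodMk continuous_const)
      have e : (oneParam (E := E) Y 0 : G) • x = x := by
        have := oneParam_zero (G := G) (E := E) Y
        exact (congrArg (· • x) this).trans (one_smul _ _)
      have h3 := this.tendsto 0
      rw [e] at h3
      exact h3
    have h1 : (fun s : ℝ => f ((oneParam (E := E) Y s : G) • x)) =ᶠ[𝓝 0] fun _ => 0 :=
      hc.eventually h0
    have h2 := h1.deriv_eq
    rw [deriv_const] at h2
    exact h2
  · rw [(isSmooth_const c).lieDeriv_add hs, lieDeriv_const]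

theorem sub_const_mem_smoothAlg {φ : G ⧸ Γ → ℂ} (h : φ ∈ smoothAlg E Γ) (c : ℂ) :
    (fun x => φ x - c) ∈ smoothAlg E Γ := by
  simpa only [sub_eq_add_neg] using add_mem_smoothAlg h (const_mem_smoothAlg (-c))

theorem sum_mem_smoothAlg {κ : Type*} (s : Finset κ) {φ : κ → G ⧸ Γ → ℂ}
    (h : ∀ i ∈ s, φ i ∈ smoothAlg E Γ) : (fun x => ∑ i ∈ s, φ i x) ∈ smoothAlg E Γ := by
  classical
  induction s using Finset.induction_on with
  | empty => simpa using const_mem_smoothAlg (E := E) (Γ := Γ) 0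
  | insert i s hi ih =>
    simp only [Finset.sum_insert hi]
    exact add_mem_smoothAlg (h i (Finset.mem_insert_self _ _))
      (ih fun j hj => h j (Finset.mem_insert_of_mem hj))

theorem prod_mem_smoothAlg {κ : Type*} (s : Finset κ) {φ : κ → G ⧸ Γ → ℂ}
    (h : ∀ i ∈ s, φ i ∈ smoothAlg E Γ) : (fun x => ∏ i ∈ s, φ i x) ∈ smoothAlg E Γ := by
  classical
  induction s using Finset.induction_on with
  | empty => simpa using const_mem_smoothAlg (E := E) (Γ := Γ) 1
  | insert i s hi ih =>
    simp only [Finset.prod_insert hi]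
    exact mul_mem_smoothAlg (h i (Finset.mem_insert_self _ _))
      (ih fun j hj => h j (Finset.mem_insert_of_mem hj))

theorem const_mul_mem_smoothAlg {φ : G ⧸ Γ → ℂ} (h : φ ∈ smoothAlg E Γ) (c : ℂ) :
    (fun x => c * φ x) ∈ smoothAlg E Γ :=
  mul_mem_smoothAlg (const_mem_smoothAlg c) h

end SmoothFunctions

/-! ### Iterated derivatives of translates and products -/

section Words

variable {E : Type*} [NormedAddCommGroup E] [NormedSpace ℝ E] [CompleteSpace E]
  {G : Type*} [TopologicalSpace G] [ChartedSpace E G] [Group G] [LieGroup 𝓘(ℝ, E) ∞ G] [T2Space G]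
  [IsTopologicalGroup G] {Γ : Subgroup G} {κ : Type*} [Fintype κ]
  {e : Module.Basis κ ℝ (Lie𝔤 E G)}

theorem wordDeriv_append (l l' : List κ) (φ : G ⧸ Γ → ℂ) :
    wordDeriv e (l ++ l') φ = wordDeriv e l (wordDeriv e l' φ) := by
  induction l with
  | nil => rfl
  | cons i l ih => exact congrArg (lieDeriv (e i)) ih

theorem wordDeriv_mem_smoothAlg {φ : G ⧸ Γ → ℂ} (h : φ ∈ smoothAlg E Γ) (l : List κ) :
    wordDeriv e l φ ∈ smoothAlg E Γ := by
  induction l with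
  | nil => exact h
  | cons i l ih => exact lieDeriv_mem_smoothAlg ih (e i)

theorem wordDeriv_add {φ φ' : G ⧸ Γ → ℂ} (h : φ ∈ smoothAlg E Γ) (h' : φ' ∈ smoothAlg E Γ)
    (l : List κ) :
    wordDeriv e l (fun x => φ x + φ' x) = fun x => wordDeriv e l φ x + wordDeriv e l φ' x := by
  induction l with
  | nil => rfl
  | cons i l ih =>
    exact (congrArg (lieDeriv (e i)) ih).trans
      ((isSmooth_of_mem (wordDeriv_mem_smoothAlg h l)).lieDeriv_add
        (isSmooth_of_mem (wordDeriv_mem_smoothAlg h' l)) (e i))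

theorem IsSmooth.lieDeriv_const_mul {φ : G ⧸ Γ → ℂ} (h : IsSmooth E φ) (c : ℂ) (Y : Lie𝔤 E G) :
    MultiEquidist.lieDeriv Y (fun x => c * φ x) = fun x => c * MultiEquidist.lieDeriv Y φ x := by
  rw [(isSmooth_const c).lieDeriv_mul h, lieDeriv_const]
  simp

theorem wordDeriv_const_mul {φ : G ⧸ Γ → ℂ} (h : φ ∈ smoothAlg E Γ) (c : ℂ) (l : List κ) :
    wordDeriv e l (fun x => c * φ x) = fun x => c * wordDeriv e l φ x := by
  induction l with
  | nil => rfl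
  | cons i l ih =>
    exact (congrArg (lieDeriv (e i)) ih).trans
      ((isSmooth_of_mem (wordDeriv_mem_smoothAlg h l)).lieDeriv_const_mul c (e i))

theorem wordDeriv_conj {φ : G ⧸ Γ → ℂ} (h : φ ∈ smoothAlg E Γ) (l : List κ) :
    wordDeriv e l (fun x => conj (φ x)) = fun x => conj (wordDeriv e l φ x) := by
  induction l with
  | nil => rfl
  | cons i l ih =>
    exact (congrArg (lieDeriv (e i)) ih).trans
      ((isSmooth_of_mem (wordDeriv_mem_smoothAlg h l)).lieDeriv_conj (e i))

theorem wordDeriv_const (c : ℂ) {l : List κ} (hl : l ≠ []) :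
    wordDeriv e l (fun _ : G ⧸ Γ => c) = fun _ => 0 := by
  induction l with
  | nil => exact absurd rfl hl
  | cons i l ih =>
    by_cases h : l = []
    · subst h; exact lieDeriv_const (e i) c
    · exact (congrArg (lieDeriv (e i)) (ih h)).trans (lieDeriv_const (e i) 0)

theorem wordDeriv_sum {σ : Type*} (s : Finset σ) (c : σ → ℂ) {φ : σ → G ⧸ Γ → ℂ}
    (h : ∀ i, φ i ∈ smoothAlg E Γ) (l : List κ) :
    wordDeriv e l (fun x => ∑ i ∈ s, c i * φ i x)
      = fun x => ∑ i ∈ s, c i * wordDeriv e l (φ i) x := by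
  classical
  induction s using Finset.induction_on with
  | empty =>
    have := wordDeriv_const_mul (e := e) (const_mem_smoothAlg (E := E) (Γ := Γ) 0) 0 l
    simpa using this
  | insert i s hi ih =>
    simp only [Finset.sum_insert hi]
    rw [wordDeriv_add (const_mul_mem_smoothAlg (h i) _)
      (sum_mem_smoothAlg s fun j _ => const_mul_mem_smoothAlg (h j) _),
      wordDeriv_const_mul (h i), ih]

variable (E Γ) in
/-- A translation invariant seminorm on the smooth functions. -/
structure IsInvariantSeminorm (p : (G ⧸ Γ → ℂ) → ℝ) : Prop where
  nonneg : ∀ φ, 0 ≤ p φ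
  add_le : ∀ φ ∈ smoothAlg E Γ, ∀ φ' ∈ smoothAlg E Γ, p (fun x => φ x + φ' x) ≤ p φ + p φ'
  const_mul_le : ∀ φ ∈ smoothAlg E Γ, ∀ c : ℂ, p (fun x => c * φ x) ≤ ‖c‖ * p φ
  comp_smul_le : ∀ φ ∈ smoothAlg E Γ, ∀ g : G, p (fun x => φ (g • x)) ≤ p φ

theorem IsInvariantSeminorm.sum_le {p : (G ⧸ Γ → ℂ) → ℝ} (hp : IsInvariantSeminorm E Γ p)
    {σ : Type*} (s : Finset σ) (c : σ → ℂ) {φ : σ → G ⧸ Γ → ℂ} (h : ∀ i, φ i ∈ smoothAlg E Γ) :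
    p (fun x => ∑ i ∈ s, c i * φ i x) ≤ ∑ i ∈ s, ‖c i‖ * p (φ i) := by
  classical
  induction s using Finset.induction_on with
  | empty =>
    have := hp.const_mul_le _ (const_mem_smoothAlg 0) 0
    simpa using this
  | insert i s hi ih =>
    simp only [Finset.sum_insert hi]
    exact (hp.add_le _ (const_mul_mem_smoothAlg (h i) _) _
      (sum_mem_smoothAlg s fun j _ => const_mul_mem_smoothAlg (h j) _)).trans
      (add_le_add (hp.const_mul_le _ (h i) _) ih)

/-- Each derivative of `φ (g • x)` is a derivative of `φ` along `Ad g (e j)`, which has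
`Fintype.card κ` coefficients of size at most `a`. The word is consumed from its end because the
last letter is differentiated first. -/
theorem IsInvariantSeminorm.wordDeriv_comp_smul_le {p : (G ⧸ Γ → ℂ) → ℝ}
    (hp : IsInvariantSeminorm E Γ p) {g : G} {a : ℝ}
    (ha : ∀ i j, |e.repr (Ad g (e j)) i| ≤ a) (l : List κ) :
    ∀ φ ∈ smoothAlg E Γ, ∀ W, (∀ l' : List κ, l'.length = l.length → p (wordDeriv e l' φ) ≤ W) →
      p (wordDeriv e l fun x => φ (g • x)) ≤ (Fintype.card κ * a) ^ l.length * W := by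
  induction l using List.reverseRecOn with
  | nil =>
    intro φ hφ W hW
    simp only [List.length_nil, pow_zero, one_mul]
    exact (hp.comp_smul_le φ hφ g).trans (hW [] rfl)
  | append_singleton l j ih =>
    intro φ hφ W hW
    have ha0 : 0 ≤ a := (abs_nonneg _).trans (ha j j)
    have hW0 : 0 ≤ W := (hp.nonneg _).trans (hW _ rfl)
    set c : κ → ℝ := fun i => e.repr (Ad g (e j)) i with hc
    have e1 : lieDeriv (e j) (fun x => φ (g • x))
        = fun x => ∑ i, (c i : ℂ) * lieDeriv (e i) φ (g • x) := by
      rw [lieDeriv_comp_smul, ← e.sum_repr (Ad g (e j)), (isSmooth_of_mem hφ).lieDeriv_sum_left]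
    have e2 : wordDeriv e (l ++ [j]) (fun x => φ (g • x))
        = fun x => ∑ i, (c i : ℂ) * wordDeriv e l (fun x => lieDeriv (e i) φ (g • x)) x := by
      rw [wordDeriv_append]
      exact (congrArg (wordDeriv e l) e1).trans (wordDeriv_sum _ _
        (fun i => comp_smul_mem_smoothAlg (lieDeriv_mem_smoothAlg hφ (e i)) g) l)
    rw [e2]
    refine (hp.sum_le _ _ fun i => wordDeriv_mem_smoothAlg
      (comp_smul_mem_smoothAlg (lieDeriv_mem_smoothAlg hφ (e i)) g) l).trans ?_
    have h1 : ∀ i, p (wordDeriv e l (fun x => lieDeriv (e i) φ (g • x)))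
        ≤ (Fintype.card κ * a) ^ l.length * W := fun i =>
      ih _ (lieDeriv_mem_smoothAlg hφ (e i)) W fun l' hl' => by
        have := hW (l' ++ [i]) (by simp [hl'])
        rwa [wordDeriv_append] at this
    calc ∑ i, ‖(c i : ℂ)‖ * p (wordDeriv e l (fun x => lieDeriv (e i) φ (g • x)))
        ≤ ∑ _i : κ, a * ((Fintype.card κ * a) ^ l.length * W) := by
          refine Finset.sum_le_sum fun i _ => mul_le_mul ?_ (h1 i) (hp.nonneg _) ha0
          simpa using ha i j
      _ = (Fintype.card κ * a) ^ (l ++ [j]).length * W := by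
          simp only [Finset.sum_const, Finset.card_univ, nsmul_eq_mul, List.length_append,
            List.length_singleton, pow_succ]
          ring

/-- Leibniz rule with `2 ^ l.length` terms. Two seminorms are needed: for the supremum norm `p' =
p`, but for `L^q` norms the product rule `hmul` is Hölder's inequality and `p'` is the norm with
twice the exponent. -/
theorem IsInvariantSeminorm.wordDeriv_mul_le {p p' : (G ⧸ Γ → ℂ) → ℝ}
    (hp : IsInvariantSeminorm E Γ p) (hp' : IsInvariantSeminorm E Γ p')
    (hmul : ∀ f ∈ smoothAlg E Γ, ∀ h ∈ smoothAlg E Γ, p (fun x => f x * h x) ≤ p' f * p' h)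
    (l : List κ) :
    ∀ f ∈ smoothAlg E Γ, ∀ h ∈ smoothAlg E Γ, ∀ A B,
      (∀ l' : List κ, l'.length ≤ l.length → p' (wordDeriv e l' f) ≤ A) →
      (∀ l' : List κ, l'.length ≤ l.length → p' (wordDeriv e l' h) ≤ B) →
      p (wordDeriv e l fun x => f x * h x) ≤ 2 ^ l.length * (A * B) := by
  induction l using List.reverseRecOn with
  | nil =>
    intro f hf h hh A B hA hB
    simp only [List.length_nil, pow_zero, one_mul]
    exact (hmul f hf h hh).trans (mul_le_mul (hA [] le_rfl) (hB [] le_rfl) (hp'.nonneg _)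
      ((hp'.nonneg _).trans (hA [] le_rfl)))
  | append_singleton l j ih =>
    intro f hf h hh A B hA hB
    have hA' : ∀ l' : List κ, l'.length ≤ l.length → p' (wordDeriv e l' f) ≤ A :=
      fun l' hl' => hA l' (by simp; omega)
    have hB' : ∀ l' : List κ, l'.length ≤ l.length → p' (wordDeriv e l' h) ≤ B :=
      fun l' hl' => hB l' (by simp; omega)
    have mf := lieDeriv_mem_smoothAlg hf (e j)
    have mh := lieDeriv_mem_smoothAlg hh (e j)
    have e2 : wordDeriv e (l ++ [j]) (fun x => f x * h x)
        = fun x => wordDeriv e l (fun x => lieDeriv (e j) f x * h x) x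
          + wordDeriv e l (fun x => f x * lieDeriv (e j) h x) x := by
      rw [wordDeriv_append]
      exact (congrArg (wordDeriv e l)
        ((isSmooth_of_mem hf).lieDeriv_mul (isSmooth_of_mem hh) (e j))).trans
        (wordDeriv_add (mul_mem_smoothAlg mf hh) (mul_mem_smoothAlg hf mh) l)
    rw [e2]
    refine (hp.add_le _ (wordDeriv_mem_smoothAlg (mul_mem_smoothAlg mf hh) l) _
      (wordDeriv_mem_smoothAlg (mul_mem_smoothAlg hf mh) l)).trans ?_
    have h1 := ih _ mf h hh A B (fun l' hl' => by
      have := hA (l' ++ [j]) (by simp [hl'])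
      rwa [wordDeriv_append] at this) hB'
    have h2 := ih f hf _ mh A B hA' (fun l' hl' => by
      have := hB (l' ++ [j]) (by simp [hl'])
      rwa [wordDeriv_append] at this)
    calc _ ≤ 2 ^ l.length * (A * B) + 2 ^ l.length * (A * B) := add_le_add h1 h2
      _ = 2 ^ (l ++ [j]).length * (A * B) := by
          simp only [List.length_append, List.length_singleton, pow_succ]
          ring

/-- Seminorms of the derivatives of the correlation `φ (g x) * conj (φ (g' x))`. -/
theorem IsInvariantSeminorm.wordDeriv_corr_le {p p' : (G ⧸ Γ → ℂ) → ℝ}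
    (hp : IsInvariantSeminorm E Γ p) (hp' : IsInvariantSeminorm E Γ p')
    (hmul : ∀ f ∈ smoothAlg E Γ, ∀ h ∈ smoothAlg E Γ, p (fun x => f x * h x) ≤ p' f * p' h)
    (hconj : ∀ f ∈ smoothAlg E Γ, p' (fun x => conj (f x)) ≤ p' f) {g g' : G} {a : ℝ} (ha1 : 1 ≤ a)
    (ha : ∀ i j, |e.repr (Ad g (e j)) i| ≤ a) (ha' : ∀ i j, |e.repr (Ad g' (e j)) i| ≤ a)
    {φ : G ⧸ Γ → ℂ} (hφ : φ ∈ smoothAlg E Γ) {k : ℕ} {W : ℝ}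
    (hW : ∀ l : List κ, l.length ≤ k → p' (wordDeriv e l φ) ≤ W) {l : List κ} (hl : l.length ≤ k) :
    p (wordDeriv e l fun x => φ (g • x) * conj (φ (g' • x)))
      ≤ 2 ^ k * ((1 + Fintype.card κ) * a) ^ (2 * k) * W ^ 2 := by
  have hW0 : 0 ≤ W := (hp'.nonneg _).trans (hW [] (by simp))
  -- The summand `1` makes the base at least `1` even for empty `κ`, so that shorter words obey the
  -- bound for length `k`.
  have hK : (1 : ℝ) ≤ (1 + Fintype.card κ) * a :=
    one_le_mul_of_one_le_of_one_le (by simp) ha1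
  have key : ∀ g : G, (∀ i j, |e.repr (Ad g (e j)) i| ≤ a) → ∀ l' : List κ, l'.length ≤ l.length →
      p' (wordDeriv e l' fun x => φ (g • x)) ≤ ((1 + Fintype.card κ) * a) ^ k * W := by
    intro g ha l' hl'
    refine (hp'.wordDeriv_comp_smul_le ha l' φ hφ W fun l₁ h₁ => hW l₁ (by omega)).trans ?_
    refine mul_le_mul_of_nonneg_right ?_ hW0
    calc (Fintype.card κ * a) ^ l'.length ≤ ((1 + Fintype.card κ) * a) ^ l'.length := by
          gcongr; linarith
      _ ≤ _ := pow_le_pow_right₀ hK (by omega)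
  have := hp.wordDeriv_mul_le hp' hmul l _ (comp_smul_mem_smoothAlg hφ g) _
    (conj_mem_smoothAlg (comp_smul_mem_smoothAlg hφ g')) _ _ (key g ha) fun l' hl' => by
      rw [wordDeriv_conj (comp_smul_mem_smoothAlg hφ g')]
      exact (hconj _ (wordDeriv_mem_smoothAlg (comp_smul_mem_smoothAlg hφ g') l')).trans
        (key g' ha' l' hl')
  refine this.trans ?_
  calc _ ≤ (2 : ℝ) ^ k * (((1 + Fintype.card κ) * a) ^ k * W * (((1 + Fintype.card κ) * a) ^ k * W)) := by
        gcongr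
        norm_num
    _ = _ := by ring

/-! ### The supremum norm and the `L^q` norms -/

theorem supNorm_nonneg {X : Type*} (φ : X → ℂ) : 0 ≤ supNorm φ :=
  Real.iSup_nonneg fun _ => norm_nonneg _

theorem supNorm_le {X : Type*} {φ : X → ℂ} {W : ℝ} (hW : 0 ≤ W) (h : ∀ x, ‖φ x‖ ≤ W) :
    supNorm φ ≤ W :=
  Real.iSup_le h hW

theorem norm_le_supNorm {φ : G ⧸ Γ → ℂ} (h : φ ∈ smoothAlg E Γ) (x : G ⧸ Γ) :
    ‖φ x‖ ≤ supNorm φ := by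
  obtain ⟨C, hC⟩ := exists_norm_le_of_mem h
  exact le_ciSup (f := fun x => ‖φ x‖) ⟨C, by rintro _ ⟨x, rfl⟩; exact hC x⟩ x

theorem isInvariantSeminorm_supNorm : IsInvariantSeminorm E Γ (supNorm : (G ⧸ Γ → ℂ) → ℝ) where
  nonneg := supNorm_nonneg
  add_le φ h φ' h' := supNorm_le (add_nonneg (supNorm_nonneg _) (supNorm_nonneg _)) fun x =>
    (norm_add_le _ _).trans (add_le_add (norm_le_supNorm h x) (norm_le_supNorm h' x))
  const_mul_le φ h c := supNorm_le (mul_nonneg (norm_nonneg _) (supNorm_nonneg _)) fun x => by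
    rw [norm_mul]; gcongr; exact norm_le_supNorm h x
  comp_smul_le φ h g := supNorm_le (supNorm_nonneg _) fun x => norm_le_supNorm h _

theorem supNorm_mul_le {f h : G ⧸ Γ → ℂ} (hf : f ∈ smoothAlg E Γ) (hh : h ∈ smoothAlg E Γ) :
    supNorm (fun x => f x * h x) ≤ supNorm f * supNorm h :=
  supNorm_le (mul_nonneg (supNorm_nonneg _) (supNorm_nonneg _)) fun x => by
    rw [norm_mul]
    exact mul_le_mul (norm_le_supNorm hf x) (norm_le_supNorm hh x) (norm_nonneg _)
      (supNorm_nonneg _)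

theorem supNorm_conj {X : Type*} (f : X → ℂ) : supNorm (fun x => conj (f x)) = supNorm f := by
  simp [supNorm]

instance opensMeasurableSpace_quotient [MeasurableSpace G] [OpensMeasurableSpace G] :
    OpensMeasurableSpace (G ⧸ Γ) :=
  ⟨MeasurableSpace.generateFrom_le fun _ hs => (QuotientGroup.continuous_mk.isOpen_preimage _ hs).measurableSet⟩

variable [MeasurableSpace G] [BorelSpace G]

theorem measurable_of_mem {φ : G ⧸ Γ → ℂ} (h : φ ∈ smoothAlg E Γ) : Measurable φ :=
  (continuous_of_mem h).measurable

theorem memLp_of_mem {μ : Measure (G ⧸ Γ)} [IsFiniteMeasure μ] {φ : G ⧸ Γ → ℂ}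
    (h : φ ∈ smoothAlg E Γ) (q : ℝ≥0∞) : MemLp φ q μ := by
  obtain ⟨C, hC⟩ := exists_norm_le_of_mem h
  exact MemLp.of_bound (measurable_of_mem h).aestronglyMeasurable C (.of_forall hC)

instance measurableConstSMul_quotient : MeasurableConstSMul G (G ⧸ Γ) where
  measurable_const_smul g := by
    refine measurable_from_quotient.2 ?_
    have h1 : Measurable fun x : G => g * x := (continuous_const_mul g).measurable
    exact measurable_quotient_mk''.comp h1

theorem isInvariantSeminorm_eLpNorm (μ : Measure (G ⧸ Γ)) [IsFiniteMeasure μ]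
    [SMulInvariantMeasure G (G ⧸ Γ) μ] {q : ℝ≥0∞} (hq : 1 ≤ q) :
    IsInvariantSeminorm E Γ fun φ => (eLpNorm φ q μ).toReal where
  nonneg _ := ENNReal.toReal_nonneg
  add_le φ h φ' h' := by
    rw [← ENNReal.toReal_add (memLp_of_mem h q).eLpNorm_ne_top (memLp_of_mem h' q).eLpNorm_ne_top]
    refine ENNReal.toReal_mono (ENNReal.add_ne_top.2 ⟨(memLp_of_mem h q).eLpNorm_ne_top,
      (memLp_of_mem h' q).eLpNorm_ne_top⟩) ?_
    exact eLpNorm_add_le (memLp_of_mem h q).1 (memLp_of_mem h' q).1 hq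
  const_mul_le φ h c := by
    have : eLpNorm (fun x => c * φ x) q μ = ‖c‖ₑ * eLpNorm φ q μ := eLpNorm_const_smul c φ q μ
    rw [this]
    simp
  comp_smul_le φ h g := by
    have := eLpNorm_comp_measurePreserving (p := q) (memLp_of_mem h q).1
      (measurePreserving_smul g μ)
    exact (congrArg ENNReal.toReal this).le

/-- Hölder's inequality with `1 / 2 ^ d = 2 / 2 ^ (d + 1)`. The exponents `2 ^ d` in the Sobolev
norms are made for this step from `d` to `d + 1`. -/
theorem eLpNorm_mul_le_sq {μ : Measure (G ⧸ Γ)} [IsFiniteMeasure μ] {f h : G ⧸ Γ → ℂ}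
    (hf : f ∈ smoothAlg E Γ) (hh : h ∈ smoothAlg E Γ) (d : ℕ) :
    (eLpNorm (fun x => f x * h x) (2 ^ d) μ).toReal
      ≤ (eLpNorm f (2 ^ (d + 1)) μ).toReal * (eLpNorm h (2 ^ (d + 1)) μ).toReal := by
  rw [← ENNReal.toReal_mul]
  refine ENNReal.toReal_mono (ENNReal.mul_ne_top (memLp_of_mem hf _).eLpNorm_ne_top
    (memLp_of_mem hh _).eLpNorm_ne_top) ?_
  have : ENNReal.HolderTriple (2 ^ (d + 1)) (2 ^ (d + 1)) (2 ^ d) := ⟨by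
    rw [pow_succ, ENNReal.mul_inv (by simp) (by simp), ← mul_add, ENNReal.inv_two_add_inv_two,
      mul_one]⟩
  have h1 := eLpNorm_smul_le_mul_eLpNorm (p := 2 ^ (d + 1)) (q := 2 ^ (d + 1)) (r := 2 ^ d)
    (memLp_of_mem (μ := μ) hh (2 ^ (d + 1))).1 (memLp_of_mem (μ := μ) hf (2 ^ (d + 1))).1
  exact h1

theorem eLpNorm_conj {X : Type*} [MeasurableSpace X] {μ : Measure X} (f : X → ℂ) (q : ℝ≥0∞) :
    eLpNorm (fun x => conj (f x)) q μ = eLpNorm f q μ :=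
  eLpNorm_congr_norm_ae (.of_forall fun x => by simp)

end Words

/-! ### The right-invariant Riemannian distance along one-parameter subgroups -/

section RiemannianDistance

open Filter Topology

variable {E : Type*} [NormedAddCommGroup E] [NormedSpace ℝ E] [CompleteSpace E]
  {G : Type*} [TopologicalSpace G] [ChartedSpace E G] [Group G] [LieGroup 𝓘(ℝ, E) ∞ G] [T2Space G]
  [IsTopologicalGroup G] {Γ : Subgroup G} {κ : Type*} [Fintype κ]
  {e : Module.Basis κ ℝ (Lie𝔤 E G)}

/-- With `m` the multiplication in coordinates, `c (t + s) = m (c t) (c s)` gives `c' t` as the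
derivative of `m (c t)` at `0` applied to `Y`, which is continuous in `t`. This regularity is what
makes the curve admissible for the Riemannian distance. -/
theorem contDiffAt_logChart_oneParam (Y : E) :
    ContDiffAt ℝ 1 (fun s => logChart E (oneParam Y s : G)) 0 := by
  set c : ℝ → E := fun s => logChart E (oneParam Y s : G) with hc
  set m : E → E → E := fun x y => logChart E (expChart G x * expChart G y) with hm
  have hc0 : c 0 = 0 := by simp [hc, logChart_one]
  have hd0 : HasDerivAt c Y 0 := logChart_oneParam_hasDerivAt Y
  have hm1 : ContDiffAt ℝ 1 (Function.uncurry m) (0, 0) := contDiffAt_mul_chart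
  have hW : ContDiffAt ℝ 0 (fun x => fderiv ℝ (m x) 0 Y) 0 :=
    (ContDiffAt.fderiv (m := 0) (n := 1) (f := m) (g := fun _ => 0) hm1 contDiffAt_const
      (by simp)).clm_apply contDiffAt_const
  have hsrc : ∀ᶠ s in 𝓝 (0 : ℝ), (oneParam Y s : G) ∈ (extChartAt 𝓘(ℝ, E) (1 : G)).source :=
    (oneParam_continuous Y).continuousAt.eventually (by
      rw [oneParam_zero]; exact extChartAt_source_mem_nhds (I := 𝓘(ℝ, E)) (1 : G))
  have hdiff : ∀ᶠ t in 𝓝 (0 : ℝ), DifferentiableAt ℝ (m (c t)) 0 := by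
    have h1 : ∀ᶠ p in 𝓝 ((0 : E), (0 : E)), ContDiffAt ℝ 1 (Function.uncurry m) p :=
      hm1.eventually (by simp)
    have h2 : Tendsto (fun t => (c t, (0 : E))) (𝓝 0) (𝓝 ((0 : E), (0 : E))) := by
      have := hd0.continuousAt.tendsto
      rw [hc0] at this
      exact this.prodMk_nhds tendsto_const_nhds
    filter_upwards [h2.eventually h1] with t ht
    exact DifferentiableAt.comp (0 : E) (ht.differentiableAt (by simp))
      ((differentiableAt_const (c t)).prodMk differentiableAt_id)
  have hder : ∀ᶠ t in 𝓝 (0 : ℝ), HasDerivAt c (fderiv ℝ (m (c t)) 0 Y) t := by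
    filter_upwards [hsrc, hdiff] with t ht htd
    have h1 := HasFDerivAt.comp_hasDerivAt_of_eq (0 : ℝ) htd.hasFDerivAt hd0 hc0.symm
    have h2 : HasDerivAt (fun s => c (t + s)) (fderiv ℝ (m (c t)) 0 Y) 0 := by
      refine h1.congr_of_eventuallyEq ?_
      filter_upwards [hsrc] with s hs
      simp [hc, hm, oneParam_add, expChart_logChart ht, expChart_logChart hs]
    have h3 := HasDerivAt.comp_sub_const (x := t) (a := t) (by rwa [sub_self])
    simpa using h3
  have hcc : ContDiffAt ℝ 0 c 0 :=
    contDiffAt_zero.2 ⟨_, hder, fun t ht => (HasDerivAt.continuousAt ht).continuousWithinAt⟩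
  have hWc : ContDiffAt ℝ 0 (fun t => fderiv ℝ (m (c t)) 0 Y) 0 :=
    ContDiffAt.comp (0 : ℝ) (g := fun x => fderiv ℝ (m x) 0 Y) (by rw [hc0]; exact hW) hcc
  rw [show (1 : WithTop ℕ∞) = ((0 : ℕ) : WithTop ℕ∞) + 1 by simp]
  refine contDiffAt_succ_iff_hasFDerivAt.2
    ⟨fun t => (1 : ℝ →L[ℝ] ℝ).smulRight (fderiv ℝ (m (c t)) 0 Y), ⟨_, hder, fun t ht =>
      hasDerivAt_iff_hasFDerivAt.1 ht⟩, ?_⟩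
  exact contDiffAt_const.smulRight (by simpa using hWc)

theorem contMDiff_oneParam (Y : E) : ContMDiff 𝓘(ℝ, ℝ) 𝓘(ℝ, E) 1 (oneParam Y : ℝ → G) := by
  have h0 : ContMDiffAt 𝓘(ℝ, ℝ) 𝓘(ℝ, E) 1 (oneParam Y : ℝ → G) 0 := by
    have h1 : ContMDiffAt 𝓘(ℝ, ℝ) 𝓘(ℝ, E) 1
        (fun s => expChart G (logChart E (oneParam Y s : G))) 0 := by
      refine ContMDiffAt.comp (x := (0 : ℝ)) (g := (expChart G : E → G)) ?_
        (contMDiffAt_iff_contDiffAt.2 (contDiffAt_logChart_oneParam Y))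
      rw [oneParam_zero, logChart_one]
      exact contMDiffAt_expChart.of_le (by exact_mod_cast le_top)
    refine h1.congr_of_eventuallyEq ?_
    have : ∀ᶠ s in 𝓝 (0 : ℝ), (oneParam Y s : G) ∈ (extChartAt 𝓘(ℝ, E) (1 : G)).source :=
      (oneParam_continuous Y).continuousAt.eventually (by
        rw [oneParam_zero]; exact extChartAt_source_mem_nhds (I := 𝓘(ℝ, E)) (1 : G))
    filter_upwards [this] with s hs
    rw [expChart_logChart hs]
  intro t
  have h1 : ContMDiffAt 𝓘(ℝ, ℝ) 𝓘(ℝ, E) 1 (fun s => (oneParam Y (s - t) : G)) t := by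
    refine ContMDiffAt.comp (x := t) (g := (oneParam Y : ℝ → G)) (by rwa [sub_self]) ?_
    exact contMDiffAt_iff_contDiffAt.2 (contDiffAt_id.sub contDiffAt_const)
  have h2 : ContMDiffAt 𝓘(ℝ, ℝ) 𝓘(ℝ, E) 1 (fun s => (oneParam Y (s - t) : G) * oneParam Y t) t :=
    ContMDiffAt.comp (x := t) (g := fun g : G => g * oneParam Y t)
      ((contMDiff_mul_right (I := 𝓘(ℝ, E)) (n := ∞)).contMDiffAt.of_le
        (by exact_mod_cast le_top)) h1
  refine h2.congr_of_eventuallyEq (.of_forall fun s => ?_)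
  change oneParam Y s = oneParam Y (s - t) * oneParam Y t
  rw [← oneParam_add, sub_add_cancel]

theorem rightField_differential (v : E) (g : G) :
    rightField (differential (fun x : G => x * g⁻¹) g v : E) g = v := by
  have h1 := (hasDifferentialAt_mul_right (E := E) g (1 : G)).comp
    (hasDifferentialAt_mul_right (E := E) g⁻¹ g) (mul_inv_cancel g)
  simp only [inv_mul_cancel_right] at h1
  have h2 := h1.differential.symm.trans (hasDifferentialAt_id (E := E) g).differential
  exact DFunLike.congr_fun h2 v

theorem differential_rightField (v : E) (g : G) :
    differential (fun x : G => x * g⁻¹) g (rightField v g) = v := by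
  rw [← rightField_mul, mul_inv_cancel, rightField_one]

theorem rightInvLength_eq (g : G) (v : E) :
    rightInvLength e g v = ENNReal.ofReal (Real.sqrt (∑ i,
      (e.repr (differential (fun x : G => x * g⁻¹) g v : E) i) ^ 2)) := rfl

theorem rightInvLength_rightField_eq (g : G) (v : E) :
    rightInvLength e g (rightField v g : E)
      = ENNReal.ofReal (Real.sqrt (∑ i, (e.repr v i) ^ 2)) := by
  rw [rightInvLength_eq, differential_rightField]

theorem rightInvLength_rightField (g : G) (j : κ) :
    rightInvLength e g (rightField (E := E) (e j) g : E) = 1 := by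
  classical
  have : ∑ i, (e.repr (e j) i) ^ 2 = 1 := by
    simp [Module.Basis.repr_self, Finsupp.single_apply]
  exact (rightInvLength_rightField_eq (E := E) g (e j)).trans
    ((congrArg (fun x => ENNReal.ofReal (Real.sqrt x)) this).trans (by simp))

theorem rightInvLength_smul (g : G) (a : ℝ) (v : E) :
    rightInvLength e g (a • v : E) = ‖a‖ₑ * rightInvLength e g v := by
  rw [rightInvLength_eq, rightInvLength_eq, map_smul, Real.enorm_eq_ofReal_abs,
    ← ENNReal.ofReal_mul (abs_nonneg a), ← Real.sqrt_sq_eq_abs, ← Real.sqrt_mul (sq_nonneg a),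
    Finset.mul_sum]
  congr 3
  funext i
  have : e.repr (a • (differential (fun x : G => x * g⁻¹) g v : E)) i
    = a * e.repr (differential (fun x : G => x * g⁻¹) g v : E) i := by
    exact (DFunLike.congr_fun (map_smul e.repr a _) i)
  rw [← mul_pow]
  exact congrArg (· ^ 2) this

/-- The velocity of `t ↦ oneParam (e j) t * g` is the right-invariant field of the orthonormal
vector `e j`, so the curve has unit speed and length `s`. -/
theorem rightInvEDist_oneParam_mul_le (j : κ) {s : ℝ} (hs : 0 ≤ s) (g : G) :
    rightInvEDist e g (oneParam (E := E) (e j) s * g) ≤ ENNReal.ofReal s := by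
  let : ∀ x : G, ENorm (TangentSpace 𝓘(ℝ, E) x) := fun x => ⟨rightInvLength e x⟩
  have : ∀ x : G, ENormSMulClass ℝ (TangentSpace 𝓘(ℝ, E) x) := fun x =>
    ⟨fun a v => rightInvLength_smul (E := E) x a v⟩
  set Y : E := e j with hY
  have hγ : ContMDiff 𝓘(ℝ, ℝ) 𝓘(ℝ, E) 1 (fun t => (oneParam Y t : G) * g) :=
    ContMDiff.comp (g := fun x : G => x * g)
      ((contMDiff_mul_right (I := 𝓘(ℝ, E)) (n := ∞)).of_le (by exact_mod_cast le_top))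
      (contMDiff_oneParam Y)
  have h1 := Manifold.riemannianEDist_le_pathELength (I := 𝓘(ℝ, E)) (a := 0) (b := s) (x := g)
    (y := oneParam Y s * g) hγ.contMDiffOn (by simp) rfl hs
  refine h1.trans ?_
  rw [Manifold.pathELength_eq_lintegral_mfderiv_Icc]
  have h2 : ∀ t : ℝ, HasVelocityAt (fun t => (oneParam Y t : G) * g)
      (rightField Y ((oneParam Y t : G) * g)) t := fun t => by
    rw [rightField_mul]
    exact (hasDifferentialAt_mul_right (E := E) g _).comp_velocity
      (oneParam_hasVelocityAt_rightField Y t) rfl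
  have h3 : ∀ t : ℝ, rightInvLength e ((oneParam Y t : G) * g)
      (differential (fun t => (oneParam Y t : G) * g) t (1 : ℝ) : E) = 1 := fun t => by
    rw [(h2 t).differential_apply_one]
    exact rightInvLength_rightField _ j
  have h4 : ∫⁻ t in Icc 0 s, rightInvLength e ((oneParam Y t : G) * g)
      (differential (fun t => (oneParam Y t : G) * g) t (1 : ℝ) : E) ≤ ENNReal.ofReal s := by
    simp [h3]
  exact h4

theorem quotEDist_oneParam_smul_le (j : κ) {s : ℝ} (hs : 0 ≤ s) (x : G ⧸ Γ) :
    quotEDist e x ((oneParam (E := E) (e j) s : G) • x) ≤ ENNReal.ofReal s := by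
  induction x using QuotientGroup.induction_on with
  | H g =>
    exact (iInf_le_of_le g (iInf_le_of_le (oneParam (E := E) (e j) s * g)
      (iInf_le_of_le rfl (iInf_le_of_le rfl le_rfl)))).trans (rightInvEDist_oneParam_mul_le j hs g)

/-- A Lipschitz constant bounds the derivatives along the basis. -/
theorem norm_lieDeriv_le_of_lipschitz {φ : G ⧸ Γ → ℂ} (h : φ ∈ smoothAlg E Γ) {L : ℝ} (hL : 0 ≤ L)
    (hlip : ∀ x y, ‖φ x - φ y‖ₑ ≤ ENNReal.ofReal L * quotEDist e x y) (j : κ) (x : G ⧸ Γ) :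
    ‖lieDeriv (e j) φ x‖ ≤ L := by
  have hd := (isSmooth_of_mem h).hasDerivAt_zero (E := E) (e j) x
  have key : ∀ s : ℝ, 0 ≤ s → ∀ y : G ⧸ Γ,
      ‖φ y - φ ((oneParam (E := E) (e j) s : G) • y)‖ ≤ L * s := fun s hs y => by
    have h1 := (hlip y ((oneParam (E := E) (e j) s : G) • y)).trans
      (mul_le_mul_right (quotEDist_oneParam_smul_le j hs y) _)
    rw [← ENNReal.ofReal_mul hL, ← ofReal_norm] at h1
    exact (ENNReal.ofReal_le_ofReal_iff (by positivity)).1 h1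
  have e0 : (oneParam (E := E) (e j) 0 : G) • x = x :=
    (congrArg (· • x) (oneParam_zero (G := G) (E := E) (e j))).trans (one_smul _ _)
  refine hd.le_of_lip' hL (.of_forall fun s => ?_)
  rw [e0, sub_zero, Real.norm_eq_abs]
  rcases le_total 0 s with hs | hs
  · rw [abs_of_nonneg hs, norm_sub_rev]
    exact key s hs x
  · rw [abs_of_nonpos hs]
    have h1 := key (-s) (by linarith) ((oneParam (E := E) (e j) s : G) • x)
    have e1 : (oneParam (E := E) (e j) (-s) : G) • (oneParam (E := E) (e j) s : G) • x = x := by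
      rw [smul_smul]
      have : (oneParam (E := E) (e j) (-s) : G) * (oneParam (E := E) (e j) s : G) = 1 := by
        have h2 := oneParam_neg (G := G) (E := E) (e j) s
        exact (congrArg (· * (oneParam (E := E) (e j) s : G)) h2).trans (inv_mul_cancel _)
      rw [this, one_smul]
    rwa [e1] at h1

end RiemannianDistance

/-! ### Comparison of the Lipschitz norm with first derivatives, and the families of norms -/

section LipschitzNorm

open Filter Topology

variable {E : Type*} [NormedAddCommGroup E] [NormedSpace ℝ E] [CompleteSpace E]
  {G : Type*} [TopologicalSpace G] [ChartedSpace E G] [Group G] [LieGroup 𝓘(ℝ, E) ∞ G] [T2Space G]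
  [IsTopologicalGroup G] {Γ : Subgroup G} {κ : Type*} [Fintype κ]
  {e : Module.Basis κ ℝ (Lie𝔤 E G)}

theorem norm_lieDeriv_le_sum {φ : G ⧸ Γ → ℂ} (h : IsSmooth E φ) {L : ℝ}
    (hL : ∀ j x, ‖lieDeriv (e j) φ x‖ ≤ L) (Y : Lie𝔤 E G) (x : G ⧸ Γ) :
    ‖lieDeriv Y φ x‖ ≤ (∑ j, |e.repr Y j|) * L := by
  have h1 : lieDeriv Y φ x = ∑ i, ((e.repr Y i : ℝ) : ℂ) * lieDeriv (e i) φ x := by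
    conv_lhs => rw [← e.sum_repr Y, h.lieDeriv_sum_left]
  rw [h1, Finset.sum_mul]
  refine (norm_sum_le _ _).trans (Finset.sum_le_sum fun i _ => ?_)
  rw [norm_mul, Complex.norm_real, Real.norm_eq_abs]
  exact mul_le_mul_of_nonneg_left (hL i x) (abs_nonneg _)

/-- Every tangent vector at `g` is the value of a right-invariant field, and its coordinates satisfy
`ℓ¹ ≤ Fintype.card κ * ℓ²`. -/
theorem enorm_differential_le {φ : G ⧸ Γ → ℂ} (h : IsSmooth E φ) {L : ℝ} (hL0 : 0 ≤ L)
    (hL : ∀ j x, ‖lieDeriv (e j) φ x‖ ≤ L) (g : G) (v : E) :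
    ‖(differential (fun g : G => φ g) g v : ℂ)‖ₑ
      ≤ ENNReal.ofReal (Fintype.card κ * L) * rightInvLength e g v := by
  set Y : E := differential (fun x : G => x * g⁻¹) g v with hY
  have h1 : (differential (fun g : G => φ g) g v : ℂ) = lieDeriv (E := E) Y φ g := by
    rw [h.lieDeriv_coe, hY, rightField_differential]
  rw [h1, rightInvLength_eq, ← ENNReal.ofReal_mul (by positivity), ← ofReal_norm]
  refine ENNReal.ofReal_le_ofReal ((norm_lieDeriv_le_sum h hL Y g).trans ?_)
  have h2 : ∑ j, |e.repr Y j| ≤ Fintype.card κ * Real.sqrt (∑ i, (e.repr Y i) ^ 2) := by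
    refine (Finset.sum_le_card_nsmul _ _ _ fun j _ => Real.abs_le_sqrt ?_).trans_eq
      (by rw [nsmul_eq_mul, Finset.card_univ])
    exact Finset.single_le_sum (f := fun j => (e.repr Y j) ^ 2) (fun i _ => sq_nonneg _)
      (Finset.mem_univ j)
  calc _ ≤ _ := mul_le_mul_of_nonneg_right h2 hL0
    _ = _ := by
      rw [mul_right_comm]

/-- The differential is integrated along a `C^1` path from `g` to `g'` of length less than `r`. -/
theorem enorm_sub_le_mul_rightInvEDist {φ : G ⧸ Γ → ℂ} (h : IsSmooth E φ) {L : ℝ} (hL0 : 0 ≤ L)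
    (hL : ∀ j x, ‖lieDeriv (e j) φ x‖ ≤ L) {g g' : G} {r : ℝ≥0∞} (hr : rightInvEDist e g g' < r) :
    ‖φ g - φ g'‖ₑ ≤ ENNReal.ofReal (Fintype.card κ * L) * r := by
  let : ∀ x : G, ENorm (TangentSpace 𝓘(ℝ, E) x) := fun x => ⟨rightInvLength e x⟩
  have : ∀ x : G, ENormSMulClass ℝ (TangentSpace 𝓘(ℝ, E) x) := fun x =>
    ⟨fun a v => rightInvLength_smul (E := E) x a v⟩
  obtain ⟨γ, h0, h1, hγ, hlen, -, -⟩ :=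
    Manifold.exists_lt_locally_constant_of_riemannianEDist_lt (I := 𝓘(ℝ, E)) hr zero_lt_one
  rw [Manifold.pathELength_eq_lintegral_mfderiv_Icc] at hlen
  set c : ℝ → ℂ := fun t => φ (γ t : G ⧸ Γ) with hc
  have hc1 : ContDiff ℝ 1 c := by
    rw [← contMDiff_iff_contDiff]
    exact ContMDiff.comp (g := fun g : G => φ (g : G ⧸ Γ))
      (ContMDiff.of_le h (by exact_mod_cast le_top)) hγ
  have hd : ∀ t, HasDerivAt c (differential (fun g : G => φ g) (γ t)
      (differential γ t (1 : ℝ) : E)) t := fun t => by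
    have v1 : HasVelocityAt γ (differential γ t (1 : ℝ) : E) t := by
      have := hγ.hasDifferentialAt one_ne_zero t
      unfold HasVelocityAt
      convert this using 1
      ext
      simp
    exact hasVelocityAt_iff_hasDerivAt.1 ((h.hasDifferentialAt (γ t)).comp_velocity v1 rfl)
  have hft : ‖c 1 - c 0‖ₑ ≤ ∫⁻ t in Icc (0 : ℝ) 1, ‖derivWithin c (Icc 0 1) t‖ₑ :=
    enorm_sub_le_lintegral_derivWithin_Icc_of_contDiffOn_Icc hc1.contDiffOn zero_le_one
  have e1 : c 1 = φ g' := by simp only [hc, h1]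
  have e0 : c 0 = φ g := by simp only [hc, h0]
  rw [e0, e1, ← enorm_neg, neg_sub] at hft
  refine hft.trans ?_
  have hle : ∫⁻ t in Icc (0 : ℝ) 1, ‖derivWithin c (Icc 0 1) t‖ₑ
      ≤ ∫⁻ t in Icc (0 : ℝ) 1, ENNReal.ofReal (Fintype.card κ * L)
        * rightInvLength e (γ t) (differential γ t (1 : ℝ) : E) := by
    refine setLIntegral_mono' measurableSet_Icc fun t ht => ?_
    rw [(hd t).hasDerivWithinAt.derivWithin (uniqueDiffOn_Icc zero_lt_one t ht)]
    exact enorm_differential_le h hL0 hL (γ t) _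
  refine hle.trans ?_
  rw [lintegral_const_mul' _ _ ENNReal.ofReal_ne_top]
  exact mul_le_mul_right hlen.le _

/-- Positivity of `c` matters where the distance is infinite, since `0 * ∞ = 0`. -/
theorem enorm_sub_le_mul_quotEDist {φ : G ⧸ Γ → ℂ} (h : IsSmooth E φ) {L : ℝ} (hL0 : 0 ≤ L)
    (hL : ∀ j x, ‖lieDeriv (e j) φ x‖ ≤ L) {c : ℝ} (hc : 0 < c) (hcL : Fintype.card κ * L ≤ c)
    (x y : G ⧸ Γ) : ‖φ x - φ y‖ₑ ≤ ENNReal.ofReal c * quotEDist e x y := by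
  rw [mul_comm, ← ENNReal.div_le_iff (by simpa using hc) ENNReal.ofReal_ne_top]
  refine le_of_forall_gt fun r hr => ?_
  obtain ⟨r', hr', hrr⟩ := exists_between hr
  unfold quotEDist at hr'
  simp only [iInf_lt_iff] at hr'
  obtain ⟨g, g', rfl, rfl, hgg⟩ := hr'
  refine lt_of_le_of_lt ?_ hrr
  rw [ENNReal.div_le_iff (by simpa using hc) ENNReal.ofReal_ne_top, mul_comm]
  exact (enorm_sub_le_mul_rightInvEDist h hL0 hL hgg).trans
    (mul_le_mul_left (ENNReal.ofReal_le_ofReal hcL) _)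

theorem lipNorm_nonneg (φ : G ⧸ Γ → ℂ) : 0 ≤ lipNorm e φ :=
  Real.sInf_nonneg fun _ h => h.1

theorem lipNorm_le {φ : G ⧸ Γ → ℂ} (h : φ ∈ smoothAlg E Γ) {L : ℝ} (hL0 : 0 ≤ L)
    (hL : ∀ j x, ‖lieDeriv (e j) φ x‖ ≤ L) : lipNorm e φ ≤ Fintype.card κ * L := by
  refine le_of_forall_gt_imp_ge_of_dense fun c hc => ?_
  have hc0 : 0 < c := lt_of_le_of_lt (by positivity) hc
  exact csInf_le ⟨0, fun _ h => h.1⟩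
    ⟨hc0.le, enorm_sub_le_mul_quotEDist (isSmooth_of_mem h) hL0 hL hc0 hc.le⟩

theorem norm_lieDeriv_le_supNorm {φ : G ⧸ Γ → ℂ} (h : φ ∈ smoothAlg E Γ) (Y : Lie𝔤 E G)
    (x : G ⧸ Γ) : ‖lieDeriv Y φ x‖ ≤ supNorm (lieDeriv Y φ) :=
  norm_le_supNorm (lieDeriv_mem_smoothAlg h Y) x

theorem norm_lieDeriv_le_lipNorm {φ : G ⧸ Γ → ℂ} (h : φ ∈ smoothAlg E Γ) (j : κ) (x : G ⧸ Γ) :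
    ‖lieDeriv (e j) φ x‖ ≤ lipNorm e φ := by
  -- The derivatives are bounded because they lie in the algebra again. So some Lipschitz constant
  -- exists; otherwise the infimum `lipNorm` would take its default value `0`.
  have hb : ∀ i x, ‖lieDeriv (e i) φ x‖ ≤ ∑ i, supNorm (lieDeriv (e i) φ) := fun i x =>
    (norm_lieDeriv_le_supNorm h (e i) x).trans
      (Finset.single_le_sum (f := fun i => supNorm (lieDeriv (e i) φ))
        (fun i _ => supNorm_nonneg _) (Finset.mem_univ i))
  have hb0 : 0 ≤ ∑ i, supNorm (lieDeriv (e i) φ) := Finset.sum_nonneg fun i _ => supNorm_nonneg _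
  have hc0 : 0 < Fintype.card κ * (∑ i, supNorm (lieDeriv (e i) φ)) + 1 := by positivity
  exact le_csInf ⟨_, hc0.le, enorm_sub_le_mul_quotEDist (isSmooth_of_mem h) hb0 hb hc0 (by simp)⟩
    fun L hL => norm_lieDeriv_le_of_lipschitz h hL.1 hL.2 j x

theorem lipNorm_sub_const (φ : G ⧸ Γ → ℂ) (z : ℂ) :
    lipNorm e (fun x => φ x - z) = lipNorm e φ := by
  simp [lipNorm]

theorem lipNorm_conj (φ : G ⧸ Γ → ℂ) : lipNorm e (fun x => conj (φ x)) = lipNorm e φ := by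
  have : ∀ x y, ‖conj (φ x) - conj (φ y)‖ₑ = ‖φ x - φ y‖ₑ := fun x y => by
    rw [← map_sub, ← ofReal_norm, ← ofReal_norm, RCLike.norm_conj]
  simp only [lipNorm, this]

/-- Functions move slowly along one-parameter groups if their derivatives are small. -/
theorem norm_oneParam_smul_sub_le {φ : G ⧸ Γ → ℂ} (h : IsSmooth E φ) {L : ℝ}
    (hL : ∀ j x, ‖lieDeriv (e j) φ x‖ ≤ L) (Y : E) (s : ℝ) (x : G ⧸ Γ) :
    ‖φ ((oneParam Y s : G) • x) - φ x‖ ≤ (∑ j, |e.repr Y j|) * L * |s| := by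
  have := Convex.norm_image_sub_le_of_norm_hasDerivWithin_le (s := univ) (x := 0) (y := s)
    (fun t _ => (h.hasDerivAt_smul Y x t).hasDerivWithinAt)
    (fun t _ => norm_lieDeriv_le_sum h hL Y _) convex_univ (mem_univ _) (mem_univ _)
  rwa [oneParam_zero, one_smul, sub_zero, Real.norm_eq_abs] at this

/-! ### The `C^k` norm and the Sobolev norm -/

theorem supNorm_wordDeriv_le_ckNorm {k : ℕ} (φ : G ⧸ Γ → ℂ) {l : List κ} (hl : l.length ≤ k) :
    supNorm (wordDeriv e l φ) ≤ ckNorm e k φ := by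
  have : supNorm (wordDeriv e (List.ofFn l.get) φ) ≤ ckNorm e k φ :=
    le_ciSup (f := fun w : Words κ k => supNorm (wordDeriv e (List.ofFn w.2) φ))
      (Set.finite_range _).bddAbove ⟨⟨l.length, by omega⟩, l.get⟩
  rwa [List.ofFn_get] at this

theorem ckNorm_le {k : ℕ} {φ : G ⧸ Γ → ℂ} {W : ℝ} (hW : 0 ≤ W)
    (h : ∀ l : List κ, l.length ≤ k → supNorm (wordDeriv e l φ) ≤ W) : ckNorm e k φ ≤ W :=
  Real.iSup_le (fun w => h _ (by rw [List.length_ofFn]; omega)) hW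

theorem ckNorm_nonneg {k : ℕ} (φ : G ⧸ Γ → ℂ) : 0 ≤ ckNorm e k φ :=
  Real.iSup_nonneg fun _ => supNorm_nonneg _

theorem wordDeriv_sub_const {φ : G ⧸ Γ → ℂ} (h : φ ∈ smoothAlg E Γ) (z : ℂ) {l : List κ}
    (hl : l ≠ []) : wordDeriv e l (fun x => φ x - z) = wordDeriv e l φ := by
  simp only [sub_eq_add_neg]
  rw [wordDeriv_add h (const_mem_smoothAlg _), wordDeriv_const _ hl]
  simp

theorem supNorm_sub_const_le {φ : G ⧸ Γ → ℂ} (h : φ ∈ smoothAlg E Γ) (z : ℂ) :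
    supNorm (fun x => φ x - z) ≤ supNorm φ + ‖z‖ :=
  supNorm_le (add_nonneg (supNorm_nonneg _) (norm_nonneg _)) fun x =>
    (norm_sub_le _ _).trans (by gcongr; exact norm_le_supNorm h x)

theorem ckNorm_sub_const_le {k : ℕ} {φ : G ⧸ Γ → ℂ} (h : φ ∈ smoothAlg E Γ) (z : ℂ) :
    ckNorm e k (fun x => φ x - z) ≤ ckNorm e k φ + ‖z‖ := by
  refine ckNorm_le (add_nonneg (ckNorm_nonneg _) (norm_nonneg _)) fun l hl => ?_
  by_cases h0 : l = []
  · subst h0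
    exact (supNorm_sub_const_le h z).trans
      (add_le_add_left (supNorm_wordDeriv_le_ckNorm (e := e) φ hl) _)
  · rw [wordDeriv_sub_const h z h0]
    exact (supNorm_wordDeriv_le_ckNorm φ hl).trans (le_add_of_nonneg_right (norm_nonneg _))

theorem ckNorm_corr_le {g g' : G} {a : ℝ} (ha1 : 1 ≤ a)
    (ha : ∀ i j, |e.repr (Ad g (e j)) i| ≤ a) (ha' : ∀ i j, |e.repr (Ad g' (e j)) i| ≤ a)
    {φ : G ⧸ Γ → ℂ} (hφ : φ ∈ smoothAlg E Γ) (k : ℕ) :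
    ckNorm e k (fun x => φ (g • x) * conj (φ (g' • x)))
      ≤ 2 ^ k * ((1 + Fintype.card κ) * a) ^ (2 * k) * ckNorm e k φ ^ 2 := by
  refine ckNorm_le (by positivity) fun l hl => ?_
  exact isInvariantSeminorm_supNorm.wordDeriv_corr_le isInvariantSeminorm_supNorm
    (fun f hf h hh => supNorm_mul_le hf hh) (fun f _ => (supNorm_conj f).le) ha1 ha ha' hφ
    (fun l hl => supNorm_wordDeriv_le_ckNorm φ hl) hl

theorem norm_lieDeriv_le_ckNorm {k : ℕ} (hk : 1 ≤ k) {φ : G ⧸ Γ → ℂ} (h : φ ∈ smoothAlg E Γ)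
    (j : κ) (x : G ⧸ Γ) : ‖lieDeriv (e j) φ x‖ ≤ ckNorm e k φ :=
  (norm_lieDeriv_le_supNorm h (e j) x).trans
    (supNorm_wordDeriv_le_ckNorm (e := e) (l := [j]) φ (by simpa using hk))

/-- Together with `lipNorm_le`, this lets the Lipschitz norm of a correlation be estimated by the
Leibniz rule for the `C^1` norm. -/
theorem ckNorm_one_le {φ : G ⧸ Γ → ℂ} (h : φ ∈ smoothAlg E Γ) :
    ckNorm e 1 φ ≤ max (supNorm φ) (lipNorm e φ) := by
  refine ckNorm_le (le_max_of_le_left (supNorm_nonneg _)) fun l hl => ?_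
  match l with
  | [] => exact le_max_left _ _
  | [j] =>
    exact le_max_of_le_right (supNorm_le (lipNorm_nonneg _) (norm_lieDeriv_le_lipNorm h j))
  | _ :: _ :: _ => simp at hl

variable [MeasurableSpace G] [BorelSpace G] {μ : Measure (G ⧸ Γ)}

theorem sobolevNorm_nonneg {q : ℝ≥0∞} {k : ℕ} (φ : G ⧸ Γ → ℂ) : 0 ≤ sobolevNorm e μ q k φ :=
  Finset.sum_nonneg fun _ _ => ENNReal.toReal_nonneg

theorem eLpNorm_wordDeriv_le_sobolevNorm {q : ℝ≥0∞} {k : ℕ} (φ : G ⧸ Γ → ℂ) {l : List κ}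
    (hl : l.length ≤ k) : (eLpNorm (wordDeriv e l φ) q μ).toReal ≤ sobolevNorm e μ q k φ := by
  have := Finset.single_le_sum
    (f := fun w : Words κ k => (eLpNorm (wordDeriv e (List.ofFn w.2) φ) q μ).toReal)
    (fun _ _ => ENNReal.toReal_nonneg) (Finset.mem_univ ⟨⟨l.length, by omega⟩, l.get⟩)
  rw [List.ofFn_get] at this
  exact this

theorem sobolevNorm_le {q : ℝ≥0∞} {k : ℕ} {φ : G ⧸ Γ → ℂ} {W : ℝ}
    (h : ∀ l : List κ, l.length ≤ k → (eLpNorm (wordDeriv e l φ) q μ).toReal ≤ W) :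
    sobolevNorm e μ q k φ ≤ Fintype.card (Words κ k) * W := by
  refine (Finset.sum_le_card_nsmul _ _ W fun w _ => h _ ?_).trans_eq
    (by rw [nsmul_eq_mul, Finset.card_univ])
  rw [List.length_ofFn]; omega

theorem sobolevNorm_mono [IsProbabilityMeasure μ] {φ : G ⧸ Γ → ℂ} (h : φ ∈ smoothAlg E Γ) (k : ℕ)
    {q q' : ℝ≥0∞} (hq : q ≤ q') : sobolevNorm e μ q k φ ≤ sobolevNorm e μ q' k φ :=
  Finset.sum_le_sum fun w _ => by
    have hw := wordDeriv_mem_smoothAlg (e := e) h (List.ofFn w.2)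
    exact ENNReal.toReal_mono (memLp_of_mem hw q').eLpNorm_ne_top
      (eLpNorm_le_eLpNorm_of_exponent_le hq (memLp_of_mem hw q).1)

theorem sobolevNorm_sub_const_le [IsProbabilityMeasure μ] [SMulInvariantMeasure G (G ⧸ Γ) μ]
    {φ : G ⧸ Γ → ℂ} (h : φ ∈ smoothAlg E Γ) (z : ℂ) {q : ℝ≥0∞} (hq : 1 ≤ q) (k : ℕ) :
    sobolevNorm e μ q k (fun x => φ x - z) ≤ sobolevNorm e μ q k φ + ‖z‖ := by
  -- Derivatives of positive order do not see the constant, so exactly one summand, that of the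
  -- empty word, changes.
  have hz : ∑ w : Words κ k, (if w.1 = 0 then ‖z‖ else 0) = ‖z‖ := by
    rw [Fintype.sum_sigma, Finset.sum_eq_single 0]
    · have : IsEmpty (Fin ((0 : Fin (k + 1)) : ℕ)) := Fin.isEmpty'
      exact Fintype.sum_subsingleton _ (fun i => isEmptyElim i)
    · intro j _ hj
      simp [hj]
    · simp
  rw [← hz]
  unfold sobolevNorm
  rw [← Finset.sum_add_distrib]
  refine Finset.sum_le_sum fun w _ => ?_
  by_cases hw : w.1 = 0
  · have e0 : List.ofFn w.2 = [] := by
      rw [← List.length_eq_zero_iff, List.length_ofFn, hw]; rfl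
    rw [e0, if_pos hw]
    simp only [wordDeriv, sub_eq_add_neg]
    refine ((isInvariantSeminorm_eLpNorm (E := E) μ hq).add_le φ h _
      (const_mem_smoothAlg (-z))).trans (add_le_add_right ?_ _)
    refine ENNReal.toReal_le_of_le_ofReal (norm_nonneg _) ?_
    rw [eLpNorm_const _ (by positivity) (NeZero.ne μ)]
    simp [← ofReal_norm]
  · have e0 : List.ofFn w.2 ≠ [] := fun h0 => hw (by
      rw [← List.length_eq_zero_iff, List.length_ofFn] at h0
      exact Fin.ext h0)
    rw [wordDeriv_sub_const h z e0, if_neg hw, add_zero]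

theorem sobolevNorm_corr_le [IsProbabilityMeasure μ] [SMulInvariantMeasure G (G ⧸ Γ) μ] {g g' : G}
    {a : ℝ} (ha1 : 1 ≤ a)
    (ha : ∀ i j, |e.repr (Ad g (e j)) i| ≤ a) (ha' : ∀ i j, |e.repr (Ad g' (e j)) i| ≤ a)
    {φ : G ⧸ Γ → ℂ} (hφ : φ ∈ smoothAlg E Γ) (k d : ℕ) :
    sobolevNorm e μ (2 ^ d) k (fun x => φ (g • x) * conj (φ (g' • x)))
      ≤ Fintype.card (Words κ k) * (2 ^ k * ((1 + Fintype.card κ) * a) ^ (2 * k)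
        * sobolevNorm e μ (2 ^ (d + 1)) k φ ^ 2) :=
  sobolevNorm_le fun _ hl =>
    (isInvariantSeminorm_eLpNorm (E := E) μ (one_le_pow₀ one_le_two)).wordDeriv_corr_le
      (isInvariantSeminorm_eLpNorm (E := E) μ (one_le_pow₀ one_le_two))
      (fun f hf h hh => eLpNorm_mul_le_sq hf hh d) (fun f _ => by rw [eLpNorm_conj]) ha1 ha ha' hφ
      (fun l hl => eLpNorm_wordDeriv_le_sobolevNorm φ hl) hl

/-! ### Families of norms -/

variable (e) in
/-- The properties of the norms `S d` on the smooth functions that are used below. -/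
structure IsNormFamily (S : ℕ → (G ⧸ Γ → ℂ) → ℝ) (Q : ℝ) (m : ℕ) : Prop where
  one_le : 1 ≤ Q
  norm_le : ∀ φ ∈ smoothAlg E Γ, ∀ d x, ‖φ x‖ ≤ S d φ
  norm_lieDeriv_le : ∀ φ ∈ smoothAlg E Γ, ∀ d j x, ‖lieDeriv (e j) φ x‖ ≤ S d φ
  mono : ∀ φ ∈ smoothAlg E Γ, ∀ d, S d φ ≤ S (d + 1) φ
  sub_const : ∀ φ ∈ smoothAlg E Γ, ∀ z : ℂ, ∀ d, S d (fun x => φ x - z) ≤ S d φ + ‖z‖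
  conj_le : ∀ φ ∈ smoothAlg E Γ, ∀ d, S d (fun x => conj (φ x)) ≤ S d φ
  corr : ∀ φ ∈ smoothAlg E Γ, ∀ (g g' : G) (a : ℝ), 1 ≤ a →
    (∀ i j, |e.repr (Ad g (e j)) i| ≤ a) → (∀ i j, |e.repr (Ad g' (e j)) i| ≤ a) →
    ∀ d, S d (fun x => φ (g • x) * conj (φ (g' • x))) ≤ Q * a ^ m * S (d + 1) φ ^ 2

theorem isNormFamily_ckNorm {S : ℕ → (G ⧸ Γ → ℂ) → ℝ} {k : ℕ} (hk : 1 ≤ k)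
    (hS : ∀ d φ, S d φ = ckNorm e k φ) :
    IsNormFamily e S (2 ^ k * (1 + Fintype.card κ) ^ (2 * k)) (2 * k) where
  one_le := one_le_mul_of_one_le_of_one_le (one_le_pow₀ one_le_two) (one_le_pow₀ (by simp))
  norm_le φ h d x := by
    rw [hS]
    exact (norm_le_supNorm h x).trans
      (supNorm_wordDeriv_le_ckNorm (e := e) (l := []) φ (by simp))
  norm_lieDeriv_le φ h d j x := by
    rw [hS]
    exact norm_lieDeriv_le_ckNorm hk h j x
  mono φ _ d := by rw [hS, hS]
  sub_const φ h z d := by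
    rw [hS, hS]
    exact ckNorm_sub_const_le h z
  conj_le φ h d := by
    rw [hS, hS]
    refine ckNorm_le (ckNorm_nonneg _) fun l hl => ?_
    rw [wordDeriv_conj h, supNorm_conj]
    exact supNorm_wordDeriv_le_ckNorm φ hl
  corr φ h g g' a ha1 ha ha' d := by
    rw [hS, hS, mul_assoc (2 ^ k), ← mul_pow]
    exact ckNorm_corr_le ha1 ha ha' h k

theorem isNormFamily_lipSobolevNorm [IsProbabilityMeasure μ] [SMulInvariantMeasure G (G ⧸ Γ) μ]
    {S : ℕ → (G ⧸ Γ → ℂ) → ℝ} {k : ℕ} (hS : ∀ d φ, S d φ = lipSobolevNorm e μ k d φ) :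
    IsNormFamily e S ((1 + Fintype.card κ) * (1 + Fintype.card (Words κ k))
      * (2 ^ (k + 1) * (1 + Fintype.card κ) ^ (2 * (k + 1)))) (2 * (k + 1)) where
  one_le := one_le_mul_of_one_le_of_one_le (one_le_mul_of_one_le_of_one_le
    (le_add_of_nonneg_right (Nat.cast_nonneg _)) (le_add_of_nonneg_right (Nat.cast_nonneg _)))
    (one_le_mul_of_one_le_of_one_le (one_le_pow₀ one_le_two) (one_le_pow₀ (by simp)))
  norm_le φ h d x := by
    rw [hS]
    exact (norm_le_supNorm h x).trans (le_max_left _ _)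
  norm_lieDeriv_le φ h d j x := by
    rw [hS]
    exact (norm_lieDeriv_le_lipNorm h j x).trans (le_max_of_le_right (le_max_left _ _))
  mono φ h d := by
    rw [hS, hS]
    exact max_le_max le_rfl (max_le_max le_rfl (sobolevNorm_mono h k
      (pow_le_pow_right₀ one_le_two d.le_succ)))
  sub_const φ h z d := by
    rw [hS, hS]
    unfold lipSobolevNorm
    have hz := norm_nonneg z
    refine max_le ((supNorm_sub_const_le h z).trans (by gcongr; exact le_max_left _ _))
      (max_le ?_ ((sobolevNorm_sub_const_le h z (one_le_pow₀ one_le_two) k).trans ?_))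
    · rw [lipNorm_sub_const]
      exact (le_max_of_le_right (le_max_left _ _)).trans (le_add_of_nonneg_right hz)
    · gcongr
      exact le_max_of_le_right (le_max_right _ _)
  conj_le φ h d := by
    rw [hS, hS]
    refine max_le_max (supNorm_conj φ).le (max_le_max (lipNorm_conj φ).le (le_of_eq ?_))
    refine Finset.sum_congr rfl fun w _ => ?_
    rw [wordDeriv_conj h, eLpNorm_conj]
  corr φ h g g' a ha1 ha ha' d := by
    rw [hS, hS]
    set s := lipSobolevNorm e μ k (d + 1) φ with hs
    have hsup : supNorm φ ≤ s := le_max_left _ _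
    have hlip : lipNorm e φ ≤ s := le_max_of_le_right (le_max_left _ _)
    have hsob : sobolevNorm e μ (2 ^ (d + 1)) k φ ≤ s := le_max_of_le_right (le_max_right _ _)
    have hs0 : 0 ≤ s := (supNorm_nonneg φ).trans hsup
    set K : ℝ := (Fintype.card κ : ℝ) with hK
    set w : ℝ := (Fintype.card (Words κ k) : ℝ) with hw
    have hK0 : 0 ≤ K := Nat.cast_nonneg _
    have hw0 : 0 ≤ w := Nat.cast_nonneg _
    have hKa : 1 ≤ (1 + K) * a := one_le_mul_of_one_le_of_one_le (by linarith) ha1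
    -- Order `k + 1` dominates both the `C^1` part, also when `k = 0`, and the Sobolev part of order
    -- `k`.
    set R : ℝ := 2 ^ (k + 1) * ((1 + K) * a) ^ (2 * (k + 1)) with hR
    have hR1 : 1 ≤ R := one_le_mul_of_one_le_of_one_le (one_le_pow₀ one_le_two) (one_le_pow₀ hKa)
    have hle : ∀ n ≤ k + 1, (2 : ℝ) ^ n * ((1 + K) * a) ^ (2 * n) ≤ R := fun n hn =>
      mul_le_mul (pow_le_pow_right₀ one_le_two hn) (pow_le_pow_right₀ hKa (by omega))
        (by positivity) (by positivity)
    have hmem := mul_mem_smoothAlg (comp_smul_mem_smoothAlg h g)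
      (conj_mem_smoothAlg (comp_smul_mem_smoothAlg h g'))
    have hck : ckNorm e 1 φ ≤ s := (ckNorm_one_le h).trans (max_le hsup hlip)
    have hck0 : 0 ≤ ckNorm e 1 φ := ckNorm_nonneg φ
    have hcorr1 : ckNorm e 1 (fun x => φ (g • x) * conj (φ (g' • x))) ≤ R * s ^ 2 :=
      (ckNorm_corr_le ha1 ha ha' h 1).trans (mul_le_mul (hle 1 (by omega))
        (pow_le_pow_left₀ hck0 hck 2) (by positivity) (by positivity))
    have htot : (1 + K) * (1 + w) * (2 ^ (k + 1) * (1 + K) ^ (2 * (k + 1))) * a ^ (2 * (k + 1))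
        * s ^ 2 = (1 + K) * (1 + w) * (R * s ^ 2) := by
      rw [hR, mul_pow]; ring
    rw [htot]
    have hRs : 0 ≤ R * s ^ 2 := by positivity
    have f1 : 1 ≤ (1 + K) * (1 + w) := one_le_mul_of_one_le_of_one_le (by linarith) (by linarith)
    have f2 : K ≤ (1 + K) * (1 + w) := by nlinarith
    have f3 : w ≤ (1 + K) * (1 + w) := by nlinarith
    refine max_le ?_ (max_le ?_ ?_)
    · refine le_trans ?_ (le_mul_of_one_le_left hRs f1)
      exact (supNorm_wordDeriv_le_ckNorm (e := e) (k := 1) (l := []) _ (by simp)).trans hcorr1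
    · refine le_trans ?_ (mul_le_mul_of_nonneg_right f2 hRs)
      exact (lipNorm_le hmem (ckNorm_nonneg _) (norm_lieDeriv_le_ckNorm le_rfl hmem)).trans
        (mul_le_mul_of_nonneg_left hcorr1 hK0)
    · refine le_trans ?_ (mul_le_mul_of_nonneg_right f3 hRs)
      refine (sobolevNorm_corr_le ha1 ha ha' h k d).trans (mul_le_mul_of_nonneg_left ?_ hw0)
      exact mul_le_mul (hle k (by omega)) (pow_le_pow_left₀ (sobolevNorm_nonneg _) hsob 2)
        (sq_nonneg _) (by positivity)

end LipschitzNorm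

/-! ### Expansion in the eigenbasis -/

section Wiener

variable {X : Type*} [MeasurableSpace X] {ν : Measure X} [IsProbabilityMeasure ν] {Ξ : Type*}

theorem integral_sq_norm_hilbertBasis (ψ : HilbertBasis Ξ ℂ (Lp ℂ 2 ν)) (ξ : Ξ) :
    ∫ x, ‖(ψ ξ : X → ℂ) x‖ ^ 2 ∂ν = 1 := by
  have h1 : inner ℂ (ψ ξ) (ψ ξ) = (1 : ℂ) := by
    rw [inner_self_eq_norm_sq_to_K, ψ.orthonormal.1 ξ]
    simp
  rw [L2.inner_def] at h1
  simp only [inner_self_eq_norm_sq_to_K] at h1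
  have h2 : ∫ x, (((‖(ψ ξ : X → ℂ) x‖ ^ 2 : ℝ)) : ℂ) ∂ν = 1 := by
    rw [← h1]
    refine integral_congr_ae (.of_forall fun x => ?_)
    simp
  rw [integral_complex_ofReal] at h2
  exact_mod_cast h2

/-- Expansion of an integral in an orthonormal basis. -/
theorem hasSum_fourierCoeff_mul_integral (ψ : HilbertBasis Ξ ℂ (Lp ℂ 2 ν)) {φ H : X → ℂ}
    (hφ : MemLp φ 2 ν) (hH : MemLp H 2 ν) :
    HasSum (fun ξ => fourierCoeff ψ φ ξ * ∫ x, (ψ ξ : X → ℂ) x * H x ∂ν) (∫ x, φ x * H x ∂ν) := by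
  -- The inner product is conjugate linear in its first argument, so the conjugate of `H` goes there
  -- to give the bilinear pairing.
  have hH' : MemLp (fun x => conj (H x)) 2 ν := hH.star
  have h := ψ.hasSum_inner_mul_inner (hH'.toLp _) (hφ.toLp _)
  have e1 : inner ℂ (hH'.toLp _) (hφ.toLp _) = ∫ x, φ x * H x ∂ν := by
    rw [L2.inner_def]
    refine integral_congr_ae ?_
    filter_upwards [hH'.coeFn_toLp, hφ.coeFn_toLp] with x h1 h2
    rw [h1, h2]
    simp
  have e2 : ∀ ξ, inner ℂ (hH'.toLp _) (ψ ξ) = ∫ x, (ψ ξ : X → ℂ) x * H x ∂ν := fun ξ => by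
    rw [L2.inner_def]
    refine integral_congr_ae ?_
    filter_upwards [hH'.coeFn_toLp] with x h1
    rw [h1]
    simp
  have e3 : ∀ ξ, inner ℂ (ψ ξ) (hφ.toLp _) = fourierCoeff ψ φ ξ := fun ξ => by
    rw [L2.inner_def]
    refine integral_congr_ae ?_
    filter_upwards [hφ.coeFn_toLp] with x h1
    rw [h1]
    simp
  rw [e1] at h
  refine h.congr_fun ?_
  intro ξ
  rw [e2, e3, mul_comm]

/-- A bound for all basis functions extends to the Wiener algebra. -/
theorem norm_integral_mul_sub_le (ψ : HilbertBasis Ξ ℂ (Lp ℂ 2 ν)) {φ₀ F : X → ℂ}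
    (hφ₀ : φ₀ ∈ wienerAlg ψ) (hF : MemLp F 2 ν) (P : ℂ) {R : ℝ}
    (h : ∀ ξ, ‖∫ x, (ψ ξ : X → ℂ) x * F x ∂ν - (∫ x, (ψ ξ : X → ℂ) x ∂ν) * P‖ ≤ R) :
    ‖∫ x, φ₀ x * F x ∂ν - (∫ x, φ₀ x ∂ν) * P‖ ≤ wienerNorm ψ φ₀ * R := by
  obtain ⟨hm, ⟨C, hC⟩, hsum⟩ := hφ₀
  have hφ : MemLp φ₀ 2 ν := MemLp.of_bound hm.aestronglyMeasurable C (.of_forall hC)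
  have key : ∀ g : X → ℂ, MemLp g 2 ν →
      ∫ x, g x * (F x - P) ∂ν = ∫ x, g x * F x ∂ν - (∫ x, g x ∂ν) * P := fun g hg => by
    have h1 : Integrable (fun x => g x * F x) ν := hg.integrable_mul hF
    rw [← integral_mul_const, ← integral_sub h1 ((hg.integrable one_le_two).mul_const P)]
    simp only [mul_sub]
  -- Expanding against `F - P` makes both integrals in the claim into one series, whose terms are
  -- bounded by `h`.
  have hs := hasSum_fourierCoeff_mul_integral ψ hφ (H := fun x => F x - P)
    (hF.sub (memLp_const P))
  rw [← key φ₀ hφ, ← hs.tsum_eq]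
  refine tsum_of_norm_bounded (hsum.hasSum.mul_right R) fun ξ => ?_
  rw [norm_mul, key _ (Lp.memLp _)]
  exact mul_le_mul_of_nonneg_left (h ξ) (norm_nonneg _)

end Wiener

/-! ### The separation parameter -/

section Delta

variable {T ι : Type*} [Group T] {α : ι → T →* ℝˣ} {ρ : T → ℝ} {r : ℕ}

theorem Delta_le_rho (t : Fin r → T) (i : Fin r) : Delta α ρ t ≤ ρ (t i) := by
  have h : ⨅ i, ρ (t i) ≤ ρ (t i) := ciInf_le (Set.finite_range _).bddBelow i
  unfold Delta
  split_ifs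
  · exact h
  · exact (min_le_left _ _).trans h

theorem Delta_le_starNorm (t : Fin r → T) {i j : Fin r} (hij : i ≠ j) :
    Delta α ρ t ≤ starNorm α (t i * (t j)⁻¹) := by
  have hr : ¬ r ≤ 1 := fun hr => hij (by
    have := i.2
    have := j.2
    ext
    omega)
  unfold Delta
  rw [if_neg hr]
  exact (min_le_right _ _).trans
    (ciInf_le (f := fun p : {p : Fin r × Fin r // p.1 ≠ p.2} =>
      starNorm α (t p.1.1 * (t p.1.2)⁻¹)) (Set.finite_range _).bddBelow ⟨(i, j), hij⟩)

end Delta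

/-! ### Verification of the axioms in the Lie group setting -/

section Assembly

variable {E : Type*} [NormedAddCommGroup E] [NormedSpace ℝ E] [CompleteSpace E]
  {G : Type*} [TopologicalSpace G] [ChartedSpace E G] [Group G] [LieGroup 𝓘(ℝ, E) ∞ G] [T2Space G]
  [IsTopologicalGroup G] [MeasurableSpace G] [BorelSpace G] {Γ : Subgroup G}
  {U T : Subgroup G} {ι κ : Type*} [Fintype ι] [Fintype κ]
  {e : Module.Basis κ ℝ (Lie𝔤 E G)} {b : Module.Basis ι ℝ (lieAlgOf E U)} {α : ι → (T →* ℝˣ)}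
  {μ ν : Measure (G ⧸ Γ)} {S : ℕ → (G ⧸ Γ → ℂ) → ℝ} {Tplus : Set T} {ρ : T → ℝ}

variable (b) in
/-- The one-parameter subgroups defined by a basis of the Lie algebra of `U`. -/
def basisFlow (i : ι) (s : ℝ) : G := oneParam (E := E) (b i : Lie𝔤 E G) s

theorem lieExp_smul_basis (i : ι) (s : ℝ) :
    lieExp ((s • b i : lieAlgOf E U) : Lie𝔤 E G) = basisFlow b i s := rfl

theorem basisFlow_add (i : ι) (s t : ℝ) :
    basisFlow b i (s + t) = basisFlow b i s * basisFlow b i t := oneParam_add _ s t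

theorem basisFlow_mem (hU : IsClosed (U : Set G)) (i : ι) (s : ℝ) : basisFlow b i s ∈ U :=
  oneParam_mem_of_mem_lieAlgOf hU (b i).2 s

theorem norm_equivFun_smul_basis (i : ι) (s : ℝ) : ‖b.equivFun (s • b i)‖ = |s| := by
  classical
  rw [map_smul, norm_smul, Real.norm_eq_abs]
  have : b.equivFun (b i) = Pi.single i 1 := by
    ext j
    simp [Pi.single_apply, eq_comm]
  rw [this, Pi.norm_single, norm_one, mul_one]

theorem exists_Ad_basisFlow_le (hgrowth : ∃ B p : ℝ, ∀ (w : lieAlgOf E U) (i j : κ),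
      |e.repr (Ad (lieExp (w : Lie𝔤 E G)) (e j)) i| ≤ B * (max 1 ‖b.equivFun w‖) ^ p) :
    ∃ (B : ℝ) (P : ℕ), 1 ≤ B ∧ ∀ k s N, 1 ≤ N → |s| ≤ N → ∀ i j,
      |e.repr (Ad (basisFlow b k s) (e j)) i| ≤ B * N ^ P := by
  obtain ⟨B, p, h⟩ := hgrowth
  -- A natural exponent and a constant at least `1` make `B * N ^ P` an admissible bound `a ≥ 1` in
  -- `IsNormFamily.corr`.
  refine ⟨1 + |B|, ⌈p⌉₊, le_add_of_nonneg_right (abs_nonneg B), fun k s N hN hs i j => ?_⟩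
  have h1 := h (s • b k) i j
  rw [norm_equivFun_smul_basis, lieExp_smul_basis] at h1
  have h0 : (1 : ℝ) ≤ max 1 |s| := le_max_left _ _
  calc _ ≤ B * (max 1 |s|) ^ p := h1
    _ ≤ (1 + |B|) * (max 1 |s|) ^ p :=
        mul_le_mul_of_nonneg_right (by linarith [le_abs_self B]) (by positivity)
    _ ≤ (1 + |B|) * N ^ ⌈p⌉₊ := by
        refine mul_le_mul_of_nonneg_left ?_ (by positivity)
        calc (max 1 |s|) ^ p ≤ (max 1 |s|) ^ (⌈p⌉₊ : ℝ) :=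
              Real.rpow_le_rpow_of_exponent_le h0 (Nat.le_ceil p)
          _ = (max 1 |s|) ^ ⌈p⌉₊ := Real.rpow_natCast _ _
          _ ≤ N ^ ⌈p⌉₊ := pow_le_pow_left₀ (by positivity) (max_le hN hs) _

/-- The setting of the theorem provides the data for the abstract equidistribution argument. -/
theorem exists_equidistData [IsProbabilityMeasure μ] [SMulInvariantMeasure G (G ⧸ Γ) μ]
    [IsProbabilityMeasure ν] [SMulInvariantMeasure U (G ⧸ Γ) ν] (hU : IsClosed (U : Set G))
    (hdiag : ∀ (t : T) (i : ι), Ad (t : G) (b i : Lie𝔤 E G)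
      = ((α i t : ℝˣ) : ℝ) • (b i : Lie𝔤 E G))
    (hgrowth : ∃ B p : ℝ, ∀ (w : lieAlgOf E U) (i j : κ),
      |e.repr (Ad (lieExp (w : Lie𝔤 E G)) (e j)) i| ≤ B * (max 1 ‖b.equivFun w‖) ^ p)
    {Q : ℝ} {m : ℕ} (hS : IsNormFamily e S Q m) {D δ : ℝ} (hD : 1 ≤ D) (hδ : 0 < δ)
    (hEQ1 : ∀ φ ∈ smoothAlg E Γ, ∀ t ∈ Tplus,
        ‖∫ x, φ ((t : G) • x) ∂ν - ∫ x, φ x ∂μ‖ ≤ D * ρ t ^ (-δ) * S 1 φ)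
    {C c : ℝ} (hC : 1 ≤ C) (hc : 0 < c) (hc2 : c < 1 / 2)
    (hEQ2 : ∀ φ₁ ∈ smoothAlg E Γ, ∀ φ₂ ∈ smoothAlg E Γ, ∀ w : lieAlgOf E U,
          ‖∫ x, φ₁ (lieExp (w : Lie𝔤 E G) • x) * φ₂ x ∂μ
              - (∫ x, φ₁ x ∂μ) * ∫ x, φ₂ x ∂μ‖
            ≤ C * (max 1 ‖b.equivFun w‖) ^ (-c) * S 1 φ₁ * S 1 φ₂) :
    ∃ (M : ℝ) (A : ℕ), EquidistData μ ν (smoothAlg E Γ) S (basisFlow b) (fun t : T => (t : G)) α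
      Tplus ρ M A C c D δ := by
  obtain ⟨B, P, hB, hAd⟩ := exists_Ad_basisFlow_le hgrowth
  set Λ : ℝ := ∑ i, ∑ j, |e.repr (b i : Lie𝔤 E G) j| with hΛ
  have hΛ0 : 0 ≤ Λ := Finset.sum_nonneg fun i _ => Finset.sum_nonneg fun j _ => abs_nonneg _
  have hQ := hS.one_le
  have hQB : 1 ≤ Q * B ^ m := one_le_mul_of_one_le_of_one_le hQ (one_le_pow₀ hB)
  have hS0 : ∀ φ ∈ smoothAlg E Γ, ∀ d, 0 ≤ S d φ := fun φ hφ d =>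
    (norm_nonneg _).trans (hS.norm_le φ hφ d ((1 : G) : G ⧸ Γ))
  -- `Q * B ^ m` is for the correlations, where `a = B * N ^ P` enters with the power `m`, and `Λ`
  -- for the Lipschitz bound along the basis vectors `b i`.
  refine ⟨Q * B ^ m + Λ, P * m, ⟨by linarith, hC, hc, hc2, hD, hδ,
    fun φ h => measurable_of_mem h, hS.norm_le, hS.mono,
    fun φ h z => ⟨sub_const_mem_smoothAlg h z, hS.sub_const φ h z⟩, ?_, ?_, ?_, ?_, ?_, hEQ1⟩⟩
  · intro φ h i s s' N hN hs hs'
    refine ⟨mul_mem_smoothAlg (comp_smul_mem_smoothAlg h _)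
      (conj_mem_smoothAlg (comp_smul_mem_smoothAlg h _)), fun d => ?_⟩
    have hN0 : 0 < N := by linarith
    refine (hS.corr φ h _ _ (B * N ^ P) (one_le_mul_of_one_le_of_one_le hB (one_le_pow₀ hN))
      (hAd i s N hN hs) (hAd i s' N hN hs') d).trans ?_
    refine mul_le_mul_of_nonneg_right ?_ (sq_nonneg _)
    rw [mul_pow, ← pow_mul, ← mul_assoc]
    exact mul_le_mul_of_nonneg_right (by linarith) (by positivity)
  · intro φ h i s x d
    refine (norm_oneParam_smul_sub_le (isSmooth_of_mem h) (hS.norm_lieDeriv_le φ h d)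
      ((b i : Lie𝔤 E G) : E) s x).trans ?_
    have h1 : ∑ j, |e.repr (b i : Lie𝔤 E G) j| ≤ Q * B ^ m + Λ := by
      have := Finset.single_le_sum (f := fun i => ∑ j, |e.repr (b i : Lie𝔤 E G) j|)
        (fun i _ => Finset.sum_nonneg fun j _ => abs_nonneg _) (Finset.mem_univ i)
      have h2 : ∑ j, |e.repr (b i : Lie𝔤 E G) j| ≤ Λ := this
      linarith
    have h3 := mul_le_mul_of_nonneg_right h1 (mul_nonneg (abs_nonneg s) (hS0 φ h d))
    calc _ = (∑ j, |e.repr (b i : Lie𝔤 E G) j|) * (|s| * S d φ) := by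
          rw [mul_assoc, mul_comm (S d φ)]
      _ ≤ _ := h3.trans_eq (by ring)
  · intro t i s
    have h1 := conj_oneParam (E := E) (t : G) ((b i : Lie𝔤 E G) : E) s
    have h2 : (oneParam (E := E) (Ad (t : G) (b i : Lie𝔤 E G)) s : G)
        = basisFlow b i (((α i t : ℝˣ) : ℝ) * s) := by
      rw [hdiag t i]
      exact (oneParam_smul (E := E) (G := G) ((b i : Lie𝔤 E G) : E) _ s).trans (by rw [mul_comm]; rfl)
    exact mul_inv_eq_iff_eq_mul.1 (h1.trans h2)
  · intro i s
    have : MeasurableConstSMul U (G ⧸ Γ) := ⟨fun u => measurable_const_smul (u : G)⟩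
    exact measurePreserving_smul (⟨_, basisFlow_mem hU i s⟩ : U) ν
  · intro φ h h0 i s s'
    have hm := measurePreserving_smul (basisFlow b i s') μ
    -- Invariance of `μ` leaves only the relative shift `s - s'`; mixing is then applied to `φ` and
    -- its conjugate.
    have hcm : (fun x => conj (φ x)) ∈ smoothAlg E Γ := conj_mem_smoothAlg h
    have h1 : ∫ x, φ (basisFlow b i s • x) * conj (φ (basisFlow b i s' • x)) ∂μ
        = ∫ x, φ (basisFlow b i (s - s') • x) * conj (φ x) ∂μ := by
      symm
      rw [← hm.integral_comp' (f := MeasurableEquiv.smul (basisFlow b i s'))]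
      refine integral_congr_ae (.of_forall fun x => ?_)
      simp only [MeasurableEquiv.smul_apply, smul_smul, ← basisFlow_add, sub_add_cancel]
    rw [h1]
    have h2 := hEQ2 φ h _ hcm ((s - s') • b i)
    rw [h0, zero_mul, sub_zero, norm_equivFun_smul_basis, lieExp_smul_basis] at h2
    refine h2.trans ?_
    rw [mul_assoc, sq]
    refine mul_le_mul_of_nonneg_left ?_ (by positivity)
    exact mul_le_mul_of_nonneg_left (hS.conj_le φ h 1) (hS0 φ h 1)

theorem isEigenfunction_hilbertBasis [IsProbabilityMeasure ν] {Ξ : Type*}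
    {ψ : HilbertBasis Ξ ℂ (Lp ℂ 2 ν)} (hψ : IsEigenbasis (E := E) ν U ψ) (ξ : Ξ) :
    IsEigenfunction ν (basisFlow b) (ψ ξ : G ⧸ Γ → ℂ) where
  memLp := Lp.memLp _
  sq_le := (integral_sq_norm_hilbertBasis ψ ξ).le
  eigen i s := by
    obtain ⟨χ, -, h⟩ := hψ ξ
    exact ⟨χ (s • b i), Circle.norm_coe _, h (s • b i)⟩

/-- If the trivial group acts ergodically, then functions are constant. -/
theorem ae_eq_const_of_ergodicSMul_bot [ErgodicSMul U (G ⧸ Γ) ν] (hU : U = ⊥) {f : G ⧸ Γ → ℂ}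
    (hf : AEStronglyMeasurable f ν) : ∃ z : ℂ, f =ᵐ[ν] fun _ => z := by
  -- Every set is invariant under the trivial group, so all measurable sets are null or conull.
  have h1 : PreErgodic (id : G ⧸ Γ → G ⧸ Γ) ν := ⟨fun s hs _ =>
    ErgodicSMul.aeconst_of_forall_preimage_smul_ae_eq (G := U) hs fun u => by
      have hu : (u : G) = 1 := Subgroup.mem_bot.1 (hU ▸ u.2)
      have : (fun x : G ⧸ Γ => u • x) = id := funext fun x => by
        change (u : G) • x = x
        rw [hu, one_smul]
      rw [this]
      exact Filter.EventuallyEq.rfl⟩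
  obtain ⟨z, hz⟩ := h1.ae_eq_const_of_ae_eq_comp hf.stronglyMeasurable_mk.measurable rfl
  exact ⟨z, hf.ae_eq_mk.trans hz⟩

end Assembly

end MultiEquidist

end

/-! ### The main theorem -/

theorem mainTheorem5
    -- `G` is a connected semisimple Lie group without compact factors
    {E : Type*} [NormedAddCommGroup E] [NormedSpace ℝ E] [FiniteDimensional ℝ E]
    {G : Type*} [TopologicalSpace G] [ChartedSpace E G] [Group G] [LieGroup 𝓘(ℝ, E) ∞ G]
    [T2Space G] [SecondCountableTopology G] [ConnectedSpace G]
    [MeasurableSpace G] [BorelSpace G]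
    (hss : MultiEquidist.IsSemisimpleLieGroup E G) (hncf : MultiEquidist.NoCompactFactors G)
    -- `Γ` is an irreducible lattice, `μ` is the invariant probability measure on `X = G/Γ`
    (Γ : Subgroup G) [DiscreteTopology Γ] (hirr : MultiEquidist.IsIrreducibleSubgroup Γ)
    (μ : Measure (G ⧸ Γ)) [IsProbabilityMeasure μ] [SMulInvariantMeasure G (G ⧸ Γ) μ]
    -- `U` is closed connected; `T` is closed connected abelian and normalizes `U`
    (U T : Subgroup G) (hUcl : IsClosed (U : Set G)) (hUconn : IsConnected (U : Set G))
    (hTcl : IsClosed (T : Set G)) (hTconn : IsConnected (T : Set G))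
    (hTcomm : ∀ s ∈ T, ∀ t ∈ T, s * t = t * s) (hTU : ∀ t ∈ T, ∀ u ∈ U, t * u * t⁻¹ ∈ U)
    -- the adjoint action of `T` on `Lie(U)` is diagonalizable (in the basis `b`, with weights `α`)
    -- and proper
    {ι : Type*} [Fintype ι] (b : Module.Basis ι ℝ (MultiEquidist.lieAlgOf E U))
    (α : ι → (T →* ℝˣ))
    (hdiag : ∀ (t : T) (i : ι), MultiEquidist.Ad (t : G) (b i : MultiEquidist.Lie𝔤 E G)
      = ((α i t : ℝˣ) : ℝ) • (b i : MultiEquidist.Lie𝔤 E G))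
    (hproper : IsProperMap fun (t : T) (i : ι) => α i t)
    -- a basis of the Lie algebra of `G`, which fixes the norms below up to equivalence
    {κ : Type*} [Fintype κ] (e : Module.Basis κ ℝ (MultiEquidist.Lie𝔤 E G))
    -- `Ad (exp w)` grows at most polynomially in `w ∈ Lie(U)`
    (hgrowth : ∃ B p : ℝ, ∀ (w : MultiEquidist.lieAlgOf E U) (i j : κ),
      |e.repr (MultiEquidist.Ad
          (MultiEquidist.lieExp (w : MultiEquidist.Lie𝔤 E G)) (e j)) i|
        ≤ B * (max 1 ‖b.equivFun w‖) ^ p)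
    -- `ν` is `U`-invariant and ergodic with discrete spectrum
    (ν : Measure (G ⧸ Γ)) [IsProbabilityMeasure ν] [ErgodicSMul U (G ⧸ Γ) ν]
    {Ξ : Type*} (ψ : HilbertBasis Ξ ℂ (Lp ℂ 2 ν)) (hψ : MultiEquidist.IsEigenbasis (E := E) ν U ψ)
    -- the norms: either a fixed `C^k` norm with `k ≥ 1`, or the Lipschitz-Sobolev norms
    (S : ℕ → (G ⧸ Γ → ℂ) → ℝ)
    (hS : (∃ k : ℕ, 1 ≤ k ∧ ∀ d φ, S d φ = MultiEquidist.ckNorm e k φ) ∨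
      (∃ k : ℕ, ∀ d φ, S d φ = MultiEquidist.lipSobolevNorm e μ k d φ))
    -- effective equidistribution of the translates `t ν`, `t ∈ T₊`
    (Tplus : Set T) (ρ : T → ℝ) (hρ : ∀ t ∈ Tplus, 1 ≤ ρ t)
    (hEQ1 : ∃ D δ : ℝ, 1 ≤ D ∧ 0 < δ ∧ δ < 1 ∧
      ∀ φ ∈ MultiEquidist.smoothAlg E Γ, ∀ t ∈ Tplus,
        ‖∫ x, φ ((t : G) • x) ∂ν - ∫ x, φ x ∂μ‖ ≤ D * ρ t ^ (-δ) * S 1 φ)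
    -- polynomial mixing along `U`
    (hEQ2 : ∃ C c : ℝ, 1 ≤ C ∧ 0 < c ∧ c < 1 / 2 ∧
      ∀ φ₁ ∈ MultiEquidist.smoothAlg E Γ, ∀ φ₂ ∈ MultiEquidist.smoothAlg E Γ,
        ∀ w : MultiEquidist.lieAlgOf E U,
          ‖∫ x, φ₁ (MultiEquidist.lieExp (w : MultiEquidist.Lie𝔤 E G) • x) * φ₂ x ∂μ
              - (∫ x, φ₁ x ∂μ) * ∫ x, φ₂ x ∂μ‖
            ≤ C * (max 1 ‖b.equivFun w‖) ^ (-c) * S 1 φ₁ * S 1 φ₂) :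
    ∃ H₁ H₂ l : ℝ, 0 < H₁ ∧ 0 < H₂ ∧ 1 < l ∧
      ∀ r : ℕ, 1 ≤ r → ∀ φ₀ ∈ MultiEquidist.wienerAlg ψ,
        ∀ φ : Fin r → (G ⧸ Γ → ℂ), (∀ i, φ i ∈ MultiEquidist.smoothAlg E Γ) →
        ∀ t : Fin r → T, (∀ i, t i ∈ Tplus) →
          H₂ ^ (((r - 1).factorial : ℝ) * (r.factorial : ℝ) * l ^ r) < MultiEquidist.Delta α ρ t →
          ‖∫ x, φ₀ x * ∏ i, φ i ((t i : G) • x) ∂ν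
              - (∫ x, φ₀ x ∂ν) * ∏ i, ∫ x, φ i x ∂μ‖
            ≤ r * H₁ * MultiEquidist.Delta α ρ t ^ (-(1 / ((r.factorial : ℝ) ^ 2 * l ^ r)))
              * MultiEquidist.wienerNorm ψ φ₀ * ∏ i, S (r + 1) (φ i) := by
  classical
  have : CompleteSpace E := FiniteDimensional.complete ℝ E
  have : IsTopologicalGroup G := topologicalGroup_of_lieGroup 𝓘(ℝ, E) ∞
  obtain ⟨Q, m, hSf⟩ : ∃ Q m, MultiEquidist.IsNormFamily e S Q m := by
    rcases hS with ⟨k, hk, h⟩ | ⟨k, h⟩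
    · exact ⟨_, _, MultiEquidist.isNormFamily_ckNorm hk h⟩
    · exact ⟨_, _, MultiEquidist.isNormFamily_lipSobolevNorm h⟩
  obtain ⟨D, δ, hD, hδ, -, hEQ1⟩ := hEQ1
  obtain ⟨C, c, hC, hc, hc2, hEQ2⟩ := hEQ2
  have hS0 : ∀ φ ∈ MultiEquidist.smoothAlg E Γ, ∀ d, 0 ≤ S d φ := fun φ hφ d =>
    (norm_nonneg _).trans (hSf.norm_le φ hφ d ((1 : G) : G ⧸ Γ))
  have hmem : ∀ {r : ℕ} {φ : Fin r → (G ⧸ Γ → ℂ)} (t : Fin r → T),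
      (∀ i, φ i ∈ MultiEquidist.smoothAlg E Γ) →
      MemLp (fun x => ∏ i, φ i ((t i : G) • x)) 2 ν := fun {r φ} t hφ => by
    refine MultiEquidist.memLp_of_mem (E := E) ?_ 2
    exact MultiEquidist.prod_mem_smoothAlg _ fun i _ =>
      MultiEquidist.comp_smul_mem_smoothAlg (hφ i) _
  -- It is enough to treat the basis functions `ψ ξ` with constants independent of `ξ`; summing over
  -- `ξ` produces the Wiener norm.
  suffices h : ∃ H₁ H₂ l : ℝ, 0 < H₁ ∧ 0 < H₂ ∧ 1 < l ∧ ∀ r : ℕ, 1 ≤ r →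
      ∀ φ : Fin r → (G ⧸ Γ → ℂ), (∀ i, φ i ∈ MultiEquidist.smoothAlg E Γ) →
      ∀ t : Fin r → T, (∀ i, t i ∈ Tplus) →
        H₂ ^ (((r - 1).factorial : ℝ) * (r.factorial : ℝ) * l ^ r) < MultiEquidist.Delta α ρ t →
        ∀ ξ, ‖∫ x, (ψ ξ : G ⧸ Γ → ℂ) x * ∏ i, φ i ((t i : G) • x) ∂ν
            - (∫ x, (ψ ξ : G ⧸ Γ → ℂ) x ∂ν) * ∏ i, ∫ x, φ i x ∂μ‖
          ≤ r * H₁ * MultiEquidist.Delta α ρ t ^ (-(1 / ((r.factorial : ℝ) ^ 2 * l ^ r)))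
            * ∏ i, S (r + 1) (φ i) by
    obtain ⟨H₁, H₂, l, hH₁, hH₂, hl, h⟩ := h
    refine ⟨H₁, H₂, l, hH₁, hH₂, hl, fun r hr φ₀ hφ₀ φ hφ t ht hΔ => ?_⟩
    refine (MultiEquidist.norm_integral_mul_sub_le ψ hφ₀ (hmem t hφ) _
      (h r hr φ hφ t ht hΔ)).trans_eq ?_
    ring
  cases isEmpty_or_nonempty ι with
  | inl hι =>
    have hbot : MultiEquidist.lieAlgOf E U = ⊥ :=
      Submodule.subsingleton_iff_eq_bot.1 (b.equivFun.injective.subsingleton)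
    have hU : U = ⊥ := MultiEquidist.eq_bot_of_lieAlgOf_eq_bot hUcl hUconn hbot
    -- For `l = max 2 (1 / δ)` the rate `1 / l` is at most the exponent `δ` of equidistribution.
    have hl1 : (1 : ℝ) < max 2 (1 / δ) := lt_max_of_lt_left one_lt_two
    refine ⟨D, 1, max 2 (1 / δ), by linarith, one_pos, hl1,
      fun r hr φ hφ t ht hΔ ξ => ?_⟩
    rw [Real.one_rpow] at hΔ
    -- Without weights `starNorm` is a supremum over the empty family, hence `0`, so that `Delta >
    -- 1` is impossible for two or more functions.
    obtain rfl : r = 1 := by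
      by_contra hr1
      have := MultiEquidist.Delta_le_starNorm (α := α) (ρ := ρ) t
        (i := ⟨0, by omega⟩) (j := ⟨1, by omega⟩) (by simp)
      rw [MultiEquidist.EquidistData.starNorm_of_isEmpty] at this
      linarith
    -- By ergodicity of the trivial group `ψ ξ` is almost everywhere a constant, of modulus at most
    -- `1` by normalisation; equidistribution of `t 0` then suffices.
    obtain ⟨z, hz⟩ := MultiEquidist.ae_eq_const_of_ergodicSMul_bot hU
      (Lp.aestronglyMeasurable (ψ ξ))
    have hz1 : ‖z‖ ≤ 1 := by
      have h1 := MultiEquidist.integral_sq_norm_hilbertBasis ψ ξ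
      rw [integral_congr_ae (g := fun _ => ‖z‖ ^ 2) (hz.mono fun x hx => by simp only [hx])] at h1
      simp only [integral_const, probReal_univ, one_smul] at h1
      exact (sq_le_one_iff₀ (norm_nonneg _)).1 h1.le
    have e1 : ∫ x, (ψ ξ : G ⧸ Γ → ℂ) x * ∏ i, φ i ((t i : G) • x) ∂ν
        - (∫ x, (ψ ξ : G ⧸ Γ → ℂ) x ∂ν) * ∏ i, ∫ x, φ i x ∂μ
        = z * (∫ x, φ 0 ((t 0 : G) • x) ∂ν - ∫ x, φ 0 x ∂μ) := by
      rw [integral_congr_ae hz, integral_congr_ae (hz.mono fun x hx => by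
        change _ = (fun x => z * φ 0 ((t 0 : G) • x)) x
        simp only [hx, Fin.prod_univ_one])]
      simp only [integral_const_mul, integral_const, probReal_univ, one_smul, Fin.prod_univ_one]
      ring
    have hΔ0 : MultiEquidist.Delta α ρ t ≤ ρ (t 0) := MultiEquidist.Delta_le_rho t 0
    have hb : MultiEquidist.Delta α ρ t ≥ 1 := hΔ.le
    rw [e1, norm_mul]
    simp only [Nat.factorial_one, Nat.cast_one, one_pow, one_mul, pow_one, Fin.prod_univ_one,
      Nat.reduceAdd]
    have h1 : ρ (t 0) ^ (-δ)
        ≤ MultiEquidist.Delta α ρ t ^ (-(1 / max 2 (1 / δ))) := by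
      calc ρ (t 0) ^ (-δ) ≤ MultiEquidist.Delta α ρ t ^ (-δ) :=
            Real.rpow_le_rpow_of_nonpos (by linarith) hΔ0 (by linarith)
        _ ≤ _ := by
            refine Real.rpow_le_rpow_of_exponent_le hb (neg_le_neg ?_)
            rw [div_le_iff₀ (by linarith), mul_comm, ← div_le_iff₀ hδ]
            exact le_max_right _ _
    calc ‖z‖ * ‖∫ x, φ 0 ((t 0 : G) • x) ∂ν - ∫ x, φ 0 x ∂μ‖
        ≤ 1 * (D * ρ (t 0) ^ (-δ) * S 1 (φ 0)) :=
          mul_le_mul hz1 (hEQ1 _ (hφ 0) _ (ht 0)) (norm_nonneg _) zero_le_one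
      _ ≤ D * MultiEquidist.Delta α ρ t ^ (-(1 / max 2 (1 / δ))) * S 2 (φ 0) := by
          rw [one_mul]
          have hDΔ : 0 ≤ D * MultiEquidist.Delta α ρ t ^ (-(1 / max 2 (1 / δ))) :=
            mul_nonneg (by linarith) (Real.rpow_nonneg (by linarith) _)
          exact mul_le_mul (mul_le_mul_of_nonneg_left h1 (by linarith)) (hSf.mono _ (hφ 0) 1)
            (hS0 _ (hφ 0) 1) hDΔ
  | inr hι =>
    obtain ⟨M, A, hdata⟩ := MultiEquidist.exists_equidistData hUcl hdiag hgrowth hSf hD hδ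
      hEQ1 hC hc hc2 hEQ2
    obtain ⟨H₁, H₂, l, hH₁, hH₂, hl, h⟩ := hdata.multipleBound
    refine ⟨H₁, H₂, l, hH₁, by linarith, hl, fun r hr φ hφ t ht hΔ ξ => ?_⟩
    exact h r (Fin r) Finset.univ (by simp) φ hφ t (fun i _ => ht i) _ hΔ
      (fun i _ => MultiEquidist.Delta_le_rho t i)
      (fun i _ j _ hij => MultiEquidist.Delta_le_starNorm t hij) _
      (MultiEquidist.isEigenfunction_hilbertBasis hψ ξ)
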